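/- Let $n\ge 0$ and $m\ge n+1$ be integers, $\alpha=\frac12+n$, $\beta=2m$, and consider the fourth Painlevé equation $$y''=\frac{(y')^2}{2y}+\frac32y^3+4xy^2+2(x^2-a)y-\frac{b}{2y},\qquad a=2\alpha-\frac{\beta}{2},\quad b=\beta^2. \tag{P4}$$ A solution is called classical if it is obtained from a meromorphic solution of a Riccati equation $y'=\sigma(y^2+2xy)+q$, $\sigma=\pm1$ (for which $a=-\sigma(\frac q2+1)$, $b=q^2$), by finitely many of the Bäcklund transformations $$R_0^+[y]=y+\frac{2(1+2\alpha)y}{y'-y^2-2xy-\beta},\quad R_0^-[y]=y+\frac{2(1-2\alpha)y}{y'+y^2+2xy+\beta},\quad R_\infty^{\pm}[y]=\pm\frac{y'}{2y}-\frac y2-x+\frac{\beta}{2y},$$ where $R_0^\pm$ acts by $\tilde\alpha=-\alpha\mp1$, $\tilde\alpha-\tilde\beta=\alpha-\beta$, and $R_\infty^\pm$ by $\tilde\alpha=-\alpha$, $\tilde\alpha-\tilde\beta=\alpha-\beta\pm1$. Let $\Theta(t)=0,\frac12,1$ for $t<0$, $t=0$, $t>0$. Then there are two families of classical solutions of (P4)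 that are meromorphic on $\mathbb C$, each indexed by $c\in\mathbb C\cup\{\infty\}$, with the following asymptotics as $|x|\to\infty$, uniformly in closed subsectors of each sector (with $\frac1\infty=0$, and $\frac{c}{1+2\sqrt\pi c}=\frac{1}{2\sqrt\pi}$ for $c=\infty$). **First family.** i) $\arg x\in(-\frac\pi4,\frac\pi4)$: for $c\ne\infty$, $y=-\frac{\beta}{2x}(1+O(x^{-2}))+\mu_1x^{2n+2m}e^{-x^2}(1+O(x^{-2}))$ with $\mu_1=-(c+i\sqrt\pi\,\Theta(\arg x))\frac{2^{n+m+1}}{n!\,(m-1)!}$; for $c=\infty$, $y=-2x(1+O(x^{-2}))$. ii) $\arg x\in(\frac\pi4,\frac{3\pi}4)$: if $c+i\sqrt\pi\ne0$, $y=-2x(1+O(x^{-2}))+\mu_2x^{4n-2m+2}e^{x^2}(1+O(x^{-2}))$ with $\mu_2=\frac{1}{c+i\sqrt\pi}(-1)^n2^{2n-m+1}\frac{(m-n-1)!}{n!}$; if $c+i\sqrt\pi=0$, $y=-\frac{\beta}{2x}(1+O(x^{-2}))$. iii) $\arg x\in(\frac{3\pi}4,\frac{5\pi}4)$: for $c\ne\infty$,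 $y=-\frac{\beta}{2x}(1+O(x^{-2}))+\mu_3x^{2n+2m}e^{-x^2}(1+O(x^{-2}))$ with $\mu_3=-(c+i\sqrt\pi\,\Theta(\pi-\arg x))\frac{2^{n+m+1}}{n!\,(m-1)!}$; for $c=\infty$, $y=-2x(1+O(x^{-2}))$. iv) $\arg x\in(\frac{5\pi}4,\frac{7\pi}4)$: if $c\ne0$, $y=-2x(1+O(x^{-2}))+\mu_4x^{4n-2m+2}e^{x^2}(1+O(x^{-2}))$ with $\mu_4=\frac1c(-1)^n2^{2n-m+1}\frac{(m-n-1)!}{n!}$; if $c=0$, $y=-\frac{\beta}{2x}(1+O(x^{-2}))$. **Second family.** i) $\arg x\in(-\frac\pi4,\frac\pi4)$: for $c\ne\infty$, $y=-2x(1+O(x^{-2}))+\mu_1x^{2m-4n-2}e^{-x^2}(1+O(x^{-2}))$ with $\mu_1=c\,(-1)^n2^{m-2n}\frac{n!}{(m-n-1)!}$; for $c=\infty$, $y=\frac{\beta}{2x}(1+O(x^{-2}))$. ii) $\arg x\in(\frac\pi4,\frac{3\pi}4)$: if $c\ne0$, $y=\frac{\beta}{2x}(1+O(x^{-2}))+\mu_2x^{4m-2n-2}e^{x^2}(1+O(x^{-2}))$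 with $\mu_2=-\bigl(\frac1c+2\sqrt\pi\,\Theta(\arg x-\frac\pi2)\bigr)(-1)^n\frac{2^{2m-n-1}}{(m-1)!\,(m-n-1)!}$; if $c=0$, $y=-2x(1+O(x^{-2}))$. iii) $\arg x\in(\frac{3\pi}4,\frac{5\pi}4)$: if $1+2\sqrt\pi c\ne0$, $y=-2x(1+O(x^{-2}))+\mu_3x^{2m-4n-2}e^{-x^2}(1+O(x^{-2}))$ with $\mu_3=\frac{c}{1+2\sqrt\pi c}(-1)^n2^{m-2n}\frac{n!}{(m-n-1)!}$; if $1+2\sqrt\pi c=0$, $y=\frac{\beta}{2x}(1+O(x^{-2}))$. iv) $\arg x\in(\frac{5\pi}4,\frac{7\pi}4)$: if $c\ne0$, $y=\frac{\beta}{2x}(1+O(x^{-2}))+\mu_4x^{4m-2n-2}e^{x^2}(1+O(x^{-2}))$ with $\mu_4=-\bigl(\frac1c+2\sqrt\pi\,\Theta(\frac{3\pi}2-\arg x)\bigr)(-1)^n\frac{2^{2m-n-1}}{(m-n-1)!\,(m-1)!}$; if $c=0$, $y=-2x(1+O(x^{-2}))$. In every formula $y=L(1+O(x^{-2}))+\mu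 x^pe^{\pm x^2}(1+O(x^{-2}))$, with $L\in\{-2x,\pm\frac{\beta}{2x}\}$, the algebraic part $L(1+O(x^{-2}))$ is a fixed function, the same for all $c$: on each side of the bisector of the sector it is a meromorphic solution of (P4) that has the asymptotics $L(1+O(x^{-2}))$, uniformly in closed subsectors, in the sector together with the neighbouring sector on that side (including the ray between them); on the bisector it is the arithmetic mean of these two solutions. If $\mu=0$ on the bisector, the second term is to be read there as $x^pe^{\pm x^2}O(x^{-2})$. -/

import Mathlib

open Complex Filter Topology

/-- `y` is a meromorphic solution on `ℂ`, not identically zero, of the fourth Painlevé equation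
`y'' = (y')² / (2y) + (3/2) y³ + 4 x y² + 2 (x² - a) y - b / (2y)`.
The equation holds off a closed discrete set (zeros and poles of `y`). -/
def IsP4Solution (a b : ℂ) (y : ℂ → ℂ) : Prop :=
  MeromorphicOn y Set.univ ∧
  ∀ᶠ x in codiscrete ℂ, y x ≠ 0 ∧
    deriv (deriv y) x = (deriv y x) ^ 2 / (2 * y x) + 3 / 2 * (y x) ^ 3 + 4 * x * (y x) ^ 2
      + 2 * (x ^ 2 - a) * y x - b / (2 * y x)

/-- `y` is a meromorphic solution on `ℂ`, not identically zero, of the Riccati equation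
`y' = σ (y² + 2 x y) + q`. -/
def IsRiccatiSolution (σ q : ℂ) (y : ℂ → ℂ) : Prop :=
  MeromorphicOn y Set.univ ∧
  ∀ᶠ x in codiscrete ℂ, y x ≠ 0 ∧ deriv y x = σ * ((y x) ^ 2 + 2 * x * y x) + q

/-- `w` is the meromorphic function, not identically zero, that is given by
`w x = f x + g x / d x` off a closed discrete set, where the denominator `d` does not vanish
identically. -/
def IsTransform (w f g d : ℂ → ℂ) : Prop :=
  MeromorphicOn w Set.univ ∧ ∀ᶠ x in codiscrete ℂ, w x ≠ 0 ∧ d x ≠ 0 ∧ w x = f x + g x / d x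

/-- Classical solutions of the fourth Painlevé equation with parameters `a`, `b`: the functions
obtained from solutions of the Riccati equations `y' = σ (y² + 2 x y) + q`, `σ² = 1`
(for which `a = -σ (q / 2 + 1)`, `b = q²`) by finitely many Bäcklund transformations
`R₀⁺, R₀⁻, R∞⁺, R∞⁻`. These act on the parameters `α, β` with `a = 2 α - β / 2`, `b = β²`. -/
inductive IsClassical : ℂ → ℂ → (ℂ → ℂ) → Prop
  | riccati (σ q : ℂ) (y : ℂ → ℂ) (hσ : σ ^ 2 = 1) (hy : IsRiccatiSolution σ q y) :
      IsClassical (-σ * (q / 2 + 1)) (q ^ 2) y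
  | zero_plus (α β α' β' : ℂ) (y w : ℂ → ℂ) (hy : IsClassical (2 * α - β / 2) (β ^ 2) y)
      (hα : α' = -α - 1) (hβ : α' - β' = α - β)
      (hw : IsTransform w y (fun x => 2 * (1 + 2 * α) * y x)
        (fun x => deriv y x - (y x) ^ 2 - 2 * x * y x - β)) :
      IsClassical (2 * α' - β' / 2) (β' ^ 2) w
  | zero_minus (α β α' β' : ℂ) (y w : ℂ → ℂ) (hy : IsClassical (2 * α - β / 2) (β ^ 2) y)
      (hα : α' = -α + 1) (hβ : α' - β' = α - β)
      (hw : IsTransform w y (fun x => 2 * (1 - 2 * α) * y x)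
        (fun x => deriv y x + (y x) ^ 2 + 2 * x * y x + β)) :
      IsClassical (2 * α' - β' / 2) (β' ^ 2) w
  | infty_plus (α β α' β' : ℂ) (y w : ℂ → ℂ) (hy : IsClassical (2 * α - β / 2) (β ^ 2) y)
      (hα : α' = -α) (hβ : α' - β' = α - β + 1)
      (hw : IsTransform w (fun x => -(y x) / 2 - x) (fun x => deriv y x + β)
        (fun x => 2 * y x)) :
      IsClassical (2 * α' - β' / 2) (β' ^ 2) w
  | infty_minus (α β α' β' : ℂ) (y w : ℂ → ℂ) (hy : IsClassical (2 * α - β / 2) (β ^ 2) y)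
      (hα : α' = -α) (hβ : α' - β' = α - β - 1)
      (hw : IsTransform w (fun x => -(y x) / 2 - x) (fun x => -deriv y x + β)
        (fun x => 2 * y x)) :
      IsClassical (2 * α' - β' / 2) (β' ^ 2) w

/-- The point of modulus `r` and argument `φ`. -/
noncomputable def polarPt (r φ : ℝ) : ℂ := (r : ℂ) * exp ((φ : ℂ) * I)

/-- The step function `Θ`, equal to `0`, `1/2`, `1` for negative, zero, positive argument. -/
noncomputable def stepTheta (t : ℝ) : ℂ := if t < 0 then 0 else if t = 0 then 1 / 2 else 1

/-- `y = L (1 + O(x⁻²))` as `|x| → ∞` in the sector `arg x ∈ (lo, hi)`,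
uniformly in closed subsectors. -/
def AlgAsymp (lo hi : ℝ) (L y : ℂ → ℂ) : Prop :=
  ∀ δ : ℝ, 0 < δ → ∃ C R : ℝ, 0 < R ∧ ∀ r φ : ℝ, R ≤ r → lo + δ ≤ φ → φ ≤ hi - δ →
    ‖y (polarPt r φ) - L (polarPt r φ)‖ ≤ C / r ^ 2 * ‖L (polarPt r φ)‖

/-- The quarter-plane sector with bisector `arg x = φ₀`. -/
def SectorAlgAsymp (φ₀ : ℝ) (L y : ℂ → ℂ) : Prop :=
  AlgAsymp (φ₀ - Real.pi / 4) (φ₀ + Real.pi / 4) L y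

/-- The algebraic backgrounds `L (1 + O(x⁻²))` for the quarter-plane sector with bisector
`arg x = φ₀`, below (`Bm`) and above (`Bp`) the bisector: the solutions of the fourth Painlevé
equation that keep the algebraic behaviour `L (1 + O(x⁻²))` also in the whole neighbouring
quarter-plane sector on the same side. A nonzero exponential term, small in the first sector,
would be large in the neighbouring one, so that each of the two backgrounds is free of it. -/
def IsBackgroundPair (a b : ℂ) (φ₀ : ℝ) (L Bm Bp : ℂ → ℂ) : Prop :=
  IsP4Solution a b Bm ∧ AlgAsymp (φ₀ - 3 * Real.pi / 4) (φ₀ + Real.pi / 4) L Bm ∧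
  IsP4Solution a b Bp ∧ AlgAsymp (φ₀ - Real.pi / 4) (φ₀ + 3 * Real.pi / 4) L Bp

/-- `y = B + μ x^p e^{σ x²} (1 + O(x⁻²))` as `|x| → ∞` in the quarter-plane sector with bisector
`arg x = φ₀`, uniformly in closed subsectors. Here `B` is `Bm` below the bisector, `Bp` above it
and their arithmetic mean on it, and the coefficient `μ` may depend on `arg x`. On the bisector
itself, if `μ` happens to vanish there, the second summand is read as
`x^p e^{σ x²} O(x⁻²)`. -/
def SectorExpAsymp (φ₀ : ℝ) (Bm Bp : ℂ → ℂ) (p : ℤ) (σ : ℂ) (μ : ℝ → ℂ) (y : ℂ → ℂ) : Prop :=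
  ∀ δ : ℝ, 0 < δ → ∃ C R : ℝ, 0 < R ∧ ∀ r φ : ℝ, R ≤ r →
    φ₀ - Real.pi / 4 + δ ≤ φ → φ ≤ φ₀ + Real.pi / 4 - δ →
    ∀ x B e : ℂ, x = polarPt r φ →
      B = (1 - stepTheta (φ - φ₀)) * Bm x + stepTheta (φ - φ₀) * Bp x →
      e = x ^ p * exp (σ * x ^ 2) →
      ‖y x - (B + μ φ * e)‖ ≤ C / r ^ 2 * ‖e‖ ∧
      (φ ≠ φ₀ ∨ μ φ ≠ 0 → ‖y x - (B + μ φ * e)‖ ≤ C / r ^ 2 * ‖μ φ * e‖)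

/-!
The fourth Painlevé equation is the equation of one component `f₁` of its symmetric form
`fᵢ' = fᵢ (fᵢ₊₁ - fᵢ₋₁) + aᵢ`, `f₀ + f₁ + f₂ = -2 x`, with `a = (a₀ - a₂) / 2` and `b = a₁²`. With
`k = m - n - 1`, the equation under consideration belongs to the parameters `(2n, -2m, 2k)`. For
`n = 0` there are the solutions with `f₀ = 0`, for which `f₁` satisfies a Riccati equation; for
`n = k = 0` this `f₁` is the logarithmic derivative of a solution `u` of `u' + 2 x u = const`
(`seed`), that is, up to the Gaussian `exp (-x²)`, of an affine function of the error function. The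
parameter `c` of the family is the coefficient of `exp (-x²)` in `u`. One recursion raises `k`
(`riccatiSeq`) and then a product of two simple reflections and a rotation of the indices raises
`n` (`Triple.raise`, `triple`). These maps are well defined because `fᵢ` cannot vanish identically
if `aᵢ ≠ 0`, and the chain of solutions is classical because `R∞⁺` is the passage from `f₁` to `f₂`
(`IsSymmetricSolution.isClassical_next`).

For the asymptotics, `u` is controlled in the closed right half-plane by the recurrence for the
moments of the error function integral, and beyond it by the reflection formula of the error
function (`relClose_erfcMoment`). In each sector there are two possible regimes, `f₂ ∼ -2 x` and
`f₁ ∼ -2 x` (`SecondDominant`, `FirstDominant`), and raising preserves either. In some components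
the leading terms cancel; but such a component is known to be `O(1/x)` and solves a linear
equation `f' = f A + s` with `A ∼ κ x`, whence `f ∼ -s / (κ x)`, since `f'` is negligible by
Cauchy's estimate (`isBigO_of_linear_ode`). The exponentially small terms come from comparing two
solutions with different `c` in the same regime: their difference is multiplied in each step by an
explicit monomial up to a factor `1 + O(x⁻²)`
(`SecondDominant.sub_raise`, `FirstDominant.sub_raise`), and the product of these factors gives
the constants `μ` (`triple_sub_small`, `triple_sub_large`).

The algebraic backgrounds are the solutions of the family for `c = 0` and `c = -i √π`, for which
`u ∼ 1 / (2 x)` holds in an angle of opening `3π / 2`, and for `c = ∞`. The second family is the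
image of the first, with `n` and `k` interchanged, under the symmetry `y(x) ↦ -i y(i x)`, which
maps `(a, b)` to `(-a, b)` (`quarterTurn`).
-/

/-! ### The symmetric form and the translation of the parameters -/

/-- The symmetric form of the fourth Painlevé equation at the point `x`: three functions with sum
`-2 x` that satisfy `fᵢ' = fᵢ (fᵢ₊₁ - fᵢ₋₁) + aᵢ`, the indices being read modulo three. -/
structure SymmetricAt (a₀ a₁ a₂ : ℂ) (f₀ f₁ f₂ : ℂ → ℂ) (x : ℂ) : Prop where
  sum_eq : f₀ x + f₁ x + f₂ x = -2 * x
  deriv₀ : HasDerivAt f₀ (f₀ x * (f₁ x - f₂ x) + a₀) x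
  deriv₁ : HasDerivAt f₁ (f₁ x * (f₂ x - f₀ x) + a₁) x
  deriv₂ : HasDerivAt f₂ (f₂ x * (f₀ x - f₁ x) + a₂) x

namespace SymmetricAt

variable {a₀ a₁ a₂ : ℂ} {f₀ f₁ f₂ : ℂ → ℂ} {x : ℂ}

theorem rotate (h : SymmetricAt a₀ a₁ a₂ f₀ f₁ f₂ x) : SymmetricAt a₁ a₂ a₀ f₁ f₂ f₀ x :=
  ⟨by rw [← h.sum_eq]; ring, h.deriv₁, h.deriv₂, h.deriv₀⟩

/-- The simple reflection in the middle root acts on solutions of the symmetric form. -/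
theorem reflect (h : SymmetricAt a₀ a₁ a₂ f₀ f₁ f₂ x) (h0 : f₁ x ≠ 0) :
    SymmetricAt (a₀ + a₁) (-a₁) (a₂ + a₁)
      (fun z => f₀ z - a₁ / f₁ z) f₁ (fun z => f₂ z + a₁ / f₁ z) x := by
  have hq : HasDerivAt (fun z => a₁ / f₁ z)
      ((0 * f₁ x - a₁ * (f₁ x * (f₂ x - f₀ x) + a₁)) / f₁ x ^ 2) x :=
    (hasDerivAt_const x a₁).div h.deriv₁ h0
  refine ⟨by rw [← h.sum_eq]; ring, (h.deriv₀.sub hq).congr_deriv ?_,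
    h.deriv₁.congr_deriv ?_, (h.deriv₂.add hq).congr_deriv ?_⟩
  · field_simp; ring
  · field_simp; ring
  · field_simp; ring

end SymmetricAt

/-- A meromorphic triple that satisfies the symmetric form of the fourth Painlevé equation off a
closed discrete set. -/
structure IsSymmetricSolution (a₀ a₁ a₂ : ℂ) (f₀ f₁ f₂ : ℂ → ℂ) : Prop where
  mero₀ : MeromorphicOn f₀ Set.univ
  mero₁ : MeromorphicOn f₁ Set.univ
  mero₂ : MeromorphicOn f₂ Set.univ
  system : ∀ᶠ x in codiscrete ℂ, SymmetricAt a₀ a₁ a₂ f₀ f₁ f₂ x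

theorem eventually_codiscrete_iff {P : ℂ → Prop} :
    (∀ᶠ x in codiscrete ℂ, P x) ↔ ∀ x, ∀ᶠ y in 𝓝[≠] x, P y := by
  rw [Filter.Eventually, mem_codiscrete]
  simp only [disjoint_principal_right, compl_compl]
  rfl

theorem eventually_codiscrete_nhds {P : ℂ → Prop} (h : ∀ᶠ x in codiscrete ℂ, P x) :
    ∀ᶠ x in codiscrete ℂ, ∀ᶠ y in 𝓝 x, P y := by
  have ho := (mem_codiscrete'.1 h).1
  filter_upwards [h] with x hx
  exact ho.mem_nhds hx

theorem exists_of_eventually_codiscrete {P : ℂ → Prop} (h : ∀ᶠ x in codiscrete ℂ, P x) :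
    ∃ x, P x :=
  ((eventually_codiscrete_iff.1 h) 0).exists

/-- A meromorphic solution of `f' = f h + s` with a constant `s ≠ 0` has only isolated zeros. -/
theorem eventually_ne_zero_of_linear_ode {f h : ℂ → ℂ} {s : ℂ} (hs : s ≠ 0)
    (hf : MeromorphicOn f Set.univ)
    (hd : ∀ᶠ x in codiscrete ℂ, HasDerivAt f (f x * h x + s) x) :
    ∀ᶠ x in codiscrete ℂ, f x ≠ 0 := by
  rw [eventually_codiscrete_iff]
  intro x
  rcases (hf x trivial).eventually_eq_zero_or_eventually_ne_zero with h0 | h0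
  · exfalso
    have h1 : ∀ᶠ p in 𝓝[≠] x, ∀ᶠ z in 𝓝 p, f z = 0 := eventually_nhdsNE_eventually_nhds_iff.2 h0
    obtain ⟨p, hp1, hp2⟩ := (h1.and (eventually_codiscrete_iff.1 hd x)).exists
    have h2 : deriv f p = 0 := by
      rw [Filter.EventuallyEq.deriv_eq (f := fun _ => (0 : ℂ)) hp1, deriv_const]
    rw [hp2.deriv, hp1.self_of_nhds] at h2
    exact hs (by simpa using h2)
  · exact h0

namespace IsSymmetricSolution

variable {a₀ a₁ a₂ : ℂ} {f₀ f₁ f₂ : ℂ → ℂ}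

theorem rotate (h : IsSymmetricSolution a₀ a₁ a₂ f₀ f₁ f₂) :
    IsSymmetricSolution a₁ a₂ a₀ f₁ f₂ f₀ :=
  ⟨h.mero₁, h.mero₂, h.mero₀, h.system.mono fun _ hx => hx.rotate⟩

theorem ne_zero (h : IsSymmetricSolution a₀ a₁ a₂ f₀ f₁ f₂) (ha : a₁ ≠ 0) :
    ∀ᶠ x in codiscrete ℂ, f₁ x ≠ 0 :=
  eventually_ne_zero_of_linear_ode ha h.mero₁ (h.system.mono fun _ hx => hx.deriv₁)

/-- The parameters of a solution of the symmetric form have sum `-2`. -/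
theorem param_sum (h : IsSymmetricSolution a₀ a₁ a₂ f₀ f₁ f₂) : a₀ + a₁ + a₂ = -2 := by
  obtain ⟨x, hx, hs⟩ :=
    exists_of_eventually_codiscrete (h.system.and (eventually_codiscrete_nhds h.system))
  have h1 := (hx.deriv₀.add hx.deriv₁).add hx.deriv₂
  have h2 : HasDerivAt (fun z : ℂ => -2 * z) (-2) x := by
    simpa using (hasDerivAt_id x).const_mul (-2 : ℂ)
  have h3 : (f₀ + f₁ + f₂) =ᶠ[𝓝 x] fun z => -2 * z := hs.mono fun z hz => hz.sum_eq
  have h4 := h1.unique (h2.congr_of_eventuallyEq h3)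
  rw [← h4]; ring

/-- Each component of the symmetric form solves the fourth Painlevé equation. -/
theorem isP4Solution (h : IsSymmetricSolution a₀ a₁ a₂ f₀ f₁ f₂) (ha : a₁ ≠ 0) :
    IsP4Solution ((a₀ - a₂) / 2) (a₁ ^ 2) f₁ := by
  refine ⟨h.mero₁, ?_⟩
  filter_upwards [h.system, eventually_codiscrete_nhds h.system, h.ne_zero ha] with x hx hs h0
  refine ⟨h0, ?_⟩
  have h1 : deriv f₁ =ᶠ[𝓝 x] fun z => f₁ z * (f₂ z - f₀ z) + a₁ :=
    hs.mono fun z hz => hz.deriv₁.deriv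
  have h2 := ((hx.deriv₁.mul (hx.deriv₂.sub hx.deriv₀)).add_const a₁).deriv
  have h3 : deriv (fun z => f₁ z * (f₂ z - f₀ z) + a₁) x = _ := h2
  rw [h1.deriv_eq, h3, hx.deriv₁.deriv]
  have e0 : f₀ x = -2 * x - f₁ x - f₂ x := by linear_combination hx.sum_eq
  have ep : a₁ = -2 - a₀ - a₂ := by linear_combination h.param_sum
  simp only [Pi.sub_apply]
  rw [e0]
  field_simp
  rw [ep]
  ring

/-- The Bäcklund transformation `R∞⁺` moves one step along the triple. -/
theorem isClassical_next (h : IsSymmetricSolution a₀ a₁ a₂ f₀ f₁ f₂) (ha₁ : a₁ ≠ 0)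
    (ha₂ : a₂ ≠ 0) (hc : IsClassical ((a₀ - a₂) / 2) (a₁ ^ 2) f₁) :
    IsClassical ((a₁ - a₀) / 2) (a₂ ^ 2) f₂ := by
  have hs := h.param_sum
  have h1 := IsClassical.infty_plus ((a₀ - a₂ - a₁) / 4) (-a₁) (-((a₀ - a₂ - a₁) / 4)) a₂ f₁ f₂
    (by convert hc using 1 <;> ring) rfl (by linear_combination (-1 / 2 : ℂ) * hs) ?_
  · convert h1 using 1
    ring
  · refine ⟨h.mero₂, ?_⟩
    filter_upwards [h.system, h.ne_zero ha₁, h.rotate.ne_zero ha₂] with x hx h1 h2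
    refine ⟨h2, mul_ne_zero two_ne_zero h1, ?_⟩
    have e0 : f₀ x = -2 * x - f₁ x - f₂ x := by linear_combination hx.sum_eq
    rw [hx.deriv₁.deriv, e0]
    field_simp
    ring

end IsSymmetricSolution

/-- Three functions, thought of as a solution of the symmetric form of the fourth Painlevé
equation. -/
structure Triple where
  f₀ : ℂ → ℂ
  f₁ : ℂ → ℂ
  f₂ : ℂ → ℂ

/-- The translation `(2n, -2m, 2k) ↦ (2(n+1), -2(m+1), 2k)` of the parameters, as a product of two
simple reflections and a rotation of the indices. -/
noncomputable def Triple.raise (m n : ℂ) (f : Triple) : Triple where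
  f₀ := fun x => f.f₂ x - 2 * m / f.f₁ x
  f₁ := fun x => f.f₀ x + 2 * m / f.f₁ x - 2 * (n + 1) / (f.f₂ x - 2 * m / f.f₁ x)
  f₂ := fun x => f.f₁ x + 2 * (n + 1) / (f.f₂ x - 2 * m / f.f₁ x)

/-- The triple between the two reflections of which `Triple.raise` is composed. -/
theorem SymmetricAt.first_reflection {n m k : ℂ} (hm : m = n + k + 1) {f : Triple} {x : ℂ}
    (h : SymmetricAt (2 * n) (-2 * m) (2 * k) f.f₀ f.f₁ f.f₂ x) (h1 : f.f₁ x ≠ 0) :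
    SymmetricAt (2 * m) (-2 * (n + 1)) (2 * (n - m)) f.f₁ (f.raise m n).f₀
      (fun z => f.f₀ z + 2 * m / f.f₁ z) x := by
  have := (h.reflect h1).rotate
  subst hm
  convert this using 1
  · ring
  · ring
  · ring
  · funext z; simp only [Triple.raise]; ring
  · funext z; ring

theorem SymmetricAt.raise {n m k : ℂ} (hm : m = n + k + 1) {f : Triple} {x : ℂ}
    (h : SymmetricAt (2 * n) (-2 * m) (2 * k) f.f₀ f.f₁ f.f₂ x) (h1 : f.f₁ x ≠ 0)
    (h2 : (f.raise m n).f₀ x ≠ 0) :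
    SymmetricAt (2 * (n + 1)) (-2 * (m + 1)) (2 * k) (f.raise m n).f₀ (f.raise m n).f₁
      (f.raise m n).f₂ x := by
  have := ((h.first_reflection hm h1).reflect h2).rotate
  subst hm
  convert this using 1
  · ring
  · ring
  · ring
  · funext z; simp only [Triple.raise]; ring
  · funext z; simp only [Triple.raise]; ring

theorem IsSymmetricSolution.first_reflection {n m k : ℂ} (hm : m = n + k + 1) (hm0 : m ≠ 0)
    {f : Triple} (h : IsSymmetricSolution (2 * n) (-2 * m) (2 * k) f.f₀ f.f₁ f.f₂) :
    IsSymmetricSolution (2 * m) (-2 * (n + 1)) (2 * (n - m)) f.f₁ (f.raise m n).f₀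
      (fun z => f.f₀ z + 2 * m / f.f₁ z) := by
  have hc : MeromorphicOn (fun _ : ℂ => 2 * m) Set.univ := fun z _ => MeromorphicAt.const _ z
  refine ⟨h.mero₁, h.mero₂.sub (hc.div h.mero₁), h.mero₀.add (hc.div h.mero₁), ?_⟩
  filter_upwards [h.system, h.ne_zero (by simpa using hm0)] with x hx h1
  exact hx.first_reflection hm h1

theorem IsSymmetricSolution.raise {n m k : ℂ} (hm : m = n + k + 1) (hm0 : m ≠ 0)
    (hn0 : n + 1 ≠ 0) {f : Triple}
    (h : IsSymmetricSolution (2 * n) (-2 * m) (2 * k) f.f₀ f.f₁ f.f₂) :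
    IsSymmetricSolution (2 * (n + 1)) (-2 * (m + 1)) (2 * k) (f.raise m n).f₀ (f.raise m n).f₁
      (f.raise m n).f₂ := by
  have hg := h.first_reflection hm hm0
  have hc : MeromorphicOn (fun _ : ℂ => 2 * (n + 1)) Set.univ :=
    fun z _ => MeromorphicAt.const _ z
  refine ⟨hg.mero₁, hg.mero₂.sub (hc.div hg.mero₁), hg.mero₀.add (hc.div hg.mero₁), ?_⟩
  filter_upwards [h.system, h.ne_zero (by simpa using hm0), hg.ne_zero (by simpa using hn0)]
    with x hx h1 h2
  exact hx.raise hm h1 h2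

/-- The reflection in `a₁` does not change `f₁`; from there two applications of `R∞⁺` lead to the
middle component of the raised triple, the second one after the reflection in the new middle root,
which does not change the function reached by the first. -/
theorem IsSymmetricSolution.isClassical_raise {n m k : ℂ} (hm : m = n + k + 1) (hm0 : m ≠ 0)
    (hm1 : m + 1 ≠ 0) (hn0 : n + 1 ≠ 0) {f : Triple}
    (h : IsSymmetricSolution (2 * n) (-2 * m) (2 * k) f.f₀ f.f₁ f.f₂)
    (hc : IsClassical (n - k) ((-2 * m) ^ 2) f.f₁) :
    IsClassical (n + 1 - k) ((-2 * (m + 1)) ^ 2) (f.raise m n).f₁ := by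
  have hg := (h.first_reflection hm hm0).rotate.rotate
  have h1 := hg.isClassical_next (by simpa using hm0) (by simpa using hn0)
    (by subst hm; convert hc using 1 <;> ring)
  have h2 := (h.raise hm hm0 hn0).rotate.rotate.isClassical_next (by simpa using hn0)
    (by simpa using hm1) (by subst hm; convert h1 using 1 <;> ring)
  convert h2 using 1
  ring

/-- The solutions of the Riccati equations `y' = -(y² + 2 x y) - 2 (k + 1)` that come from a
solution `y₀` for `k = 0`. -/
noncomputable def riccatiSeq (y₀ : ℂ → ℂ) : ℕ → ℂ → ℂ
  | 0 => y₀
  | k + 1 => fun x => -2 * x - 2 * ((k : ℂ) + 1) / riccatiSeq y₀ k x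

/-- The recursion of `riccatiSeq` raises the constant of the Riccati equation. -/
theorem hasDerivAt_riccati_succ {y : ℂ → ℂ} {κ x : ℂ}
    (h : HasDerivAt y (-(y x ^ 2 + 2 * x * y x) - 2 * κ) x) (h0 : y x ≠ 0) :
    HasDerivAt (fun z => -2 * z - 2 * κ / y z)
      (-((-2 * x - 2 * κ / y x) ^ 2 + 2 * x * (-2 * x - 2 * κ / y x)) - 2 * (κ + 1)) x := by
  have hq : HasDerivAt (fun z => 2 * κ / y z) _ x := (hasDerivAt_const x (2 * κ)).div h h0
  refine (((hasDerivAt_id x).const_mul (-2 : ℂ)).sub hq).congr_deriv ?_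
  field_simp
  ring

theorem symmetricAt_of_riccati {y : ℂ → ℂ} {k x : ℂ}
    (h : HasDerivAt y (-(y x ^ 2 + 2 * x * y x) - 2 * (k + 1)) x) :
    SymmetricAt 0 (-2 * (k + 1)) (2 * k) (fun _ => 0) y (fun z => -2 * z - y z) x := by
  refine ⟨by ring, by simpa using hasDerivAt_const x (0 : ℂ), h.congr_deriv (by ring), ?_⟩
  refine (((hasDerivAt_id x).const_mul (-2 : ℂ)).sub h).congr_deriv ?_
  ring

/-- The triple with parameters `(2n, -2(n+k+1), 2k)` obtained from the solution `y₀` of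
`y' = -(y² + 2 x y) - 2`. -/
noncomputable def triple (y₀ : ℂ → ℂ) (k : ℕ) : ℕ → Triple
  | 0 => ⟨fun _ => 0, riccatiSeq y₀ k, fun z => -2 * z - riccatiSeq y₀ k z⟩
  | n + 1 => (triple y₀ k n).raise ((n : ℂ) + k + 1) n

theorem symmetricAt_triple_zero {y₀ : ℂ → ℂ} {k : ℕ} {x : ℂ}
    (h : HasDerivAt (riccatiSeq y₀ k)
      (-(riccatiSeq y₀ k x ^ 2 + 2 * x * riccatiSeq y₀ k x) - 2 * ((k : ℂ) + 1)) x) :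
    SymmetricAt (2 * ((0 : ℕ) : ℂ)) (-2 * (((0 : ℕ) : ℂ) + k + 1)) (2 * (k : ℂ))
      (triple y₀ k 0).f₀ (triple y₀ k 0).f₁ (triple y₀ k 0).f₂ x := by
  have h1 := symmetricAt_of_riccati h
  have e1 : 2 * ((0 : ℕ) : ℂ) = 0 := by simp
  have e2 : -2 * (((0 : ℕ) : ℂ) + k + 1) = -2 * ((k : ℂ) + 1) := by simp
  rw [e1, e2]
  exact h1

theorem natCast_add_add_one_ne_zero (n k : ℕ) : (n : ℂ) + k + 1 ≠ 0 := by
  exact_mod_cast Nat.succ_ne_zero (n + k)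

section Global

variable {y₀ : ℂ → ℂ}

/-- Each member of the sequence is meromorphic, solves its Riccati equation and has only isolated
zeros, so that the next member is well defined. -/
theorem riccatiSeq_solution (hm : MeromorphicOn y₀ Set.univ)
    (hd : ∀ᶠ x in codiscrete ℂ, HasDerivAt y₀ (-(y₀ x ^ 2 + 2 * x * y₀ x) - 2) x) (k : ℕ) :
    MeromorphicOn (riccatiSeq y₀ k) Set.univ ∧
    (∀ᶠ x in codiscrete ℂ, HasDerivAt (riccatiSeq y₀ k)
      (-(riccatiSeq y₀ k x ^ 2 + 2 * x * riccatiSeq y₀ k x) - 2 * ((k : ℂ) + 1)) x) ∧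
    (∀ᶠ x in codiscrete ℂ, riccatiSeq y₀ k x ≠ 0) := by
  have key : ∀ (k : ℕ) (f : ℂ → ℂ), MeromorphicOn f Set.univ →
      (∀ᶠ x in codiscrete ℂ, HasDerivAt f
        (-(f x ^ 2 + 2 * x * f x) - 2 * ((k : ℂ) + 1)) x) →
      ∀ᶠ x in codiscrete ℂ, f x ≠ 0 := fun k f h1 h2 => by
    have hk : (k : ℂ) + 1 ≠ 0 := Nat.cast_add_one_ne_zero k
    refine eventually_ne_zero_of_linear_ode (h := fun x => -f x - 2 * x)
      (s := -2 * ((k : ℂ) + 1)) (by simpa using hk) h1 ?_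
    exact h2.mono fun x hx => hx.congr_deriv (by ring)
  induction k with
  | zero =>
    have h2 : ∀ᶠ x in codiscrete ℂ, HasDerivAt y₀
        (-(y₀ x ^ 2 + 2 * x * y₀ x) - 2 * (((0 : ℕ) : ℂ) + 1)) x :=
      hd.mono fun x hx => hx.congr_deriv (by push_cast; ring)
    exact ⟨hm, h2, key 0 _ hm h2⟩
  | succ k ih =>
    obtain ⟨h1, h2, h3⟩ := ih
    have hx : MeromorphicOn (fun z : ℂ => -2 * z) Set.univ :=
      fun z _ => (MeromorphicAt.const (-2 : ℂ) z).mul (MeromorphicAt.id z)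
    have hc : MeromorphicOn (fun _ : ℂ => 2 * ((k : ℂ) + 1)) Set.univ :=
      fun z _ => MeromorphicAt.const _ z
    have h4 : MeromorphicOn (riccatiSeq y₀ (k + 1)) Set.univ := hx.sub (hc.div h1)
    have h5 : ∀ᶠ x in codiscrete ℂ, HasDerivAt (riccatiSeq y₀ (k + 1))
        (-(riccatiSeq y₀ (k + 1) x ^ 2 + 2 * x * riccatiSeq y₀ (k + 1) x)
          - 2 * (((k + 1 : ℕ) : ℂ) + 1)) x := by
      filter_upwards [h2, h3] with x hx h0
      rw [Nat.cast_add_one]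
      exact hasDerivAt_riccati_succ hx h0
    exact ⟨h4, h5, key (k + 1) _ h4 h5⟩

theorem triple_solution (hm : MeromorphicOn y₀ Set.univ)
    (hd : ∀ᶠ x in codiscrete ℂ, HasDerivAt y₀ (-(y₀ x ^ 2 + 2 * x * y₀ x) - 2) x) (k n : ℕ) :
    IsSymmetricSolution (2 * (n : ℂ)) (-2 * ((n : ℂ) + k + 1)) (2 * (k : ℂ))
      (triple y₀ k n).f₀ (triple y₀ k n).f₁ (triple y₀ k n).f₂ ∧
    IsClassical ((n : ℂ) - k) ((-2 * ((n : ℂ) + k + 1)) ^ 2) (triple y₀ k n).f₁ := by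
  induction n with
  | zero =>
    obtain ⟨h1, h2, h3⟩ := riccatiSeq_solution hm hd k
    have hx : MeromorphicOn (fun z : ℂ => -2 * z) Set.univ :=
      fun z _ => (MeromorphicAt.const (-2 : ℂ) z).mul (MeromorphicAt.id z)
    refine ⟨⟨fun z _ => MeromorphicAt.const 0 z, h1, hx.sub h1, ?_⟩, ?_⟩
    · filter_upwards [h2] with x hx
      exact symmetricAt_triple_zero hx
    · have hc := IsClassical.riccati (-1) (-2 * ((k : ℂ) + 1)) (riccatiSeq y₀ k) (by norm_num)
        ⟨h1, by
          filter_upwards [h2, h3] with x hx h0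
          exact ⟨h0, by rw [hx.deriv]; ring⟩⟩
      have e1 : -(-1) * (-2 * ((k : ℂ) + 1) / 2 + 1) = ((0 : ℕ) : ℂ) - k := by push_cast; ring
      have e2 : -2 * ((k : ℂ) + 1) = -2 * (((0 : ℕ) : ℂ) + k + 1) := by push_cast; ring
      rw [e1, e2] at hc
      exact hc
  | succ n ih =>
    have hm0 := natCast_add_add_one_ne_zero n k
    have hm1 : (n : ℂ) + k + 1 + 1 ≠ 0 := by exact_mod_cast Nat.succ_ne_zero (n + k + 1)
    have hn0 : (n : ℂ) + 1 ≠ 0 := Nat.cast_add_one_ne_zero n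
    have h1 := ih.1.raise rfl hm0 hn0
    have h2 := ih.1.isClassical_raise rfl hm0 hm1 hn0 ih.2
    have e : (((n + 1 : ℕ) : ℂ) + k + 1) = (n : ℂ) + k + 1 + 1 := by push_cast; ring
    rw [e, Nat.cast_add_one]
    exact ⟨h1, h2⟩

end Global

/-! ### Moments of the complementary error function -/

/-- The moments `∫₀^∞ s^j exp(-s² - 2 s z) ds`; for `j = 0` this is `(√π / 2) exp(z²) erfc z`. -/
noncomputable def erfcMoment (j : ℕ) (z : ℂ) : ℂ :=
  ∫ s in Set.Ioi (0 : ℝ), (s : ℂ) ^ j * exp (-(s : ℂ) ^ 2 - 2 * s * z)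

theorem norm_moment_integrand_le (j : ℕ) {z : ℂ} {M s : ℝ} (hz : -z.re ≤ M) (hs : 0 < s) :
    ‖(s : ℂ) ^ j * exp (-(s : ℂ) ^ 2 - 2 * s * z)‖
      ≤ Real.exp (2 * M ^ 2) * (s ^ (j : ℝ) * Real.exp (-(1 / 2) * s ^ 2)) := by
  have h1 : (-(s : ℂ) ^ 2 - 2 * s * z).re = -s ^ 2 - 2 * s * z.re := by
    simp [pow_two]
  rw [norm_mul, norm_pow, norm_exp, h1, Complex.norm_real, Real.norm_of_nonneg hs.le,
    Real.rpow_natCast, mul_left_comm, ← Real.exp_add]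
  gcongr
  -- `-s² + 2 s M ≤ 2 M² - s² / 2`, which is `(s - 2 M)² ≥ 0`.
  nlinarith [sq_nonneg (s - 2 * M), mul_le_mul_of_nonneg_left hz hs.le]

theorem integrable_moment_bound (j : ℕ) (C : ℝ) :
    MeasureTheory.IntegrableOn
      (fun s : ℝ => C * (s ^ (j : ℝ) * Real.exp (-(1 / 2) * s ^ 2))) (Set.Ioi 0) :=
  (integrableOn_rpow_mul_exp_neg_mul_sq (by norm_num)
    (lt_of_lt_of_le (by norm_num) (Nat.cast_nonneg j))).const_mul C

theorem continuous_moment_integrand (j : ℕ) (z : ℂ) :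
    Continuous fun s : ℝ => (s : ℂ) ^ j * exp (-(s : ℂ) ^ 2 - 2 * s * z) := by fun_prop

theorem integrable_moment_integrand (j : ℕ) (z : ℂ) :
    MeasureTheory.IntegrableOn
      (fun s : ℝ => (s : ℂ) ^ j * exp (-(s : ℂ) ^ 2 - 2 * s * z)) (Set.Ioi 0) := by
  refine MeasureTheory.Integrable.mono' (integrable_moment_bound j (Real.exp (2 * (-z.re) ^ 2)))
    (continuous_moment_integrand j z).aestronglyMeasurable ?_
  filter_upwards [MeasureTheory.ae_restrict_mem measurableSet_Ioi] with s hs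
  exact norm_moment_integrand_le j le_rfl hs

/-- The moments are bounded in the closed right half-plane. -/
theorem exists_norm_erfcMoment_le (j : ℕ) : ∃ C : ℝ, ∀ z : ℂ, 0 ≤ z.re → ‖erfcMoment j z‖ ≤ C := by
  refine ⟨_, fun z hz => MeasureTheory.norm_integral_le_of_norm_le
    (integrable_moment_bound j (Real.exp (2 * 0 ^ 2))) ?_⟩
  filter_upwards [MeasureTheory.ae_restrict_mem measurableSet_Ioi] with s hs
  exact norm_moment_integrand_le j (by linarith) hs

theorem hasDerivAt_moment_integrand (j : ℕ) (z : ℂ) (s : ℝ) :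
    HasDerivAt (fun w : ℂ => (s : ℂ) ^ j * exp (-(s : ℂ) ^ 2 - 2 * s * w))
      (-2 * ((s : ℂ) ^ (j + 1) * exp (-(s : ℂ) ^ 2 - 2 * s * z))) z := by
  have h1 : HasDerivAt (fun w : ℂ => -(s : ℂ) ^ 2 - 2 * s * w) (-(2 * (s : ℂ))) z := by
    simpa using ((hasDerivAt_id z).const_mul (2 * (s : ℂ))).const_sub (-(s : ℂ) ^ 2)
  refine (h1.cexp.const_mul ((s : ℂ) ^ j)).congr_deriv ?_
  ring

theorem hasDerivAt_erfcMoment (j : ℕ) (z : ℂ) :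
    HasDerivAt (erfcMoment j) (-2 * erfcMoment (j + 1) z) z := by
  have h := hasDerivAt_integral_of_dominated_loc_of_deriv_le
    (μ := MeasureTheory.volume.restrict (Set.Ioi (0 : ℝ)))
    (F := fun (w : ℂ) (s : ℝ) => (s : ℂ) ^ j * exp (-(s : ℂ) ^ 2 - 2 * s * w))
    (F' := fun (w : ℂ) (s : ℝ) => -2 * ((s : ℂ) ^ (j + 1) * exp (-(s : ℂ) ^ 2 - 2 * s * w)))
    (bound := fun s : ℝ => 2 * (Real.exp (2 * (‖z‖ + 1) ^ 2) *
      (s ^ ((j + 1 : ℕ) : ℝ) * Real.exp (-(1 / 2) * s ^ 2))))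
    (Metric.ball_mem_nhds z one_pos)
    (Filter.Eventually.of_forall fun w =>
      (continuous_moment_integrand j w).aestronglyMeasurable)
    (integrable_moment_integrand j z)
    ((continuous_moment_integrand (j + 1) z).aestronglyMeasurable.const_mul (-2 : ℂ))
    ?_ ((integrable_moment_bound (j + 1) _).const_mul 2) ?_
  · refine h.2.congr_deriv ?_
    rw [MeasureTheory.integral_const_mul]
    rfl
  · filter_upwards [MeasureTheory.ae_restrict_mem measurableSet_Ioi] with s hs w hw
    rw [norm_mul, norm_neg, Complex.norm_ofNat]
    refine mul_le_mul_of_nonneg_left (norm_moment_integrand_le (j + 1) ?_ hs) zero_le_two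
    have h1 : ‖w‖ ≤ ‖z‖ + 1 := by
      have := norm_le_norm_add_norm_sub' w z
      rw [Metric.mem_ball, dist_eq_norm] at hw
      linarith
    linarith [abs_re_le_norm w, neg_abs_le w.re]
  · exact Filter.Eventually.of_forall fun s w _ => hasDerivAt_moment_integrand j w s

theorem tendsto_moment_integrand (j : ℕ) (z : ℂ) :
    Tendsto (fun s : ℝ => (s : ℂ) ^ j * exp (-(s : ℂ) ^ 2 - 2 * s * z)) atTop (𝓝 0) := by
  have h0 : -(1 / 2 : ℝ) < 0 := by norm_num
  have h := (rpow_mul_exp_neg_mul_sq_isLittleO_exp_neg (b := 1 / 2) (by norm_num)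
    (j : ℝ)).trans_tendsto
      (Real.tendsto_exp_atBot.comp (tendsto_id.const_mul_atTop_of_neg h0))
  have h1 := h.const_mul (Real.exp (2 * (-z.re) ^ 2))
  rw [mul_zero] at h1
  refine squeeze_zero_norm' ?_ h1
  filter_upwards [eventually_gt_atTop 0] with s hs
  exact norm_moment_integrand_le j le_rfl hs

theorem hasDerivAt_moment_integrand_real (j : ℕ) (z : ℂ) (s : ℝ) :
    HasDerivAt (fun t : ℝ => (t : ℂ) ^ j * exp (-(t : ℂ) ^ 2 - 2 * t * z))
      (j * ((s : ℂ) ^ (j - 1) * exp (-(s : ℂ) ^ 2 - 2 * s * z))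
        - 2 * ((s : ℂ) ^ (j + 1) * exp (-(s : ℂ) ^ 2 - 2 * s * z))
        - 2 * z * ((s : ℂ) ^ j * exp (-(s : ℂ) ^ 2 - 2 * s * z))) s := by
  have h1 : HasDerivAt (fun w : ℂ => -w ^ 2 - 2 * w * z) (-2 * s - 2 * z) (s : ℂ) :=
    ((hasDerivAt_pow 2 (s : ℂ)).neg.sub
      (((hasDerivAt_id (s : ℂ)).const_mul 2).mul_const z)).congr_deriv (by push_cast; ring)
  have h0 : HasDerivAt (fun w : ℂ => w ^ j * exp (-w ^ 2 - 2 * w * z)) _ (s : ℂ) :=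
    (hasDerivAt_pow j (s : ℂ)).mul h1.cexp
  refine h0.comp_ofReal.congr_deriv ?_
  ring

/-- Integration by parts; for `j = 0` the first term vanishes and the boundary term is
`-0 ^ 0 = -1`. -/
theorem erfcMoment_recurrence (j : ℕ) (z : ℂ) :
    j * erfcMoment (j - 1) z - 2 * erfcMoment (j + 1) z - 2 * z * erfcMoment j z
      = -(0 : ℂ) ^ j := by
  have i1 := (integrable_moment_integrand (j - 1) z).const_mul (j : ℂ)
  have i2 := (integrable_moment_integrand (j + 1) z).const_mul (2 : ℂ)
  have i3 := (integrable_moment_integrand j z).const_mul (2 * z)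
  have h := MeasureTheory.integral_Ioi_of_hasDerivAt_of_tendsto' (a := 0)
    (fun s _ => hasDerivAt_moment_integrand_real j z s) ((i1.sub i2).sub i3)
    (tendsto_moment_integrand j z)
  have i12 : MeasureTheory.IntegrableOn (fun s : ℝ =>
      (j : ℂ) * ((s : ℂ) ^ (j - 1) * exp (-(s : ℂ) ^ 2 - 2 * s * z))
        - 2 * ((s : ℂ) ^ (j + 1) * exp (-(s : ℂ) ^ 2 - 2 * s * z))) (Set.Ioi 0) := i1.sub i2
  rw [MeasureTheory.integral_sub i12 i3, MeasureTheory.integral_sub i1 i2,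
    MeasureTheory.integral_const_mul, MeasureTheory.integral_const_mul,
    MeasureTheory.integral_const_mul] at h
  simpa [erfcMoment] using h

theorem hasDerivAt_erfcMoment_zero (z : ℂ) :
    HasDerivAt (erfcMoment 0) (2 * z * erfcMoment 0 z - 1) z := by
  refine (hasDerivAt_erfcMoment 0 z).congr_deriv ?_
  have := erfcMoment_recurrence 0 z
  simp only [Nat.cast_zero, zero_mul, pow_zero] at this
  linear_combination this

/-- The reflection formula `erfc z + erfc (-z) = 2`. -/
theorem erfcMoment_zero_add_neg (z : ℂ) :
    erfcMoment 0 z + erfcMoment 0 (-z) = (√Real.pi : ℝ) * exp (z ^ 2) := by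
  have h1 : erfcMoment 0 (-z) = ∫ s in Set.Iic (0 : ℝ), exp (-(s : ℂ) ^ 2 - 2 * s * z) := by
    have := integral_comp_neg_Iic (0 : ℝ) (fun s : ℝ => exp (-(s : ℂ) ^ 2 - 2 * s * (-z)))
    rw [neg_zero] at this
    simp only [erfcMoment, pow_zero, one_mul]
    rw [← this]
    congr 1
    funext s
    push_cast
    ring_nf
  have h2 := integral_cexp_quadratic (b := -1) (by simp) (-2 * z) 0
  have hint := integrable_cexp_quadratic' (b := -1) (by simp) (-2 * z) 0
  have e : ∀ s : ℝ, cexp (-1 * (s : ℂ) ^ 2 + -2 * z * s + 0) = cexp (-(s : ℂ) ^ 2 - 2 * s * z) :=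
    fun s => by ring_nf
  simp only [e] at h2 hint
  have h3 := MeasureTheory.integral_add_compl (s := Set.Ioi (0 : ℝ)) measurableSet_Ioi hint
  rw [Set.compl_Ioi, h2] at h3
  rw [h1]
  simp only [erfcMoment, pow_zero, one_mul]
  rw [h3]
  congr 1
  · rw [Real.sqrt_eq_rpow, Complex.ofReal_cpow Real.pi_pos.le]
    norm_num
  · ring_nf

/-- The first term of the asymptotic expansion of the complementary error function, in the closed
right half-plane. -/
theorem exists_norm_erfcMoment_sub_le : ∃ C : ℝ, ∀ z : ℂ, 0 ≤ z.re → 1 ≤ ‖z‖ →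
    ‖erfcMoment 0 z - (2 * z)⁻¹‖ ≤ C / ‖z‖ ^ 3 := by
  obtain ⟨C₁, h₁⟩ := exists_norm_erfcMoment_le 1
  obtain ⟨C₃, h₃⟩ := exists_norm_erfcMoment_le 3
  refine ⟨1 + C₁ + C₁ + C₃, fun z hz hz1 => ?_⟩
  have hz0 : z ≠ 0 := norm_pos_iff.1 (by linarith)
  have r0 := erfcMoment_recurrence 0 z
  have r1 := erfcMoment_recurrence 1 z
  have r2 := erfcMoment_recurrence 2 z
  norm_num at r0 r1 r2
  -- Three integrations by parts, with a remainder that is bounded by the bounds of the moments.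
  have key : erfcMoment 0 z - (2 * z)⁻¹
      = (-1 / 4 + erfcMoment 1 z / 2 + (erfcMoment 1 z - erfcMoment 3 z)) / z ^ 3 := by
    have e : (2 * z)⁻¹ * z ^ 3 = z ^ 2 / 2 := by field_simp
    rw [eq_div_iff (pow_ne_zero 3 hz0)]
    linear_combination -e + (1 / 4 - z ^ 2 / 2) * r0 + z / 2 * r1 - (1 / 2 : ℂ) * r2
  rw [key, norm_div, norm_pow]
  gcongr
  calc ‖(-1 / 4 + erfcMoment 1 z / 2 + (erfcMoment 1 z - erfcMoment 3 z) : ℂ)‖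
      ≤ ‖(-1 / 4 : ℂ)‖ + ‖erfcMoment 1 z / 2‖ + ‖(erfcMoment 1 z - erfcMoment 3 z)‖ :=
        norm_add₃_le
    _ ≤ 1 + C₁ + (C₁ + C₃) := by
        have t1 := h₁ z hz
        have t3 := h₃ z hz
        have t4 := norm_sub_le (erfcMoment 1 z) (erfcMoment 3 z)
        have p1 := norm_nonneg (erfcMoment 1 z)
        have p3 := norm_nonneg (erfcMoment 3 z)
        rw [norm_div, norm_div, Complex.norm_ofNat]
        norm_num
        linarith
    _ = _ := by ring

/-! ### Asymptotic relations in sectors -/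

section Sectors

open Asymptotics

theorem norm_polarPt {r : ℝ} (hr : 0 ≤ r) (φ : ℝ) : ‖polarPt r φ‖ = r := by
  rw [polarPt, norm_mul, norm_exp_ofReal_mul_I, mul_one, Complex.norm_real, Real.norm_of_nonneg hr]

theorem polarPt_add (r φ ψ : ℝ) : polarPt r (φ + ψ) = exp (ψ * I) * polarPt r φ := by
  rw [polarPt, polarPt, Complex.ofReal_add, add_mul, exp_add]
  ring

/-- The filter of points that tend to infinity in the closed subsector
`lo + δ ≤ arg x ≤ hi - δ` of the sector `lo < arg x < hi`. -/
noncomputable def sectorFilter (lo hi δ : ℝ) : Filter ℂ :=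
  map (fun p : ℝ × ℝ => polarPt p.1 p.2) (atTop ×ˢ 𝓟 (Set.Icc (lo + δ) (hi - δ)))

theorem eventually_sectorFilter {lo hi δ : ℝ} {P : ℂ → Prop} :
    (∀ᶠ x in sectorFilter lo hi δ, P x) ↔ ∃ R : ℝ, 0 < R ∧ ∀ r φ : ℝ, R ≤ r → lo + δ ≤ φ →
      φ ≤ hi - δ → P (polarPt r φ) := by
  rw [sectorFilter, eventually_map, eventually_prod_principal_iff, eventually_atTop]
  constructor
  · rintro ⟨R, hR⟩
    exact ⟨max R 1, by positivity, fun r φ hr h1 h2 =>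
      hR r ((le_max_left _ _).trans hr) φ ⟨h1, h2⟩⟩
  · rintro ⟨R, -, hR⟩
    exact ⟨R, fun r hr φ hφ => hR r φ hr hφ.1 hφ.2⟩

theorem sectorFilter_le_cobounded (lo hi δ : ℝ) : sectorFilter lo hi δ ≤ Bornology.cobounded ℂ := by
  rw [← comap_norm_atTop, ← tendsto_iff_comap, tendsto_atTop]
  intro b
  rw [eventually_sectorFilter]
  refine ⟨max b 1, by positivity, fun r φ hr _ _ => ?_⟩
  rw [norm_polarPt ((zero_le_one.trans (le_max_right b 1)).trans hr)]
  exact (le_max_left _ _).trans hr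

theorem sectorFilter_mono {lo hi lo' hi' δ δ' : ℝ} (h1 : lo' + δ' ≤ lo + δ)
    (h2 : hi - δ ≤ hi' - δ') : sectorFilter lo hi δ ≤ sectorFilter lo' hi' δ' :=
  map_mono (prod_mono le_rfl (principal_mono.2 (Set.Icc_subset_Icc h1 h2)))

section Powers

variable {l : Filter ℂ} {f g : ℂ → ℂ} {a b c : ℤ}

theorem eventually_norm_ge (hl : l ≤ Bornology.cobounded ℂ) (R : ℝ) : ∀ᶠ x in l, R ≤ ‖x‖ :=
  (tendsto_norm_cobounded_atTop.mono_left hl).eventually_ge_atTop R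

theorem eventually_ne_zero_of_le_cobounded (hl : l ≤ Bornology.cobounded ℂ) : ∀ᶠ x in l, x ≠ 0 :=
  (eventually_norm_ge hl 1).mono fun _ hx => norm_pos_iff.1 (one_pos.trans_le hx)

theorem isBigO_zpow_of_le (hl : l ≤ Bornology.cobounded ℂ) (hab : a ≤ b) :
    (fun x : ℂ => x ^ a) =O[l] fun x => x ^ b := by
  refine IsBigO.of_bound 1 ?_
  filter_upwards [eventually_norm_ge hl 1] with x hx
  rw [norm_zpow, norm_zpow, one_mul]
  exact zpow_le_zpow_right₀ hx hab

theorem isBigO_zpow_mul (hl : l ≤ Bornology.cobounded ℂ) (hf : f =O[l] fun x => x ^ a)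
    (hg : g =O[l] fun x => x ^ b) (hc : a + b ≤ c) :
    (fun x => f x * g x) =O[l] fun x => x ^ c := by
  refine ((hf.mul hg).congr' EventuallyEq.rfl ?_).trans (isBigO_zpow_of_le hl hc)
  filter_upwards [eventually_ne_zero_of_le_cobounded hl] with x hx
  rw [zpow_add₀ hx]

end Powers

/-- The asymptotic relation `f = p (1 + O(x⁻²))` along the filter `l`. -/
def RelClose (l : Filter ℂ) (f p : ℂ → ℂ) : Prop :=
  (fun x => f x - p x) =O[l] fun x => p x * x ^ (-2 : ℤ)

namespace RelClose

variable {l : Filter ℂ} {f g p q : ℂ → ℂ} {C D : ℂ} {a b : ℤ}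

theorem refl (l : Filter ℂ) (f : ℂ → ℂ) : RelClose l f f := by
  simp only [RelClose, sub_self]
  exact isBigO_zero _ _

theorem congr' (h : RelClose l f p) (hf : f =ᶠ[l] g) (hp : p =ᶠ[l] q) : RelClose l g q :=
  IsBigO.congr' h (hf.sub hp) (hp.mul EventuallyEq.rfl)

theorem mul_zpow_isBigO (hl : l ≤ Bornology.cobounded ℂ) (p : ℂ → ℂ) :
    (fun x => p x * x ^ (-2 : ℤ)) =O[l] p := by
  have h := (isBigO_refl p l).mul (isBigO_zpow_of_le (a := -2) (b := 0) hl (by norm_num))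
  simpa using h

theorem isBigO (hl : l ≤ Bornology.cobounded ℂ) (h : RelClose l f p) : f =O[l] p := by
  have h1 := (IsBigO.trans h (mul_zpow_isBigO hl p)).add (isBigO_refl p l)
  simpa using h1

theorem add_isBigO (h : RelClose l f p) (hg : g =O[l] fun x => p x * x ^ (-2 : ℤ)) :
    RelClose l (fun x => f x + g x) p :=
  (IsBigO.add h hg).congr_left fun x => by ring

theorem sub_isBigO (h : RelClose l f p) (hg : g =O[l] fun x => p x * x ^ (-2 : ℤ)) :
    RelClose l (fun x => f x - g x) p :=
  (IsBigO.sub h hg).congr_left fun x => by ring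

theorem mul (hl : l ≤ Bornology.cobounded ℂ) (hf : RelClose l f p) (hg : RelClose l g q) :
    RelClose l (fun x => f x * g x) (fun x => p x * q x) := by
  have h1 := (IsBigO.mul hf (hg.isBigO hl)).congr_right
    (g₂ := fun x => p x * q x * x ^ (-2 : ℤ)) fun x => by ring
  have h2 := ((isBigO_refl p l).mul hg).congr_right
    (g₂ := fun x => p x * q x * x ^ (-2 : ℤ)) fun x => by ring
  exact (h1.add h2).congr_left fun x => by ring

theorem inv (hl : l ≤ Bornology.cobounded ℂ) (h : RelClose l f p) :
    RelClose l (fun x => (f x)⁻¹) (fun x => (p x)⁻¹) := by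
  obtain ⟨C, hC0, hC⟩ := h.exists_pos
  refine IsBigO.of_bound (2 * C) ?_
  filter_upwards [hC.bound, eventually_norm_ge hl 1, eventually_norm_ge hl (2 * C)] with x hx h1 h2
  have hx0 : 0 < ‖x‖ := one_pos.trans_le h1
  have e : ‖x ^ (-2 : ℤ)‖ = (‖x‖ ^ 2)⁻¹ := by
    rw [norm_zpow, zpow_neg]; rfl
  rw [norm_mul, e] at hx ⊢
  have h3 : C * (‖x‖ ^ 2)⁻¹ ≤ 1 / 2 := by
    rw [← div_eq_mul_inv, div_le_iff₀ (by positivity)]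
    nlinarith
  have h4 : ‖f x - p x‖ ≤ ‖p x‖ / 2 := by
    calc _ ≤ C * (‖p x‖ * (‖x‖ ^ 2)⁻¹) := hx
      _ = ‖p x‖ * (C * (‖x‖ ^ 2)⁻¹) := by ring
      _ ≤ ‖p x‖ * (1 / 2) := by gcongr
      _ = _ := by ring
  rcases eq_or_ne (p x) 0 with hp | hp
  · rw [hp, norm_zero, zero_div, norm_le_zero_iff, sub_zero] at h4
    simp [hp, h4]
  have hp0 := norm_pos_iff.2 hp
  have h5 : ‖p x‖ / 2 ≤ ‖f x‖ := by
    have := norm_sub_norm_le (p x) (f x)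
    rw [norm_sub_rev] at this
    linarith
  have hf : f x ≠ 0 := norm_pos_iff.1 (by linarith)
  have hf0 := norm_pos_iff.2 hf
  rw [inv_sub_inv hf hp, norm_div, norm_mul, norm_inv, norm_sub_rev, div_le_iff₀ (by positivity)]
  calc ‖f x - p x‖ ≤ C * (‖p x‖ * (‖x‖ ^ 2)⁻¹) := hx
    _ = 2 * C * (‖p x‖⁻¹ * (‖x‖ ^ 2)⁻¹) * (‖p x‖ / 2 * ‖p x‖) := by field_simp
    _ ≤ _ := by gcongr

theorem eventually_ne_zero (hl : l ≤ Bornology.cobounded ℂ) (h : RelClose l f p)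
    (hp : ∀ᶠ x in l, p x ≠ 0) : ∀ᶠ x in l, f x ≠ 0 := by
  have h1 := (h.inv hl).isBigO hl
  have h2 : (fun x => f x - p x) =o[l] p := by
    refine IsBigO.trans_isLittleO h ?_
    have h3 : (fun x : ℂ => x ^ (-2 : ℤ)) =o[l] fun _ => (1 : ℂ) := by
      rw [isLittleO_one_iff]
      refine squeeze_zero_norm' (a := fun x : ℂ => ‖x‖⁻¹) ?_
        ((tendsto_norm_cobounded_atTop.mono_left hl).inv_tendsto_atTop)
      filter_upwards [eventually_norm_ge hl 1] with x hx
      rw [norm_zpow, ← zpow_neg_one]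
      exact zpow_le_zpow_right₀ hx (by norm_num)
    simpa using (isBigO_refl p l).mul_isLittleO h3
  filter_upwards [h2.bound (c := 1 / 2) (by norm_num), hp] with x hx hpx hfx
  rw [hfx, zero_sub, norm_neg] at hx
  have := norm_pos_iff.2 hpx
  linarith

theorem const_mul (h : RelClose l f p) (C : ℂ) :
    RelClose l (fun x => C * f x) (fun x => C * p x) := by
  have h1 := ((isBigO_refl (fun _ : ℂ => C) l).mul h)
  exact h1.congr (fun x => by ring) (fun x => by ring)

theorem isBigO_sub_zpow (hl : l ≤ Bornology.cobounded ℂ)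
    (h : RelClose l f fun x => C * x ^ a) :
    (fun x => f x - C * x ^ a) =O[l] fun x => x ^ (a - 2) := by
  refine IsBigO.trans h ?_
  refine ((isBigO_refl (fun x : ℂ => x ^ a * x ^ (-2 : ℤ)) l).const_mul_left C).congr' ?_ ?_
  · exact Eventually.of_forall fun x => by ring
  · filter_upwards [eventually_ne_zero_of_le_cobounded hl] with x hx
    rw [← zpow_add₀ hx]; rfl

theorem of_isBigO_sub_zpow (hl : l ≤ Bornology.cobounded ℂ) (hC : C ≠ 0)
    (h : (fun x => f x - C * x ^ a) =O[l] fun x => x ^ (a - 2)) :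
    RelClose l f fun x => C * x ^ a := by
  refine h.trans ?_
  have := (isBigO_refl (fun x : ℂ => x ^ (a - 2)) l).const_mul_left C
  refine ((isBigO_refl (fun x : ℂ => C * x ^ a * x ^ (-2 : ℤ)) l).const_mul_left C⁻¹).congr' ?_
    EventuallyEq.rfl
  filter_upwards [eventually_ne_zero_of_le_cobounded hl] with x hx
  rw [sub_eq_add_neg a 2, zpow_add₀ hx, mul_assoc, inv_mul_cancel_left₀ hC]

theorem isBigO_zpow (hl : l ≤ Bornology.cobounded ℂ)
    (h : RelClose l f fun x => C * x ^ a) : f =O[l] fun x => x ^ a :=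
  (h.isBigO hl).trans ((isBigO_refl _ l).const_mul_left C)

theorem inv_zpow (hl : l ≤ Bornology.cobounded ℂ) (h : RelClose l f fun x => C * x ^ a) :
    RelClose l (fun x => (f x)⁻¹) (fun x => C⁻¹ * x ^ (-a)) :=
  (h.inv hl).congr' EventuallyEq.rfl
    (Eventually.of_forall fun x => by simp only [mul_inv, zpow_neg])

theorem ne_zero_zpow (hl : l ≤ Bornology.cobounded ℂ) (hC : C ≠ 0)
    (h : RelClose l f fun x => C * x ^ a) : ∀ᶠ x in l, f x ≠ 0 := by
  refine h.eventually_ne_zero hl ?_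
  filter_upwards [eventually_ne_zero_of_le_cobounded hl] with x hx
  exact mul_ne_zero hC (zpow_ne_zero a hx)

end RelClose

/-- Cauchy's estimate in sectors: a derivative gains a factor `1 / x` if the sector is shrunk. -/
theorem deriv_isBigO_sectorFilter {lo hi : ℝ} {f : ℂ → ℂ}
    (hd : ∀ δ > 0, ∀ᶠ x in sectorFilter lo hi δ, DifferentiableAt ℂ f x)
    (hf : ∀ δ > 0, f =O[sectorFilter lo hi δ] fun x => x ^ (-1 : ℤ)) :
    ∀ δ > 0, deriv f =O[sectorFilter lo hi δ] fun x => x ^ (-2 : ℤ) := by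
  intro δ hδ
  obtain ⟨C, hC0, hC⟩ := (hf (δ / 2) (half_pos hδ)).exists_pos
  obtain ⟨R, hR0, hR⟩ := eventually_sectorFilter.1 ((hd (δ / 2) (half_pos hδ)).and hC.bound)
  -- Discs whose radius is a small multiple of `|x|` stay in a slightly larger sector.
  obtain ⟨ε, hε0, hε⟩ : ∃ ε > 0, ∀ w : ℂ, dist w 1 < ε → |arg w| < δ / 2 := by
    have h1 : ContinuousAt arg 1 := continuousAt_arg (by simp)
    obtain ⟨ε, h2, h3⟩ := Metric.continuousAt_iff.1 h1 (δ / 2) (half_pos hδ)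
    exact ⟨ε, h2, fun w hw => by simpa using h3 hw⟩
  set η := min (ε / 2) (1 / 2) with hη
  have hη0 : 0 < η := by positivity
  refine IsBigO.of_bound (2 * C / η) ?_
  rw [eventually_sectorFilter]
  refine ⟨2 * R, by positivity, fun r φ hr h1 h2 => ?_⟩
  have hr0 : 0 < r := by linarith
  have hp : ∀ z ∈ Metric.closedBall (polarPt r φ) (η * r),
      DifferentiableAt ℂ f z ∧ ‖f z‖ ≤ C * (2 / r) := by
    intro z hz
    have hx0 : polarPt r φ ≠ 0 := norm_pos_iff.1 (by rw [norm_polarPt hr0.le]; exact hr0)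
    set w := z / polarPt r φ with hw
    have hw1 : dist w 1 ≤ η := by
      rw [dist_eq_norm, hw, div_sub_one hx0, norm_div, norm_polarPt hr0.le, div_le_iff₀ hr0,
        ← dist_eq_norm]
      exact hz
    have hw2 : |arg w| < δ / 2 := hε w (hw1.trans_lt ((min_le_left _ _).trans_lt (by linarith)))
    have hw3 : 1 / 2 ≤ ‖w‖ := by
      have h3 := norm_sub_norm_le (1 : ℂ) w
      rw [norm_one, norm_sub_rev, ← dist_eq_norm] at h3
      have := hw1.trans (min_le_right _ _)
      linarith
    have hz' : z = polarPt (r * ‖w‖) (φ + arg w) := by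
      have h3 := norm_mul_exp_arg_mul_I w
      rw [polarPt_add, polarPt, Complex.ofReal_mul]
      calc z = polarPt r φ * w := by rw [hw]; field_simp
        _ = r * exp (φ * I) * (‖w‖ * exp (arg w * I)) := by rw [h3, polarPt]
        _ = _ := by ring
    have hrw : r / 2 ≤ r * ‖w‖ := by nlinarith
    have ha := abs_lt.1 hw2
    obtain ⟨h4, h5⟩ := hR (r * ‖w‖) (φ + arg w) (by linarith) (by linarith) (by linarith)
    rw [← hz'] at h4 h5
    refine ⟨h4, h5.trans (mul_le_mul_of_nonneg_left ?_ hC0.le)⟩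
    rw [norm_zpow, zpow_neg_one, hz', norm_polarPt (by positivity)]
    calc (r * ‖w‖)⁻¹ ≤ (r / 2)⁻¹ := inv_anti₀ (by positivity) hrw
      _ = _ := by rw [inv_div]
  have h3 : DiffContOnCl ℂ f (Metric.ball (polarPt r φ) (η * r)) :=
    DifferentiableOn.diffContOnCl_ball
      (U := Metric.closedBall (polarPt r φ) (η * r))
      (fun z hz => (hp z hz).1.differentiableWithinAt) le_rfl
  have h4 := norm_deriv_le_of_forall_mem_sphere_norm_le (by positivity) h3
    (fun z hz => (hp z (Metric.sphere_subset_closedBall hz)).2)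
  refine h4.trans (le_of_eq ?_)
  rw [norm_zpow, norm_polarPt hr0.le]
  rw [zpow_neg]
  field_simp

/-- A solution `f = O(1/x)` of `f' = f A + s` with `A = κ x + O(1/x)` in a sector satisfies
`f = -s / (κ x) + O(x⁻³)`: by Cauchy's estimate the derivative is negligible. -/
theorem isBigO_of_linear_ode {lo hi : ℝ} {f A : ℂ → ℂ} {s κ : ℂ} (hκ : κ ≠ 0)
    (hd : ∀ δ > 0, ∀ᶠ x in sectorFilter lo hi δ, HasDerivAt f (f x * A x + s) x)
    (hA : ∀ δ > 0, (fun x => A x - κ * x) =O[sectorFilter lo hi δ] fun x => x ^ (-1 : ℤ))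
    (hf : ∀ δ > 0, f =O[sectorFilter lo hi δ] fun x => x ^ (-1 : ℤ)) :
    ∀ δ > 0, (fun x => f x - (-s / κ) * x ^ (-1 : ℤ)) =O[sectorFilter lo hi δ]
      fun x => x ^ (-3 : ℤ) := by
  intro δ hδ
  have hl := sectorFilter_le_cobounded lo hi δ
  have h1 := deriv_isBigO_sectorFilter (fun δ hδ => (hd δ hδ).mono fun x hx => hx.differentiableAt)
    hf δ hδ
  have h2 := h1.sub (isBigO_zpow_mul (c := -2) hl (hf δ hδ) (hA δ hδ) (by norm_num))
  have h3 := isBigO_zpow_mul (c := -3) hl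
    ((isBigO_refl (fun x : ℂ => x ^ (-1 : ℤ)) (sectorFilter lo hi δ)).const_mul_left κ⁻¹) h2
    (by norm_num)
  refine h3.congr' ?_ EventuallyEq.rfl
  filter_upwards [hd δ hδ, eventually_ne_zero_of_le_cobounded hl] with x hx hx0
  rw [hx.deriv, zpow_neg_one]
  field_simp
  ring

/-! ### The translation of the parameters and asymptotics in sectors -/

/-- In the sector `(lo, hi)` the triple solves the symmetric form with the parameters
`(2n, -2m, 2k)`, and `f₂ ∼ -2 x` dominates: `f₁ = -(m / x) (1 + O(x⁻²))` and `f₀ = O(1/x)`. -/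
structure SecondDominant (lo hi : ℝ) (n m k : ℂ) (f : Triple) : Prop where
  system : ∀ δ > 0, ∀ᶠ x in sectorFilter lo hi δ,
    SymmetricAt (2 * n) (-2 * m) (2 * k) f.f₀ f.f₁ f.f₂ x
  isBigO₀ : ∀ δ > 0, f.f₀ =O[sectorFilter lo hi δ] fun x => x ^ (-1 : ℤ)
  relClose₁ : ∀ δ > 0, RelClose (sectorFilter lo hi δ) f.f₁ fun x => -m * x ^ (-1 : ℤ)

/-- In the sector `(lo, hi)` the triple solves the symmetric form with the parameters
`(2n, -2m, 2k)`, and `f₁ ∼ -2 x` dominates: `f₂ = -k / x + O(x⁻³)` and `f₀ = O(1/x)`. -/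
structure FirstDominant (lo hi : ℝ) (n m k : ℂ) (f : Triple) : Prop where
  system : ∀ δ > 0, ∀ᶠ x in sectorFilter lo hi δ,
    SymmetricAt (2 * n) (-2 * m) (2 * k) f.f₀ f.f₁ f.f₂ x
  isBigO₀ : ∀ δ > 0, f.f₀ =O[sectorFilter lo hi δ] fun x => x ^ (-1 : ℤ)
  isBigO₂ : ∀ δ > 0, (fun x => f.f₂ x - -k * x ^ (-1 : ℤ)) =O[sectorFilter lo hi δ]
    fun x => x ^ (-3 : ℤ)

section Steps

variable {lo hi : ℝ} {n m k : ℂ} {f g : Triple}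

namespace SecondDominant

theorem inv₁ (h : SecondDominant lo hi n m k f) {δ : ℝ} (hδ : 0 < δ) :
    (fun x => (f.f₁ x)⁻¹ - (-m)⁻¹ * x ^ (1 : ℤ)) =O[sectorFilter lo hi δ]
      fun x => x ^ (-1 : ℤ) :=
  ((h.relClose₁ δ hδ).inv_zpow (sectorFilter_le_cobounded _ _ _)).isBigO_sub_zpow
    (sectorFilter_le_cobounded _ _ _)

theorem isBigO_raise₀ (h : SecondDominant lo hi n m k f) (hm0 : m ≠ 0) {δ : ℝ} (hδ : 0 < δ) :
    (f.raise m n).f₀ =O[sectorFilter lo hi δ] fun x => x ^ (-1 : ℤ) := by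
  have hl := sectorFilter_le_cobounded lo hi δ
  have h1 := (((h.isBigO₀ δ hδ).add ((h.relClose₁ δ hδ).isBigO_zpow hl)).add
    ((h.inv₁ hδ).const_mul_left (2 * m))).neg_left
  refine h1.congr' ?_ EventuallyEq.rfl
  filter_upwards [h.system δ hδ] with x hx
  simp only [Triple.raise]
  have e : f.f₂ x = -2 * x - f.f₀ x - f.f₁ x := by linear_combination hx.sum_eq
  rw [e, zpow_one]
  field_simp
  ring

/-- The leading terms of `f₂ - 2m / f₁` cancel; the linear equation satisfied by this function
recovers its true size. -/
theorem relClose_raise₀ (h : SecondDominant lo hi n m k f) (hm : m = n + k + 1) (hm0 : m ≠ 0)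
    (hn0 : n + 1 ≠ 0) {δ : ℝ} (hδ : 0 < δ) :
    RelClose (sectorFilter lo hi δ) (f.raise m n).f₀ fun x => -(n + 1) * x ^ (-1 : ℤ) := by
  refine RelClose.of_isBigO_sub_zpow (sectorFilter_le_cobounded _ _ _) (neg_ne_zero.2 hn0) ?_
  have := isBigO_of_linear_ode (lo := lo) (hi := hi) (f := (f.raise m n).f₀)
    (A := fun x => f.f₀ x + 2 * m / f.f₁ x - f.f₁ x) (s := -2 * (n + 1)) (κ := -2)
    (by norm_num) ?_ ?_ (fun δ hδ => h.isBigO_raise₀ hm0 hδ) δ hδ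
  · refine this.congr_left fun x => ?_
    congr 2
    ring
  · intro δ hδ
    filter_upwards [h.system δ hδ, (h.relClose₁ δ hδ).ne_zero_zpow
      (sectorFilter_le_cobounded _ _ _) (neg_ne_zero.2 hm0)] with x hx h1
    exact (hx.first_reflection hm h1).deriv₁
  · intro δ hδ
    have hl := sectorFilter_le_cobounded lo hi δ
    refine (((h.isBigO₀ δ hδ).sub ((h.relClose₁ δ hδ).isBigO_zpow hl)).add
      ((h.inv₁ hδ).const_mul_left (2 * m))).congr_left fun x => ?_
    rw [zpow_one]
    field_simp
    ring

theorem raise (h : SecondDominant lo hi n m k f) (hm : m = n + k + 1) (hm0 : m ≠ 0)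
    (hm1 : m + 1 ≠ 0) (hn0 : n + 1 ≠ 0) :
    SecondDominant lo hi (n + 1) (m + 1) k (f.raise m n) := by
  have hsys : ∀ δ > 0, ∀ᶠ x in sectorFilter lo hi δ, SymmetricAt (2 * (n + 1)) (-2 * (m + 1))
      (2 * k) (f.raise m n).f₀ (f.raise m n).f₁ (f.raise m n).f₂ x := by
    intro δ hδ
    have hl := sectorFilter_le_cobounded lo hi δ
    filter_upwards [h.system δ hδ, (h.relClose₁ δ hδ).ne_zero_zpow hl (neg_ne_zero.2 hm0),
      (h.relClose_raise₀ hm hm0 hn0 hδ).ne_zero_zpow hl (neg_ne_zero.2 hn0)] with x hx h1 h2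
    exact hx.raise hm h1 h2
  have hO : ∀ δ > 0, (f.raise m n).f₁ =O[sectorFilter lo hi δ] fun x => x ^ (-1 : ℤ) := by
    intro δ hδ
    have hl := sectorFilter_le_cobounded lo hi δ
    have h1 := ((h.relClose_raise₀ hm hm0 hn0 hδ).inv_zpow hl).isBigO_sub_zpow hl
    refine (((h.isBigO₀ δ hδ).add ((h.inv₁ hδ).const_mul_left (2 * m))).sub
      (h1.const_mul_left (2 * (n + 1)))).congr_left fun x => ?_
    simp only [Triple.raise, neg_neg, zpow_one]
    field_simp
    ring
  refine ⟨hsys, fun δ hδ => h.isBigO_raise₀ hm0 hδ, fun δ hδ => ?_⟩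
  refine RelClose.of_isBigO_sub_zpow (sectorFilter_le_cobounded _ _ _) (neg_ne_zero.2 hm1) ?_
  have := isBigO_of_linear_ode (lo := lo) (hi := hi) (f := (f.raise m n).f₁)
    (A := fun x => -2 * x - (f.raise m n).f₁ x - 2 * (f.raise m n).f₀ x) (s := -2 * (m + 1))
    (κ := -2) (by norm_num) ?_ ?_ hO δ hδ
  · refine this.congr_left fun x => ?_
    congr 2
    ring
  · intro δ hδ
    filter_upwards [hsys δ hδ] with x hx
    refine hx.deriv₁.congr_deriv ?_
    rw [← hx.sum_eq]
    ring
  · intro δ hδ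
    refine ((hO δ hδ).add ((h.isBigO_raise₀ hm0 hδ).const_mul_left 2)).neg_left.congr_left
      fun x => ?_
    ring

end SecondDominant

namespace FirstDominant

theorem relClose₁ (h : FirstDominant lo hi n m k f) {δ : ℝ} (hδ : 0 < δ) :
    RelClose (sectorFilter lo hi δ) f.f₁ fun x => -2 * x ^ (1 : ℤ) := by
  have hl := sectorFilter_le_cobounded lo hi δ
  refine RelClose.of_isBigO_sub_zpow hl (by norm_num) ?_
  have h2 := ((h.isBigO₂ δ hδ).trans (isBigO_zpow_of_le hl (b := -1) (by norm_num))).add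
    ((isBigO_refl (fun x : ℂ => x ^ (-1 : ℤ)) (sectorFilter lo hi δ)).const_mul_left (-k))
  refine ((h.isBigO₀ δ hδ).add h2).neg_left.congr' ?_ EventuallyEq.rfl
  filter_upwards [h.system δ hδ] with x hx
  rw [zpow_one]
  linear_combination -hx.sum_eq

theorem relClose_raise₀ (h : FirstDominant lo hi n m k f) (hm : m = n + k + 1)
    (hn0 : n + 1 ≠ 0) {δ : ℝ} (hδ : 0 < δ) :
    RelClose (sectorFilter lo hi δ) (f.raise m n).f₀ fun x => (n + 1) * x ^ (-1 : ℤ) := by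
  have hl := sectorFilter_le_cobounded lo hi δ
  refine RelClose.of_isBigO_sub_zpow hl hn0 ?_
  have h1 := ((h.relClose₁ hδ).inv_zpow hl).isBigO_sub_zpow hl
  refine ((h.isBigO₂ δ hδ).sub (h1.const_mul_left (2 * m))).congr_left fun x => ?_
  simp only [Triple.raise]
  rw [hm]
  ring

theorem raise (h : FirstDominant lo hi n m k f) (hm : m = n + k + 1) (hn0 : n + 1 ≠ 0) :
    FirstDominant lo hi (n + 1) (m + 1) k (f.raise m n) := by
  have hsys : ∀ δ > 0, ∀ᶠ x in sectorFilter lo hi δ, SymmetricAt (2 * (n + 1)) (-2 * (m + 1))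
      (2 * k) (f.raise m n).f₀ (f.raise m n).f₁ (f.raise m n).f₂ x := by
    intro δ hδ
    have hl := sectorFilter_le_cobounded lo hi δ
    filter_upwards [h.system δ hδ, (h.relClose₁ hδ).ne_zero_zpow hl (by norm_num),
      (h.relClose_raise₀ hm hn0 hδ).ne_zero_zpow hl hn0] with x hx h1 h2
    exact hx.raise hm h1 h2
  have hO₀ : ∀ δ > 0, (f.raise m n).f₀ =O[sectorFilter lo hi δ] fun x => x ^ (-1 : ℤ) :=
    fun δ hδ => (h.relClose_raise₀ hm hn0 hδ).isBigO_zpow (sectorFilter_le_cobounded _ _ _)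
  have hO : ∀ δ > 0, (f.raise m n).f₂ =O[sectorFilter lo hi δ] fun x => x ^ (-1 : ℤ) := by
    intro δ hδ
    have hl := sectorFilter_le_cobounded lo hi δ
    have h1 := ((h.relClose_raise₀ hm hn0 hδ).inv_zpow hl).isBigO_sub_zpow hl
    refine (((h.relClose₁ hδ).isBigO_sub_zpow hl).add
      (h1.const_mul_left (2 * (n + 1)))).congr_left fun x => ?_
    simp only [Triple.raise, neg_neg, zpow_one]
    field_simp
    ring
  refine ⟨hsys, hO₀, fun δ hδ => ?_⟩
  have := isBigO_of_linear_ode (lo := lo) (hi := hi) (f := (f.raise m n).f₂)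
    (A := fun x => 2 * x + (f.raise m n).f₂ x + 2 * (f.raise m n).f₀ x) (s := 2 * k)
    (κ := 2) (by norm_num) ?_ ?_ hO δ hδ
  · refine this.congr_left fun x => ?_
    congr 2
    ring
  · intro δ hδ
    filter_upwards [hsys δ hδ] with x hx
    refine hx.deriv₂.congr_deriv ?_
    linear_combination (f.raise m n).f₂ x * (-hx.sum_eq)
  · intro δ hδ
    refine ((hO δ hδ).add ((hO₀ δ hδ).const_mul_left 2)).congr_left fun x => ?_
    ring

end FirstDominant

theorem isBigO_mul_zpow_scale {l : Filter ℂ} (hl : l ≤ Bornology.cobounded ℂ) {C : ℂ} (hC : C ≠ 0)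
    (e : ℂ → ℂ) {a j : ℤ} (h : a ≤ j - 2) :
    (fun x => e x * x ^ a) =O[l] fun x => C * x ^ j * e x * x ^ (-2 : ℤ) := by
  have h1 := ((isBigO_refl e l).mul (isBigO_zpow_of_le hl h))
  refine h1.trans (IsBigO.trans (IsBigO.of_bound' (Eventually.of_forall fun x => le_rfl))
    (((isBigO_refl (fun x => C * x ^ j * e x * x ^ (-2 : ℤ)) l).const_mul_left C⁻¹).congr'
      ?_ EventuallyEq.rfl))
  filter_upwards [eventually_ne_zero_of_le_cobounded hl] with x hx
  rw [sub_eq_add_neg, zpow_add₀ hx]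
  field_simp

/-- How the translation of the parameters acts on the difference of two solutions that are both
close to `-m / x`. -/
theorem SecondDominant.sub_raise (hf : SecondDominant lo hi n m k f)
    (hg : SecondDominant lo hi n m k g) (hm : m = n + k + 1) (hm0 : m ≠ 0) (hn0 : n + 1 ≠ 0)
    {δ : ℝ} (hδ : 0 < δ) {e : ℂ → ℂ}
    (h₁ : RelClose (sectorFilter lo hi δ) (fun x => f.f₁ x - g.f₁ x) e)
    (h₀ : (fun x => f.f₀ x - g.f₀ x) =O[sectorFilter lo hi δ] fun x => e x * x ^ (-2 : ℤ)) :
    RelClose (sectorFilter lo hi δ) (fun x => (f.raise m n).f₁ x - (g.raise m n).f₁ x)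
      (fun x => 4 / (m * (n + 1)) * x ^ (4 : ℤ) * e x) ∧
    (fun x => (f.raise m n).f₀ x - (g.raise m n).f₀ x) =O[sectorFilter lo hi δ]
      fun x => 4 / (m * (n + 1)) * x ^ (4 : ℤ) * e x * x ^ (-2 : ℤ) := by
  have hl := sectorFilter_le_cobounded lo hi δ
  set l := sectorFilter lo hi δ with hldef
  have hf0 := (hf.relClose₁ δ hδ).ne_zero_zpow hl (neg_ne_zero.2 hm0)
  have hg0 := (hg.relClose₁ δ hδ).ne_zero_zpow hl (neg_ne_zero.2 hm0)
  have hF := hf.relClose_raise₀ hm hm0 hn0 hδ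
  have hG := hg.relClose_raise₀ hm hm0 hn0 hδ
  have hF0 := hF.ne_zero_zpow hl (neg_ne_zero.2 hn0)
  have hG0 := hG.ne_zero_zpow hl (neg_ne_zero.2 hn0)
  have hx0 := eventually_ne_zero_of_le_cobounded hl
  have c1 : 2 / m ≠ 0 := div_ne_zero two_ne_zero hm0
  have c2 : 4 / (m * (n + 1)) ≠ 0 := div_ne_zero (by norm_num) (mul_ne_zero hm0 hn0)
  have he1 : e =O[l] fun x => 2 / m * x ^ (2 : ℤ) * e x * x ^ (-2 : ℤ) := by
    simpa using isBigO_mul_zpow_scale hl c1 e (a := 0) (j := 2) (by norm_num)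
  have he2 : (fun x => e x * x ^ (2 : ℤ)) =O[l]
      fun x => 4 / (m * (n + 1)) * x ^ (4 : ℤ) * e x * x ^ (-2 : ℤ) :=
    isBigO_mul_zpow_scale hl c2 e (by norm_num)
  have he3 : e =O[l] fun x => 4 / (m * (n + 1)) * x ^ (4 : ℤ) * e x * x ^ (-2 : ℤ) := by
    simpa using isBigO_mul_zpow_scale hl c2 e (a := 0) (j := 4) (by norm_num)
  have hd1 : (fun x => f.f₁ x - g.f₁ x) =O[l] e := h₁.isBigO hl
  have hd0 : (fun x => f.f₀ x - g.f₀ x) =O[l] e := h₀.trans (RelClose.mul_zpow_isBigO hl e)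
  have hD0 : RelClose l (fun x => (f.raise m n).f₀ x - (g.raise m n).f₀ x)
      (fun x => 2 / m * x ^ (2 : ℤ) * e x) := by
    have hP := (((h₁.mul hl ((hf.relClose₁ δ hδ).inv_zpow hl)).mul hl
      ((hg.relClose₁ δ hδ).inv_zpow hl)).const_mul (2 * m)).congr' (g := _)
      (q := fun x => 2 / m * x ^ (2 : ℤ) * e x) EventuallyEq.rfl
      (Eventually.of_forall fun x => by
        simp only [neg_neg, zpow_one]; norm_cast; field_simp)
    refine (hP.sub_isBigO ((hd0.add hd1).trans he1)).congr' ?_ EventuallyEq.rfl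
    filter_upwards [hf.system δ hδ, hg.system δ hδ, hf0, hg0] with x hx hx' h1 h2
    simp only [Triple.raise]
    have e1 : f.f₂ x = -2 * x - f.f₀ x - f.f₁ x := by linear_combination hx.sum_eq
    have e2 : g.f₂ x = -2 * x - g.f₀ x - g.f₁ x := by linear_combination hx'.sum_eq
    rw [e1, e2]
    field_simp
    ring
  have hD0' : (fun x => (f.raise m n).f₀ x - (g.raise m n).f₀ x) =O[l]
      fun x => e x * x ^ (2 : ℤ) :=
    (hD0.isBigO hl).trans (((isBigO_refl (fun x => e x * x ^ (2 : ℤ)) l).const_mul_left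
      (2 / m)).congr_left fun x => by ring)
  refine ⟨?_, hD0'.trans he2⟩
  have hQ := (((hD0.mul hl (hF.inv_zpow hl)).mul hl (hG.inv_zpow hl)).const_mul
    (2 * (n + 1))).congr' (g := _)
    (q := fun x => 4 / (m * (n + 1)) * x ^ (4 : ℤ) * e x) EventuallyEq.rfl
    (Eventually.of_forall fun x => by
      simp only [neg_neg, zpow_one]; norm_cast; field_simp; ring)
  refine (hQ.sub_isBigO ((hd1.trans he3).add (hD0'.trans he2))).congr' ?_ EventuallyEq.rfl
  filter_upwards [hf.system δ hδ, hg.system δ hδ, hf0, hg0, hF0, hG0] with x hx hx' h1 h2 h3 h4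
  have e1 : f.f₂ x = -2 * x - f.f₀ x - f.f₁ x := by linear_combination hx.sum_eq
  have e2 : g.f₂ x = -2 * x - g.f₀ x - g.f₁ x := by linear_combination hx'.sum_eq
  have e3 : (f.raise m n).f₁ x = f.f₀ x + f.f₂ x - (f.raise m n).f₀ x
      - 2 * (n + 1) / (f.raise m n).f₀ x := by simp only [Triple.raise]; ring
  have e4 : (g.raise m n).f₁ x = g.f₀ x + g.f₂ x - (g.raise m n).f₀ x
      - 2 * (n + 1) / (g.raise m n).f₀ x := by simp only [Triple.raise]; ring
  rw [e3, e4, e1, e2]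
  field_simp
  ring

/-- How the translation of the parameters acts on the difference of two solutions that are both
close to `-2 x`. -/
theorem FirstDominant.sub_raise (hf : FirstDominant lo hi n m k f)
    (hg : FirstDominant lo hi n m k g) (hm : m = n + k + 1) (hn0 : n + 1 ≠ 0)
    {δ : ℝ} (hδ : 0 < δ) {e : ℂ → ℂ}
    (h₂ : RelClose (sectorFilter lo hi δ) (fun x => f.f₂ x - g.f₂ x) e)
    (h₀ : (fun x => f.f₀ x - g.f₀ x) =O[sectorFilter lo hi δ] fun x => e x * x ^ (-2 : ℤ)) :
    RelClose (sectorFilter lo hi δ) (fun x => (f.raise m n).f₂ x - (g.raise m n).f₂ x)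
      (fun x => -2 / (n + 1) * x ^ (2 : ℤ) * e x) ∧
    (fun x => (f.raise m n).f₀ x - (g.raise m n).f₀ x) =O[sectorFilter lo hi δ]
      fun x => -2 / (n + 1) * x ^ (2 : ℤ) * e x * x ^ (-2 : ℤ) := by
  have hl := sectorFilter_le_cobounded lo hi δ
  set l := sectorFilter lo hi δ with hldef
  have hf1 := hf.relClose₁ hδ
  have hg1 := hg.relClose₁ hδ
  have hf0 := hf1.ne_zero_zpow hl (by norm_num)
  have hg0 := hg1.ne_zero_zpow hl (by norm_num)
  have hF := hf.relClose_raise₀ hm hn0 hδ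
  have hG := hg.relClose_raise₀ hm hn0 hδ
  have hF0 := hF.ne_zero_zpow hl hn0
  have hG0 := hG.ne_zero_zpow hl hn0
  have c1 : -2 / (n + 1) ≠ 0 := div_ne_zero (by norm_num) hn0
  have he1 : e =O[l] fun x => -2 / (n + 1) * x ^ (2 : ℤ) * e x * x ^ (-2 : ℤ) := by
    simpa using isBigO_mul_zpow_scale hl c1 e (a := 0) (j := 2) (by norm_num)
  have hd2 : (fun x => f.f₂ x - g.f₂ x) =O[l] e := h₂.isBigO hl
  have hd0 : (fun x => f.f₀ x - g.f₀ x) =O[l] e := h₀.trans (RelClose.mul_zpow_isBigO hl e)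
  have hd02 := hd0.add hd2
  have hsq : (fun x => (f.f₁ x)⁻¹ * (g.f₁ x)⁻¹) =O[l] fun x => x ^ (-2 : ℤ) :=
    isBigO_zpow_mul hl ((hf1.inv_zpow hl).isBigO_zpow hl) ((hg1.inv_zpow hl).isBigO_zpow hl)
      (by norm_num)
  have hD0 : RelClose l (fun x => (f.raise m n).f₀ x - (g.raise m n).f₀ x) e := by
    refine (h₂.sub_isBigO ((hd02.mul hsq).const_mul_left (2 * m))).congr' ?_ EventuallyEq.rfl
    filter_upwards [hf.system δ hδ, hg.system δ hδ, hf0, hg0] with x hx hx' h1 h2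
    simp only [Triple.raise]
    have e1 : f.f₀ x - g.f₀ x + (f.f₂ x - g.f₂ x) = g.f₁ x - f.f₁ x := by
      linear_combination hx.sum_eq - hx'.sum_eq
    rw [e1]
    field_simp
    ring
  refine ⟨?_, (hD0.isBigO hl).trans he1⟩
  have hQ := (((hD0.mul hl (hF.inv_zpow hl)).mul hl (hG.inv_zpow hl)).const_mul
    (-2 * (n + 1))).congr' (g := _)
    (q := fun x => -2 / (n + 1) * x ^ (2 : ℤ) * e x) EventuallyEq.rfl
    (Eventually.of_forall fun x => by
      simp only [neg_neg, zpow_one]; norm_cast; field_simp)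
  refine (hQ.sub_isBigO (hd02.trans he1)).congr' ?_ EventuallyEq.rfl
  filter_upwards [hf.system δ hδ, hg.system δ hδ, hF0, hG0] with x hx hx' h3 h4
  have e1 : f.f₀ x - g.f₀ x + (f.f₂ x - g.f₂ x) = g.f₁ x - f.f₁ x := by
    linear_combination hx.sum_eq - hx'.sum_eq
  have e3 : (f.raise m n).f₂ x = f.f₁ x + 2 * (n + 1) / (f.raise m n).f₀ x := rfl
  have e4 : (g.raise m n).f₂ x = g.f₁ x + 2 * (n + 1) / (g.raise m n).f₀ x := rfl
  rw [e1, e3, e4]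
  field_simp
  ring

end Steps

/-! ### Asymptotics of the triples in terms of the seed -/

section Seeds

variable {lo hi : ℝ} {y z : ℂ → ℂ}

/-- In the sector `(lo, hi)` the function `y` solves the Riccati equation `y' = -(y² + 2xy) - 2`. -/
def RiccatiInSector (lo hi : ℝ) (y : ℂ → ℂ) : Prop :=
  ∀ δ > 0, ∀ᶠ x in sectorFilter lo hi δ, HasDerivAt y (-(y x ^ 2 + 2 * x * y x) - 2) x

theorem riccatiSeq_small (hd : RiccatiInSector lo hi y)
    (hO : ∀ δ > 0, y =O[sectorFilter lo hi δ] fun x => x ^ (-1 : ℤ)) (k : ℕ) :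
    (∀ δ > 0, ∀ᶠ x in sectorFilter lo hi δ, HasDerivAt (riccatiSeq y k)
      (-(riccatiSeq y k x ^ 2 + 2 * x * riccatiSeq y k x) - 2 * ((k : ℂ) + 1)) x) ∧
    ∀ δ > 0, RelClose (sectorFilter lo hi δ) (riccatiSeq y k)
      fun x => -((k : ℂ) + 1) * x ^ (-1 : ℤ) := by
  have key : ∀ (k : ℕ) (f : ℂ → ℂ), (∀ δ > 0, ∀ᶠ x in sectorFilter lo hi δ,
      HasDerivAt f (-(f x ^ 2 + 2 * x * f x) - 2 * ((k : ℂ) + 1)) x) →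
      (∀ δ > 0, f =O[sectorFilter lo hi δ] fun x => x ^ (-1 : ℤ)) →
      ∀ δ > 0, RelClose (sectorFilter lo hi δ) f fun x => -((k : ℂ) + 1) * x ^ (-1 : ℤ) := by
    intro k f h1 h2 δ hδ
    have hk : (k : ℂ) + 1 ≠ 0 := Nat.cast_add_one_ne_zero k
    refine RelClose.of_isBigO_sub_zpow (sectorFilter_le_cobounded _ _ _) (neg_ne_zero.2 hk) ?_
    have := isBigO_of_linear_ode (A := fun x => -f x - 2 * x) (s := -2 * ((k : ℂ) + 1))
      (κ := -2) (by norm_num)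
      (fun δ hδ => (h1 δ hδ).mono fun x hx => hx.congr_deriv (by ring))
      (fun δ hδ => (h2 δ hδ).neg_left.congr_left fun x => by ring) h2 δ hδ
    refine this.congr_left fun x => ?_
    congr 2
    ring
  induction k with
  | zero =>
    have h1 : ∀ δ > 0, ∀ᶠ x in sectorFilter lo hi δ, HasDerivAt y
        (-(y x ^ 2 + 2 * x * y x) - 2 * (((0 : ℕ) : ℂ) + 1)) x :=
      fun δ hδ => (hd δ hδ).mono fun x hx => hx.congr_deriv (by push_cast; ring)
    exact ⟨h1, key 0 y h1 hO⟩
  | succ k ih =>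
    obtain ⟨h1, h2⟩ := ih
    have hk : (k : ℂ) + 1 ≠ 0 := Nat.cast_add_one_ne_zero k
    have h3 : ∀ δ > 0, ∀ᶠ x in sectorFilter lo hi δ, HasDerivAt (riccatiSeq y (k + 1))
        (-(riccatiSeq y (k + 1) x ^ 2 + 2 * x * riccatiSeq y (k + 1) x)
          - 2 * (((k + 1 : ℕ) : ℂ) + 1)) x := by
      intro δ hδ
      filter_upwards [h1 δ hδ, (h2 δ hδ).ne_zero_zpow (sectorFilter_le_cobounded _ _ _)
        (neg_ne_zero.2 hk)] with x hx h0
      rw [Nat.cast_add_one]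
      exact hasDerivAt_riccati_succ hx h0
    refine ⟨h3, key (k + 1) _ h3 fun δ hδ => ?_⟩
    have hl := sectorFilter_le_cobounded lo hi δ
    have h4 := ((h2 δ hδ).inv_zpow hl).isBigO_sub_zpow hl
    refine (h4.const_mul_left (-2 * ((k : ℂ) + 1))).congr_left fun x => ?_
    simp only [riccatiSeq, neg_neg, zpow_one]
    field_simp
    ring

theorem riccatiSeq_large (hd : RiccatiInSector lo hi y)
    (hO : ∀ δ > 0, (fun x => y x + 2 * x) =O[sectorFilter lo hi δ] fun x => x ^ (-1 : ℤ)) (k : ℕ) :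
    (∀ δ > 0, ∀ᶠ x in sectorFilter lo hi δ, HasDerivAt (riccatiSeq y k)
      (-(riccatiSeq y k x ^ 2 + 2 * x * riccatiSeq y k x) - 2 * ((k : ℂ) + 1)) x) ∧
    ∀ δ > 0, RelClose (sectorFilter lo hi δ) (riccatiSeq y k) fun x => -2 * x ^ (1 : ℤ) := by
  induction k with
  | zero =>
    refine ⟨fun δ hδ => (hd δ hδ).mono fun x hx => hx.congr_deriv (by simp [riccatiSeq]),
      fun δ hδ => RelClose.of_isBigO_sub_zpow (sectorFilter_le_cobounded _ _ _) (by norm_num) ?_⟩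
    refine (hO δ hδ).congr_left fun x => ?_
    rw [zpow_one, riccatiSeq]
    ring
  | succ k ih =>
    obtain ⟨h1, h2⟩ := ih
    refine ⟨fun δ hδ => ?_, fun δ hδ => ?_⟩
    · filter_upwards [h1 δ hδ, (h2 δ hδ).ne_zero_zpow (sectorFilter_le_cobounded _ _ _)
        (by norm_num)] with x hx h0
      rw [Nat.cast_add_one]
      exact hasDerivAt_riccati_succ hx h0
    · have hl := sectorFilter_le_cobounded lo hi δ
      refine RelClose.of_isBigO_sub_zpow hl (by norm_num) ?_
      have h4 := ((h2 δ hδ).inv_zpow hl).isBigO_zpow hl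
      refine (h4.const_mul_left (-2 * ((k : ℂ) + 1))).congr_left fun x => ?_
      simp only [riccatiSeq, zpow_one]
      ring

theorem secondDominant_triple (hd : RiccatiInSector lo hi y)
    (hO : ∀ δ > 0, y =O[sectorFilter lo hi δ] fun x => x ^ (-1 : ℤ)) (k n : ℕ) :
    SecondDominant lo hi n ((n : ℂ) + k + 1) k (triple y k n) := by
  induction n with
  | zero =>
    obtain ⟨h1, h2⟩ := riccatiSeq_small hd hO k
    refine ⟨fun δ hδ => (h1 δ hδ).mono fun x hx => symmetricAt_triple_zero hx,
      fun δ _ => isBigO_zero _ _, fun δ hδ => (h2 δ hδ).congr' EventuallyEq.rfl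
        (Eventually.of_forall fun x => by simp)⟩
  | succ n ih =>
    have e : (((n + 1 : ℕ) : ℂ) + k + 1) = (n : ℂ) + k + 1 + 1 := by push_cast; ring
    rw [e, Nat.cast_add_one]
    exact ih.raise rfl (natCast_add_add_one_ne_zero n k)
      (by exact_mod_cast Nat.succ_ne_zero (n + k + 1)) (Nat.cast_add_one_ne_zero n)

theorem firstDominant_triple (hd : RiccatiInSector lo hi y)
    (hO : ∀ δ > 0, (fun x => y x + 2 * x) =O[sectorFilter lo hi δ] fun x => x ^ (-1 : ℤ))
    (k n : ℕ) : FirstDominant lo hi n ((n : ℂ) + k + 1) k (triple y k n) := by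
  induction n with
  | zero =>
    obtain ⟨h1, h2⟩ := riccatiSeq_large hd hO k
    have h3 : ∀ δ > 0, (fun x => -2 * x - riccatiSeq y k x) =O[sectorFilter lo hi δ]
        fun x => x ^ (-1 : ℤ) := fun δ hδ =>
      ((h2 δ hδ).isBigO_sub_zpow (sectorFilter_le_cobounded _ _ _)).neg_left.congr_left
        fun x => by rw [zpow_one]; ring
    have hs : ∀ δ > 0, ∀ᶠ x in sectorFilter lo hi δ,
        SymmetricAt (2 * ((0 : ℕ) : ℂ)) (-2 * (((0 : ℕ) : ℂ) + k + 1)) (2 * (k : ℂ))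
          (triple y k 0).f₀ (triple y k 0).f₁ (triple y k 0).f₂ x :=
      fun δ hδ => (h1 δ hδ).mono fun x hx => symmetricAt_triple_zero hx
    refine ⟨hs, fun δ _ => isBigO_zero _ _, fun δ hδ => ?_⟩
    have := isBigO_of_linear_ode (f := (triple y k 0).f₂) (A := fun x => 0 - riccatiSeq y k x)
      (κ := 2) two_ne_zero
      (fun δ hδ => (hs δ hδ).mono fun x hx => hx.deriv₂)
      (fun δ hδ => (h3 δ hδ).congr_left fun x => by ring) h3 δ hδ
    refine this.congr_left fun x => ?_
    congr 2
    ring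
  | succ n ih =>
    have e : (((n + 1 : ℕ) : ℂ) + k + 1) = (n : ℂ) + k + 1 + 1 := by push_cast; ring
    rw [e, Nat.cast_add_one]
    exact ih.raise rfl (Nat.cast_add_one_ne_zero n)

theorem riccatiSeq_succ_sub {k : ℕ} {x : ℂ} (hy : riccatiSeq y k x ≠ 0)
    (hz : riccatiSeq z k x ≠ 0) :
    2 * ((k : ℂ) + 1) * ((riccatiSeq y k x - riccatiSeq z k x) * (riccatiSeq y k x)⁻¹
      * (riccatiSeq z k x)⁻¹) = riccatiSeq y (k + 1) x - riccatiSeq z (k + 1) x := by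
  simp only [riccatiSeq]
  field_simp
  ring

/-- The difference of two solutions of size `O(1/x)`, in terms of that of their seeds. -/
theorem riccatiSeq_sub_small (hdy : RiccatiInSector lo hi y)
    (hOy : ∀ δ > 0, y =O[sectorFilter lo hi δ] fun x => x ^ (-1 : ℤ))
    (hdz : RiccatiInSector lo hi z)
    (hOz : ∀ δ > 0, z =O[sectorFilter lo hi δ] fun x => x ^ (-1 : ℤ))
    {δ : ℝ} (hδ : 0 < δ) {e : ℂ → ℂ}
    (h : RelClose (sectorFilter lo hi δ) (fun x => y x - z x) e) (k : ℕ) :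
    RelClose (sectorFilter lo hi δ) (fun x => riccatiSeq y k x - riccatiSeq z k x)
      (fun x => 2 ^ k / (k.factorial : ℂ) * x ^ (2 * k : ℤ) * e x) := by
  have hl := sectorFilter_le_cobounded lo hi δ
  induction k with
  | zero => simpa [riccatiSeq] using h
  | succ k ih =>
    have hk : (k : ℂ) + 1 ≠ 0 := Nat.cast_add_one_ne_zero k
    have hf : (k.factorial : ℂ) ≠ 0 := Nat.cast_ne_zero.2 k.factorial_ne_zero
    have h1 := (riccatiSeq_small hdy hOy k).2 δ hδ
    have h2 := (riccatiSeq_small hdz hOz k).2 δ hδ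
    refine (((ih.mul hl (h1.inv_zpow hl)).mul hl (h2.inv_zpow hl)).const_mul
      (2 * ((k : ℂ) + 1))).congr' ?_ ?_
    · filter_upwards [h1.ne_zero_zpow hl (neg_ne_zero.2 hk),
        h2.ne_zero_zpow hl (neg_ne_zero.2 hk)] with x hy hz
      exact riccatiSeq_succ_sub hy hz
    · filter_upwards [eventually_ne_zero_of_le_cobounded hl] with x hx
      have e1 : (2 * ((k + 1 : ℕ) : ℤ)) = 2 * (k : ℤ) + 1 + 1 := by push_cast; ring
      rw [e1, zpow_add₀ hx, zpow_add₀ hx, neg_neg, zpow_one, Nat.factorial_succ]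
      push_cast
      field_simp
      ring

/-- The difference of two solutions close to `-2 x`, in terms of that of their seeds. -/
theorem riccatiSeq_sub_large (hdy : RiccatiInSector lo hi y)
    (hOy : ∀ δ > 0, (fun x => y x + 2 * x) =O[sectorFilter lo hi δ] fun x => x ^ (-1 : ℤ))
    (hdz : RiccatiInSector lo hi z)
    (hOz : ∀ δ > 0, (fun x => z x + 2 * x) =O[sectorFilter lo hi δ] fun x => x ^ (-1 : ℤ))
    {δ : ℝ} (hδ : 0 < δ) {e : ℂ → ℂ}
    (h : RelClose (sectorFilter lo hi δ) (fun x => y x - z x) e) (k : ℕ) :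
    RelClose (sectorFilter lo hi δ) (fun x => riccatiSeq y k x - riccatiSeq z k x)
      (fun x => (k.factorial : ℂ) / 2 ^ k * x ^ (-2 * k : ℤ) * e x) := by
  have hl := sectorFilter_le_cobounded lo hi δ
  induction k with
  | zero => simpa [riccatiSeq] using h
  | succ k ih =>
    have h1 := (riccatiSeq_large hdy hOy k).2 δ hδ
    have h2 := (riccatiSeq_large hdz hOz k).2 δ hδ
    refine (((ih.mul hl (h1.inv_zpow hl)).mul hl (h2.inv_zpow hl)).const_mul
      (2 * ((k : ℂ) + 1))).congr' ?_ ?_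
    · filter_upwards [h1.ne_zero_zpow hl (by norm_num), h2.ne_zero_zpow hl (by norm_num)]
        with x hy hz
      exact riccatiSeq_succ_sub hy hz
    · filter_upwards [eventually_ne_zero_of_le_cobounded hl] with x hx
      have e1 : (-2 * ((k + 1 : ℕ) : ℤ)) = -2 * (k : ℤ) + -1 + -1 := by push_cast; ring
      rw [e1, zpow_add₀ hx, zpow_add₀ hx, Nat.factorial_succ, pow_succ]
      push_cast
      field_simp

theorem triple_sub_small (hdy : RiccatiInSector lo hi y)
    (hOy : ∀ δ > 0, y =O[sectorFilter lo hi δ] fun x => x ^ (-1 : ℤ))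
    (hdz : RiccatiInSector lo hi z)
    (hOz : ∀ δ > 0, z =O[sectorFilter lo hi δ] fun x => x ^ (-1 : ℤ))
    {δ : ℝ} (hδ : 0 < δ) {e : ℂ → ℂ}
    (h : RelClose (sectorFilter lo hi δ) (fun x => y x - z x) e) (k n : ℕ) :
    RelClose (sectorFilter lo hi δ) (fun x => (triple y k n).f₁ x - (triple z k n).f₁ x)
      (fun x => 2 ^ (k + 2 * n) / (((n + k).factorial : ℂ) * (n.factorial : ℂ))
        * x ^ (2 * k + 4 * n : ℤ) * e x) ∧
    (fun x => (triple y k n).f₀ x - (triple z k n).f₀ x) =O[sectorFilter lo hi δ]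
      (fun x => 2 ^ (k + 2 * n) / (((n + k).factorial : ℂ) * (n.factorial : ℂ))
        * x ^ (2 * k + 4 * n : ℤ) * e x * x ^ (-2 : ℤ)) := by
  have hl := sectorFilter_le_cobounded lo hi δ
  induction n with
  | zero =>
    refine ⟨?_, (isBigO_zero _ _).congr_left fun x => by simp [triple]⟩
    simpa [triple] using riccatiSeq_sub_small hdy hOy hdz hOz hδ h k
  | succ n ih =>
    have hn : (n : ℂ) + 1 ≠ 0 := Nat.cast_add_one_ne_zero n
    have hm := natCast_add_add_one_ne_zero n k
    have hf : (n.factorial : ℂ) ≠ 0 := Nat.cast_ne_zero.2 n.factorial_ne_zero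
    have hf' : ((n + k).factorial : ℂ) ≠ 0 := Nat.cast_ne_zero.2 (n + k).factorial_ne_zero
    have hs := (secondDominant_triple hdy hOy k n).sub_raise (secondDominant_triple hdz hOz k n)
      rfl hm hn hδ ih.1 ih.2
    have hq : (fun x : ℂ => 4 / (((n : ℂ) + k + 1) * ((n : ℂ) + 1)) * x ^ (4 : ℤ) *
        (2 ^ (k + 2 * n) / (((n + k).factorial : ℂ) * (n.factorial : ℂ))
          * x ^ (2 * k + 4 * n : ℤ) * e x)) =ᶠ[sectorFilter lo hi δ]
        (fun x => 2 ^ (k + 2 * (n + 1)) / (((n + 1 + k).factorial : ℂ) * ((n + 1).factorial : ℂ))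
          * x ^ (2 * k + 4 * (n + 1 : ℕ) : ℤ) * e x) := by
      filter_upwards [eventually_ne_zero_of_le_cobounded hl] with x hx
      have e1 : (2 * k + 4 * ((n + 1 : ℕ) : ℤ)) = 2 * k + 4 * (n : ℤ) + 4 := by push_cast; ring
      have e2 : n + 1 + k = n + k + 1 := by ring
      rw [e1, zpow_add₀ hx _ 4, e2, Nat.factorial_succ, Nat.factorial_succ]
      push_cast
      field_simp
      ring
    exact ⟨hs.1.congr' EventuallyEq.rfl hq,
      hs.2.congr' EventuallyEq.rfl (hq.mul EventuallyEq.rfl)⟩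

theorem triple_sub_large (hdy : RiccatiInSector lo hi y)
    (hOy : ∀ δ > 0, (fun x => y x + 2 * x) =O[sectorFilter lo hi δ] fun x => x ^ (-1 : ℤ))
    (hdz : RiccatiInSector lo hi z)
    (hOz : ∀ δ > 0, (fun x => z x + 2 * x) =O[sectorFilter lo hi δ] fun x => x ^ (-1 : ℤ))
    {δ : ℝ} (hδ : 0 < δ) {e : ℂ → ℂ}
    (h : RelClose (sectorFilter lo hi δ) (fun x => y x - z x) e) (k n : ℕ) :
    RelClose (sectorFilter lo hi δ) (fun x => (triple y k n).f₁ x - (triple z k n).f₁ x)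
      (fun x => (-1) ^ n * 2 ^ (n - k : ℤ) * ((k.factorial : ℂ) / (n.factorial : ℂ))
        * x ^ (2 * n - 2 * k : ℤ) * e x) := by
  have hl := sectorFilter_le_cobounded lo hi δ
  -- The recursion is closed for the differences of `f₂` and `f₀`; the sum yields that of `f₁`.
  have key : RelClose (sectorFilter lo hi δ)
      (fun x => (triple y k n).f₂ x - (triple z k n).f₂ x)
      (fun x => -((-1) ^ n * 2 ^ (n - k : ℤ) * ((k.factorial : ℂ) / (n.factorial : ℂ)))
        * x ^ (2 * n - 2 * k : ℤ) * e x) ∧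
      (fun x => (triple y k n).f₀ x - (triple z k n).f₀ x) =O[sectorFilter lo hi δ]
      (fun x => -((-1) ^ n * 2 ^ (n - k : ℤ) * ((k.factorial : ℂ) / (n.factorial : ℂ)))
        * x ^ (2 * n - 2 * k : ℤ) * e x * x ^ (-2 : ℤ)) := by
    induction n with
    | zero =>
      refine ⟨?_, (isBigO_zero _ _).congr_left fun x => by simp [triple]⟩
      refine ((riccatiSeq_sub_large hdy hOy hdz hOz hδ h k).const_mul (-1)).congr'
        (Eventually.of_forall fun x => ?_) (Eventually.of_forall fun x => ?_)
      · simp only [triple]; ring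
      · simp only [Nat.cast_zero, zero_sub, mul_zero, pow_zero, Nat.factorial_zero, Nat.cast_one,
          div_one, zpow_neg, zpow_natCast, neg_mul]
        ring
    | succ n ih =>
      have hn : (n : ℂ) + 1 ≠ 0 := Nat.cast_add_one_ne_zero n
      have hf : (n.factorial : ℂ) ≠ 0 := Nat.cast_ne_zero.2 n.factorial_ne_zero
      have hs := (firstDominant_triple hdy hOy k n).sub_raise (firstDominant_triple hdz hOz k n)
        rfl hn hδ ih.1 ih.2
      have hq : (fun x : ℂ => -2 / ((n : ℂ) + 1) * x ^ (2 : ℤ) *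
          (-((-1) ^ n * 2 ^ (n - k : ℤ) * ((k.factorial : ℂ) / (n.factorial : ℂ)))
          * x ^ (2 * n - 2 * k : ℤ) * e x)) =ᶠ[sectorFilter lo hi δ]
          (fun x => -((-1) ^ (n + 1) * 2 ^ ((n + 1 : ℕ) - k : ℤ)
            * ((k.factorial : ℂ) / ((n + 1).factorial : ℂ)))
            * x ^ (2 * (n + 1 : ℕ) - 2 * k : ℤ) * e x) := by
        filter_upwards [eventually_ne_zero_of_le_cobounded hl] with x hx
        have e1 : (2 * ((n + 1 : ℕ) : ℤ) - 2 * k) = 2 * n - 2 * k + 2 := by push_cast; ring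
        have e2 : (((n + 1 : ℕ) : ℤ) - k) = n - k + 1 := by push_cast; ring
        rw [e1, e2, zpow_add₀ hx _ 2, zpow_add₀ two_ne_zero _ 1, Nat.factorial_succ, pow_succ,
          zpow_one]
        push_cast
        field_simp
      exact ⟨hs.1.congr' EventuallyEq.rfl hq,
        hs.2.congr' EventuallyEq.rfl (hq.mul EventuallyEq.rfl)⟩
  refine ((key.1.add_isBigO key.2).const_mul (-1)).congr' ?_ (Eventually.of_forall fun x => ?_)
  · filter_upwards [(firstDominant_triple hdy hOy k n).system δ hδ,
      (firstDominant_triple hdz hOz k n).system δ hδ] with x h1 h2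
    linear_combination h2.sum_eq - h1.sum_eq
  · ring

end Seeds

/-! ### The seed solutions -/

theorem tendsto_rotate_sectorFilter (lo hi δ θ : ℝ) :
    Tendsto (fun x => exp (θ * I) * x) (sectorFilter lo hi δ)
      (sectorFilter (lo + θ) (hi + θ) δ) := by
  intro s hs
  obtain ⟨R, hR, h⟩ := eventually_sectorFilter.1 hs
  refine eventually_sectorFilter.2 ⟨R, hR, fun r φ hr h1 h2 => ?_⟩
  have := h r (φ + θ) hr (by linarith) (by linarith)
  rwa [polarPt_add] at this

/-- The argument is determined only up to multiples of `2 π`. -/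
theorem sectorFilter_sub_two_pi (lo hi δ : ℝ) :
    sectorFilter lo hi δ ≤ sectorFilter (lo - 2 * Real.pi) (hi - 2 * Real.pi) δ := by
  have h := tendsto_rotate_sectorFilter lo hi δ (-(2 * Real.pi))
  have e : exp (((-(2 * Real.pi) : ℝ) : ℂ) * I) = 1 := by
    push_cast
    rw [neg_mul, exp_neg, exp_two_pi_mul_I, inv_one]
  simp only [e, one_mul] at h
  rw [sub_eq_add_neg, sub_eq_add_neg]
  exact tendsto_id'.1 h

theorem RelClose.comp_rotate {lo hi δ θ : ℝ} {f p : ℂ → ℂ}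
    (h : RelClose (sectorFilter (lo + θ) (hi + θ) δ) f p) :
    RelClose (sectorFilter lo hi δ) (fun x => f (exp (θ * I) * x))
      (fun x => p (exp (θ * I) * x)) := by
  have h1 := IsBigO.comp_tendsto h (tendsto_rotate_sectorFilter lo hi δ θ)
  refine IsBigO.trans h1 (IsBigO.of_bound 1 (Eventually.of_forall fun x => ?_))
  simp [norm_exp_ofReal_mul_I]

/-- The Gaussian `exp (κ x²)` is small beyond all orders in the quarter-plane sector where `κ x²`
has negative real part. -/
theorem exp_isBigO_zpow {φ₀ : ℝ} {κ : ℂ} (hκ : κ * exp (φ₀ * I) ^ 2 = -1) (a : ℤ) {δ : ℝ}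
    (hδ : 0 < δ) : (fun x => exp (κ * x ^ 2)) =O[sectorFilter (φ₀ - Real.pi / 4)
      (φ₀ + Real.pi / 4) δ] fun x => x ^ a := by
  have hl := sectorFilter_le_cobounded (φ₀ - Real.pi / 4) (φ₀ + Real.pi / 4) δ
  rcases lt_or_ge (Real.pi / 4) δ with hδ' | hδ'
  · -- The closed subsector is empty.
    refine IsBigO.of_bound 1 (eventually_sectorFilter.2 ⟨1, one_pos, fun r φ _ h1 h2 => ?_⟩)
    exfalso
    linarith
  have hη : 0 < Real.sin (2 * δ) :=
    Real.sin_pos_of_pos_of_lt_pi (by linarith) (by linarith [Real.pi_pos])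
  have h1 : (fun x : ℂ => Real.exp (-Real.sin (2 * δ) * ‖x‖)) =O[sectorFilter (φ₀ - Real.pi / 4)
      (φ₀ + Real.pi / 4) δ] fun x : ℂ => ‖x‖ ^ (a : ℝ) :=
    ((isLittleO_exp_neg_mul_rpow_atTop hη (a : ℝ)).comp_tendsto
      (tendsto_norm_cobounded_atTop.mono_left hl)).isBigO
  refine (IsBigO.of_bound 1 ?_ : _ =O[_] fun x : ℂ =>
    Real.exp (-Real.sin (2 * δ) * ‖x‖)).trans (h1.trans (IsBigO.of_bound 1 ?_))
  · refine eventually_sectorFilter.2 ⟨1, one_pos, fun r φ hr h2 h3 => ?_⟩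
    have hr0 : 0 < r := by linarith
    rw [norm_polarPt hr0.le, one_mul, Real.norm_of_nonneg (Real.exp_pos _).le, norm_exp,
      Real.exp_le_exp]
    set ψ := φ - φ₀ with hψ
    have e : κ * polarPt r φ ^ 2 = ((-r ^ 2 : ℝ) : ℂ) * exp ((2 * ψ : ℝ) * I) := by
      rw [show φ = ψ + φ₀ by rw [hψ]; ring, polarPt_add, mul_pow, ← mul_assoc, hκ, polarPt,
        mul_pow, ← exp_nat_mul]
      push_cast
      ring_nf
    have h4 : Real.sin (2 * δ) ≤ Real.cos (2 * ψ) := by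
      rw [← Real.cos_pi_div_two_sub, ← Real.cos_abs (2 * ψ)]
      refine Real.cos_le_cos_of_nonneg_of_le_pi (abs_nonneg _) (by linarith [Real.pi_pos]) ?_
      rw [abs_le]
      constructor <;> linarith
    rw [e, re_ofReal_mul, exp_ofReal_mul_I_re]
    have h5 : r * Real.sin (2 * δ) ≤ r ^ 2 * Real.sin (2 * δ) :=
      mul_le_mul_of_nonneg_right (by nlinarith) hη.le
    have h6 := mul_le_mul_of_nonneg_left h4 (sq_nonneg r)
    linarith
  · filter_upwards [eventually_norm_ge hl 1] with x hx
    rw [Real.rpow_intCast, norm_zpow, one_mul, norm_zpow, norm_norm]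

/-- `∫₀^∞ exp(-s² - 2 s z) ds = (1 + O(z⁻²)) / (2 z)` for `|arg z| < 3π/4`. -/
theorem relClose_erfcMoment {δ : ℝ} (hδ : 0 < δ) :
    RelClose (sectorFilter (-(3 * Real.pi / 4)) (3 * Real.pi / 4) δ) (erfcMoment 0)
      fun z => 1 / 2 * z ^ (-1 : ℤ) := by
  refine RelClose.of_isBigO_sub_zpow (sectorFilter_le_cobounded _ _ _) (by norm_num) ?_
  obtain ⟨C, hC⟩ := exists_norm_erfcMoment_sub_le
  have h1 : ∀ z : ℂ, 1 ≤ ‖z‖ → 0 ≤ z.re →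
      ‖erfcMoment 0 z - 1 / 2 * z ^ (-1 : ℤ)‖ ≤ C * ‖z ^ (-1 - 2 : ℤ)‖ := by
    intro z hz hz'
    have h := hC z hz' hz
    rw [mul_inv] at h
    rw [norm_zpow, zpow_neg_one, one_div]
    exact h
  -- In the left half-plane the reflection formula adds a multiple of `exp (z²)`, which is
  -- negligible as long as `arg z` stays away from `±3π/4`.
  have h2 : ∀ z : ℂ, 1 ≤ ‖z‖ → ‖erfcMoment 0 z - 1 / 2 * z ^ (-1 : ℤ)‖ ≤
      ‖C * ‖z ^ (-1 - 2 : ℤ)‖ + √Real.pi * ‖exp (1 * z ^ 2)‖‖ := by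
    intro z hz
    refine le_trans ?_ (le_abs_self _)
    rcases le_total 0 z.re with h | h
    · exact (h1 z hz h).trans (le_add_of_nonneg_right (by positivity))
    · have h3 := h1 (-z) (by rwa [norm_neg]) (by simpa using h)
      have e1 : erfcMoment 0 z - 1 / 2 * z ^ (-1 : ℤ) =
          -(erfcMoment 0 (-z) - 1 / 2 * (-z) ^ (-1 : ℤ)) + (√Real.pi : ℝ) * exp (1 * z ^ 2) := by
        rw [one_mul, ← erfcMoment_zero_add_neg, zpow_neg_one, zpow_neg_one, inv_neg]
        ring
      have e2 : ‖(-z) ^ (-1 - 2 : ℤ)‖ = ‖z ^ (-1 - 2 : ℤ)‖ := by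
        rw [norm_zpow, norm_zpow, norm_neg]
      rw [e1]
      refine (norm_add_le _ _).trans ?_
      rw [norm_neg, norm_mul, Complex.norm_real, Real.norm_of_nonneg (Real.sqrt_nonneg _), ← e2]
      exact add_le_add_left h3 _
  have h3 : ∀ φ₀ : ℝ, (1 : ℂ) * exp (φ₀ * I) ^ 2 = -1 →
      (fun z => erfcMoment 0 z - 1 / 2 * z ^ (-1 : ℤ)) =O[sectorFilter (φ₀ - Real.pi / 4)
        (φ₀ + Real.pi / 4) δ] fun z => z ^ (-1 - 2 : ℤ) := by
    intro φ₀ hφ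
    have hl := sectorFilter_le_cobounded (φ₀ - Real.pi / 4) (φ₀ + Real.pi / 4) δ
    have h4 := ((exp_isBigO_zpow hφ (-1 - 2) hδ).norm_left.const_mul_left (√Real.pi))
    have h5 := ((isBigO_refl (fun z : ℂ => z ^ (-1 - 2 : ℤ)) (sectorFilter (φ₀ - Real.pi / 4)
        (φ₀ + Real.pi / 4) δ)).norm_left.const_mul_left C)
    refine (IsBigO.of_bound 1 ?_).trans (h5.add h4)
    filter_upwards [eventually_norm_ge hl 1] with z hz
    rw [one_mul]
    exact h2 z hz
  have h4 : (fun z => erfcMoment 0 z - 1 / 2 * z ^ (-1 : ℤ)) =O[sectorFilter (-(Real.pi / 2))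
      (Real.pi / 2) 0] fun z => z ^ (-1 - 2 : ℤ) := by
    refine IsBigO.of_bound C (eventually_sectorFilter.2 ⟨1, one_pos, fun r φ hr h5 h6 => ?_⟩)
    refine h1 _ (by rwa [norm_polarPt (by linarith)]) ?_
    rw [polarPt, re_ofReal_mul, exp_ofReal_mul_I_re]
    exact mul_nonneg (by linarith)
      (Real.cos_nonneg_of_mem_Icc ⟨by linarith, by linarith⟩)
  have e1 : exp ((Real.pi / 2 : ℝ) * I) = I := by push_cast; exact exp_pi_div_two_mul_I
  have e2 : exp ((-(Real.pi / 2) : ℝ) * I) = -I := by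
    push_cast; rw [neg_mul, exp_neg, exp_pi_div_two_mul_I, inv_I]
  have h5 := h3 (Real.pi / 2) (by rw [e1]; simp)
  have h6 := h3 (-(Real.pi / 2)) (by rw [e2]; simp)
  refine ((h4.sup h5).sup h6).mono ?_
  intro s hs
  obtain ⟨⟨hs1, hs2⟩, hs3⟩ := hs
  obtain ⟨R₁, hR₁, h7⟩ := eventually_sectorFilter.1 hs1
  obtain ⟨R₂, hR₂, h8⟩ := eventually_sectorFilter.1 hs2
  obtain ⟨R₃, hR₃, h9⟩ := eventually_sectorFilter.1 hs3
  refine eventually_sectorFilter.2 ⟨R₁ + R₂ + R₃, by positivity, fun r φ hr ha hb => ?_⟩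
  rcases le_or_gt φ (Real.pi / 2) with hc | hc
  · rcases le_or_gt (-(Real.pi / 2)) φ with hd | hd
    · exact h7 r φ (by linarith) (by linarith) (by linarith)
    · exact h9 r φ (by linarith) (by linarith) (by linarith)
  · exact h8 r φ (by linarith) (by linarith) (by linarith)

/-- The solution of `u' + 2 x u = 1` that is `∼ 1 / (2 x)` for `-5π/4 < arg x < π/4`. -/
noncomputable def dawsonLower (x : ℂ) : ℂ := I * erfcMoment 0 (I * x)

/-- The solution of `u' + 2 x u = 1` that is `∼ 1 / (2 x)` for `-π/4 < arg x < 5π/4`. -/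
noncomputable def dawsonUpper (x : ℂ) : ℂ := -I * erfcMoment 0 (-I * x)

/-- The one-parameter family of solutions of `u' + 2 x u = 1`. -/
noncomputable def dawson (c : ℂ) (x : ℂ) : ℂ := dawsonLower x + c * exp (-1 * x ^ 2)

theorem dawson_eq_upper (c x : ℂ) :
    dawson c x = dawsonUpper x + (c + I * (√Real.pi : ℝ)) * exp (-1 * x ^ 2) := by
  have h := erfcMoment_zero_add_neg (I * x)
  rw [mul_pow, I_sq] at h
  rw [dawson, dawsonLower, dawsonUpper, neg_mul I x]
  linear_combination I * h

theorem hasDerivAt_dawson (c x : ℂ) : HasDerivAt (dawson c) (1 - 2 * x * dawson c x) x := by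
  have h1 : HasDerivAt (fun z : ℂ => I * z) I x := by
    simpa using (hasDerivAt_id x).const_mul I
  have h2 : HasDerivAt dawsonLower _ x :=
    ((hasDerivAt_erfcMoment_zero (I * x)).comp x h1).const_mul I
  have h3 : HasDerivAt (fun z : ℂ => -1 * z ^ 2) (-1 * (2 * x)) x := by
    simpa using (hasDerivAt_pow 2 x).const_mul (-1 : ℂ)
  refine (h2.add (h3.cexp.const_mul c)).congr_deriv ?_
  rw [dawson, dawsonLower]
  linear_combination (-1 + 2 * I * x * erfcMoment 0 (I * x)) * I_sq

theorem relClose_dawsonLower {δ : ℝ} (hδ : 0 < δ) :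
    RelClose (sectorFilter (-(5 * Real.pi / 4)) (Real.pi / 4) δ) dawsonLower
      fun x => 1 / 2 * x ^ (-1 : ℤ) := by
  have h := relClose_erfcMoment hδ
  rw [show -(3 * Real.pi / 4) = -(5 * Real.pi / 4) + Real.pi / 2 by ring,
    show 3 * Real.pi / 4 = Real.pi / 4 + Real.pi / 2 by ring] at h
  have e1 : exp ((Real.pi / 2 : ℝ) * I) = I := by push_cast; exact exp_pi_div_two_mul_I
  have h1 := h.comp_rotate.const_mul I
  simp only [e1] at h1
  refine h1.congr' EventuallyEq.rfl (Eventually.of_forall fun x => ?_)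
  simp only [zpow_neg_one, mul_inv, inv_I]
  linear_combination (-1 / 2 * x⁻¹) * I_sq

theorem relClose_dawsonUpper {δ : ℝ} (hδ : 0 < δ) :
    RelClose (sectorFilter (-(Real.pi / 4)) (5 * Real.pi / 4) δ) dawsonUpper
      fun x => 1 / 2 * x ^ (-1 : ℤ) := by
  have h := relClose_erfcMoment hδ
  rw [show -(3 * Real.pi / 4) = -(Real.pi / 4) + -(Real.pi / 2) by ring,
    show 3 * Real.pi / 4 = 5 * Real.pi / 4 + -(Real.pi / 2) by ring] at h
  have e1 : exp ((-(Real.pi / 2) : ℝ) * I) = -I := by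
    push_cast; rw [neg_mul, exp_neg, exp_pi_div_two_mul_I, inv_I]
  have h1 := h.comp_rotate.const_mul (-I)
  simp only [e1] at h1
  refine h1.congr' EventuallyEq.rfl (Eventually.of_forall fun x => ?_)
  simp only [zpow_neg_one, mul_inv, inv_neg, inv_I, neg_neg]
  linear_combination (-1 / 2 * x⁻¹) * I_sq

/-- The logarithmic derivatives of the solutions of `u' + 2 x u = const`: all solutions of
`y' = -(y² + 2 x y) - 2`. The value at `∞` belongs to `u = exp(-x²)`. -/
noncomputable def seed (c : OnePoint ℂ) : ℂ → ℂ :=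
  c.elim (fun x => -2 * x) fun c x => -2 * x + (dawson c x)⁻¹

theorem hasDerivAt_seed_coe {c x : ℂ} (h : dawson c x ≠ 0) :
    HasDerivAt (seed c) (-(seed c x ^ 2 + 2 * x * seed c x) - 2) x := by
  have h1 : HasDerivAt (fun z : ℂ => -2 * z) (-2) x := by
    simpa using (hasDerivAt_id x).const_mul (-2 : ℂ)
  have h2 : HasDerivAt (seed c) _ x := h1.add ((hasDerivAt_dawson c x).inv h)
  refine h2.congr_deriv ?_
  simp only [seed, OnePoint.elim_some]
  field_simp
  ring

theorem hasDerivAt_seed_infty (x : ℂ) :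
    HasDerivAt (seed OnePoint.infty)
      (-(seed OnePoint.infty x ^ 2 + 2 * x * seed OnePoint.infty x) - 2) x := by
  have h1 : HasDerivAt (fun z : ℂ => -2 * z) (-2) x := by
    simpa using (hasDerivAt_id x).const_mul (-2 : ℂ)
  refine HasDerivAt.congr_deriv (f := seed OnePoint.infty) h1 ?_
  simp only [seed, OnePoint.elim_infty]
  ring

theorem meromorphicOn_dawson (c : ℂ) : MeromorphicOn (dawson c) Set.univ := by
  have h : Differentiable ℂ (dawson c) := fun z => (hasDerivAt_dawson c z).differentiableAt
  exact fun x _ => (h.analyticAt x).meromorphicAt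

theorem seed_solution (c : OnePoint ℂ) : MeromorphicOn (seed c) Set.univ ∧
    ∀ᶠ x in codiscrete ℂ, HasDerivAt (seed c) (-(seed c x ^ 2 + 2 * x * seed c x) - 2) x := by
  have hx : MeromorphicOn (fun z : ℂ => -2 * z) Set.univ :=
    fun z _ => (MeromorphicAt.const (-2 : ℂ) z).mul (MeromorphicAt.id z)
  induction c using OnePoint.rec with
  | infty => exact ⟨hx, Eventually.of_forall hasDerivAt_seed_infty⟩
  | coe c =>
    refine ⟨hx.add (meromorphicOn_dawson c).inv, ?_⟩
    have h := eventually_ne_zero_of_linear_ode (f := dawson c) (h := fun x => -2 * x) (s := 1)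
      one_ne_zero (meromorphicOn_dawson c)
      (Eventually.of_forall fun x => (hasDerivAt_dawson c x).congr_deriv (by ring))
    exact h.mono fun x hx => hasDerivAt_seed_coe hx

section SeedInSectors

variable {lo hi : ℝ} {c b : ℂ}

theorem seed_small (h : ∀ δ > 0, RelClose (sectorFilter lo hi δ) (dawson c)
      fun x => 1 / 2 * x ^ (-1 : ℤ)) :
    RiccatiInSector lo hi (seed c) ∧
    ∀ δ > 0, seed c =O[sectorFilter lo hi δ] fun x => x ^ (-1 : ℤ) := by
  refine ⟨fun δ hδ => ?_, fun δ hδ => ?_⟩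
  · filter_upwards [(h δ hδ).ne_zero_zpow (sectorFilter_le_cobounded _ _ _) (by norm_num)]
      with x hx
    exact hasDerivAt_seed_coe hx
  · have hl := sectorFilter_le_cobounded lo hi δ
    refine (((h δ hδ).inv_zpow hl).isBigO_sub_zpow hl).congr_left fun x => ?_
    simp only [seed, OnePoint.elim_some, neg_neg, zpow_one]
    norm_num
    ring

/-- In terms of `u` the difference of two seeds is `(u_b - u_c) / (u_b u_c)`. -/
theorem seed_sub_small (hc : ∀ δ > 0, RelClose (sectorFilter lo hi δ) (dawson c)
      fun x => 1 / 2 * x ^ (-1 : ℤ))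
    (hb : ∀ δ > 0, RelClose (sectorFilter lo hi δ) (dawson b) fun x => 1 / 2 * x ^ (-1 : ℤ))
    {δ : ℝ} (hδ : 0 < δ) :
    RelClose (sectorFilter lo hi δ) (fun x => seed c x - seed b x)
      fun x => 4 * x ^ (2 : ℤ) * ((b - c) * exp (-1 * x ^ 2)) := by
  have hl := sectorFilter_le_cobounded lo hi δ
  have h := ((RelClose.refl (sectorFilter lo hi δ) fun x => (b - c) * exp (-1 * x ^ 2)).mul hl
    ((hc δ hδ).inv_zpow hl)).mul hl ((hb δ hδ).inv_zpow hl)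
  refine h.congr' ?_ (Eventually.of_forall fun x => ?_)
  · filter_upwards [(hc δ hδ).ne_zero_zpow hl (by norm_num),
      (hb δ hδ).ne_zero_zpow hl (by norm_num)] with x h1 h2
    simp only [seed, OnePoint.elim_some]
    have e : (b - c) * exp (-1 * x ^ 2) = dawson b x - dawson c x := by
      rw [dawson, dawson]; ring
    rw [e]
    field_simp
    ring
  · simp only [neg_neg, zpow_one, one_div, inv_inv]
    norm_cast
    ring

theorem seed_infty_large : RiccatiInSector lo hi (seed OnePoint.infty) ∧
    ∀ δ > 0, (fun x => seed OnePoint.infty x + 2 * x) =O[sectorFilter lo hi δ]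
      fun x => x ^ (-1 : ℤ) := by
  refine ⟨fun δ _ => Eventually.of_forall hasDerivAt_seed_infty, fun δ _ => ?_⟩
  refine (isBigO_zero _ _).congr_left fun x => ?_
  simp only [seed, OnePoint.elim_infty]
  ring

end SeedInSectors

/-- Where `exp(-x²)` is small it does not change the leading behaviour of `u`. -/
theorem relClose_add_exp {φ₀ : ℝ} (hφ : -1 * exp (φ₀ * I) ^ 2 = (-1 : ℂ)) {u : ℂ → ℂ}
    {δ : ℝ} (hδ : 0 < δ) (hu : RelClose (sectorFilter (φ₀ - Real.pi / 4) (φ₀ + Real.pi / 4) δ) u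
      fun x => 1 / 2 * x ^ (-1 : ℤ)) (c : ℂ) :
    RelClose (sectorFilter (φ₀ - Real.pi / 4) (φ₀ + Real.pi / 4) δ)
      (fun x => u x + c * exp (-1 * x ^ 2)) fun x => 1 / 2 * x ^ (-1 : ℤ) := by
  have hl := sectorFilter_le_cobounded (φ₀ - Real.pi / 4) (φ₀ + Real.pi / 4) δ
  refine RelClose.of_isBigO_sub_zpow hl (by norm_num) ?_
  refine ((hu.isBigO_sub_zpow hl).add ((exp_isBigO_zpow hφ (-1 - 2) hδ).const_mul_left
    c)).congr_left fun x => ?_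
  ring

/-- Where `exp(-x²)` is large it dominates `u`. -/
theorem relClose_add_exp_large {φ₀ : ℝ} (hφ : 1 * exp (φ₀ * I) ^ 2 = (-1 : ℂ)) {u : ℂ → ℂ}
    {δ : ℝ} (hδ : 0 < δ) (hu : RelClose (sectorFilter (φ₀ - Real.pi / 4) (φ₀ + Real.pi / 4) δ) u
      fun x => 1 / 2 * x ^ (-1 : ℤ)) {c : ℂ} (hc : c ≠ 0) :
    RelClose (sectorFilter (φ₀ - Real.pi / 4) (φ₀ + Real.pi / 4) δ)
      (fun x => u x + c * exp (-1 * x ^ 2)) fun x => c * exp (-1 * x ^ 2) := by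
  have hl := sectorFilter_le_cobounded (φ₀ - Real.pi / 4) (φ₀ + Real.pi / 4) δ
  set l := sectorFilter (φ₀ - Real.pi / 4) (φ₀ + Real.pi / 4) δ
  have h1 : (fun x => u x * exp (1 * x ^ 2) * (c⁻¹ * (c * exp (-1 * x ^ 2)))) =O[l]
      fun x => x ^ (-2 : ℤ) * (c * exp (-1 * x ^ 2)) :=
    (isBigO_zpow_mul (c := -2) hl (hu.isBigO_zpow hl) (exp_isBigO_zpow hφ (-1) hδ)
      (by norm_num)).mul ((isBigO_refl _ l).const_mul_left c⁻¹)
  refine h1.congr (fun x => ?_) fun x => by ring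
  have e : exp (1 * x ^ 2) * exp (-1 * x ^ 2) = 1 := by
    rw [← exp_add, ← add_mul]; simp
  rw [inv_mul_cancel_left₀ hc]
  linear_combination u x * e

/-! ### The first family -/

theorem RelClose.mono {l l' : Filter ℂ} {f p : ℂ → ℂ} (h : RelClose l f p) (hl : l' ≤ l) :
    RelClose l' f p := IsBigO.mono h hl

theorem AlgAsymp.of_relClose {lo hi : ℝ} {L y : ℂ → ℂ}
    (h : ∀ δ > 0, RelClose (sectorFilter lo hi δ) y L) : AlgAsymp lo hi L y := by
  intro δ hδ
  obtain ⟨C, hC⟩ := (h δ hδ).bound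
  obtain ⟨R, hR0, hR⟩ := eventually_sectorFilter.1 hC
  refine ⟨C, R, hR0, fun r φ hr h1 h2 => (hR r φ hr h1 h2).trans (le_of_eq ?_)⟩
  rw [norm_mul, norm_zpow, norm_polarPt (hR0.le.trans hr), zpow_neg]
  norm_cast
  ring

theorem stepTheta_of_neg {t : ℝ} (h : t < 0) : stepTheta t = 0 := if_pos h

theorem stepTheta_zero : stepTheta 0 = 1 / 2 := by simp [stepTheta]

theorem stepTheta_of_pos {t : ℝ} (h : 0 < t) : stepTheta t = 1 := by
  rw [stepTheta, if_neg h.le.not_gt, if_neg h.ne']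

theorem stepTheta_neg (t : ℝ) : stepTheta (-t) = 1 - stepTheta t := by
  rcases lt_trichotomy t 0 with h | rfl | h
  · rw [stepTheta_of_neg h, stepTheta_of_pos (neg_pos.2 h), sub_zero]
  · rw [neg_zero, stepTheta_zero]; norm_num
  · rw [stepTheta_of_pos h, stepTheta_of_neg (neg_neg_of_pos h), sub_self]

/-- If `y` differs from the two backgrounds by definite multiples of the same exponential, then it
has the asymptotics of `SectorExpAsymp`, the coefficient jumping on the bisector. -/
theorem SectorExpAsymp.of_relClose {φ₀ : ℝ} {Bm Bp y : ℂ → ℂ} {p : ℤ} {σ μm μp : ℂ}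
    (hm : ∀ δ > 0, RelClose (sectorFilter (φ₀ - Real.pi / 4) (φ₀ + Real.pi / 4) δ)
      (fun x => y x - Bm x) fun x => μm * (x ^ p * exp (σ * x ^ 2)))
    (hp : ∀ δ > 0, RelClose (sectorFilter (φ₀ - Real.pi / 4) (φ₀ + Real.pi / 4) δ)
      (fun x => y x - Bp x) fun x => μp * (x ^ p * exp (σ * x ^ 2))) :
    SectorExpAsymp φ₀ Bm Bp p σ
      (fun φ => (1 - stepTheta (φ - φ₀)) * μm + stepTheta (φ - φ₀) * μp) y := by
  intro δ hδ
  obtain ⟨Cm, hCm0, hCm⟩ := (hm δ hδ).exists_pos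
  obtain ⟨Cp, hCp0, hCp⟩ := (hp δ hδ).exists_pos
  obtain ⟨R, hR0, hR⟩ := eventually_sectorFilter.1 (hCm.bound.and hCp.bound)
  set K := Cm * ‖μm‖ + Cp * ‖μp‖ with hK
  have hK0 : 0 ≤ K := by positivity
  have hKm : Cm * ‖μm‖ ≤ K := by rw [hK]; linarith [mul_nonneg hCp0.le (norm_nonneg μp)]
  have hKp : Cp * ‖μp‖ ≤ K := by rw [hK]; linarith [mul_nonneg hCm0.le (norm_nonneg μm)]
  set ν := (1 - stepTheta 0) * μm + stepTheta 0 * μp with hν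
  have hKν : 0 ≤ K / ‖ν‖ := by positivity
  refine ⟨K + Cm + Cp + K / ‖ν‖, R, hR0, fun r φ hr h1 h2 x B e hx hB he => ?_⟩
  obtain ⟨h3, h4⟩ := hR r φ hr h1 h2
  have hr0 : 0 < r := hR0.trans_le hr
  have hsq : ∀ (C : ℝ) (μ : ℂ),
      C * ‖μ * (x ^ p * exp (σ * x ^ 2)) * x ^ (-2 : ℤ)‖ = C / r ^ 2 * ‖μ * e‖ := by
    intro C μ
    rw [norm_mul, norm_zpow, hx, norm_polarPt hr0.le, zpow_neg, ← hx, ← he]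
    norm_cast
    ring
  rw [← hx, hsq] at h3 h4
  have hwk : ∀ {C C' : ℝ} (μ : ℂ), C ≤ C' → C / r ^ 2 * ‖μ‖ ≤ C' / r ^ 2 * ‖μ‖ :=
    fun μ h => by gcongr
  have hfac : ∀ (C : ℝ) (μ : ℂ), C / r ^ 2 * ‖μ * e‖ = C * ‖μ‖ / r ^ 2 * ‖e‖ := fun C μ => by
    rw [norm_mul]; ring
  rcases lt_trichotomy φ φ₀ with h | h | h
  · simp only [stepTheta_of_neg (sub_neg.2 h)] at hB ⊢
    have e1 : y x - (B + ((1 - 0) * μm + 0 * μp) * e) =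
        y x - Bm x - μm * (x ^ p * exp (σ * x ^ 2)) := by rw [hB, ← he]; ring
    have e2 : ((1 - 0) * μm + 0 * μp) * e = μm * e := by ring
    rw [e1, e2]
    exact ⟨(h3.trans (hfac Cm μm).le).trans (hwk e (by linarith)),
      fun _ => h3.trans (hwk (μm * e) (by linarith))⟩
  · simp only [h, sub_self, ← hν] at hB ⊢
    have e1 : y x - (B + ν * e) =
        1 / 2 * ((y x - Bm x - μm * (x ^ p * exp (σ * x ^ 2)))
          + (y x - Bp x - μp * (x ^ p * exp (σ * x ^ 2)))) := by
      rw [hB, ← he, hν, stepTheta_zero]; ring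
    have h5 : ‖y x - (B + ν * e)‖ ≤ K / r ^ 2 * ‖e‖ := by
      rw [e1, norm_mul]
      calc _ ≤ 1 * (Cm / r ^ 2 * ‖μm * e‖ + Cp / r ^ 2 * ‖μp * e‖) := by
            refine mul_le_mul (by norm_num) ((norm_add_le _ _).trans (add_le_add h3 h4))
              (norm_nonneg _) zero_le_one
        _ = _ := by rw [hfac, hfac, hK]; ring
    refine ⟨h5.trans (hwk e (by linarith)), fun h6 => ?_⟩
    have hν0 : 0 < ‖ν‖ := norm_pos_iff.2 (h6.resolve_left (not_not.2 rfl))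
    refine (h5.trans (le_of_eq ?_)).trans (hwk (C := K / ‖ν‖) (ν * e) (by linarith))
    rw [norm_mul]
    field_simp
  · simp only [stepTheta_of_pos (sub_pos.2 h)] at hB ⊢
    have e1 : y x - (B + ((1 - 1) * μm + 1 * μp) * e) =
        y x - Bp x - μp * (x ^ p * exp (σ * x ^ 2)) := by rw [hB, ← he]; ring
    have e2 : ((1 - 1) * μm + 1 * μp) * e = μp * e := by ring
    rw [e1, e2]
    exact ⟨(h4.trans (hfac Cp μp).le).trans (hwk e (by linarith)),
      fun _ => h4.trans (hwk (μp * e) (by linarith))⟩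

/-- The classical solutions of the first family, with `m = n + k + 1`. -/
noncomputable def solution (n k : ℕ) (c : OnePoint ℂ) : ℂ → ℂ := (triple (seed c) k n).f₁

/-- The parameter of the family `dawson` to which `dawsonUpper` belongs. -/
noncomputable def upperParam : ℂ := -(I * (√Real.pi : ℝ))

section Family

variable {n k m : ℕ}

theorem solution_isP4Solution (hm : m = n + k + 1) (c : OnePoint ℂ) :
    IsP4Solution ((n : ℂ) - k) ((2 * (m : ℂ)) ^ 2) (solution n k c) := by
  obtain ⟨h1, h2⟩ := seed_solution c
  have h := (triple_solution h1 h2 k n).1.isP4Solution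
    (by simpa using natCast_add_add_one_ne_zero n k)
  unfold solution
  convert h using 1
  · ring
  · rw [hm]; push_cast; ring

theorem solution_isClassical (hm : m = n + k + 1) (c : OnePoint ℂ) :
    IsClassical ((n : ℂ) - k) ((2 * (m : ℂ)) ^ 2) (solution n k c) := by
  obtain ⟨h1, h2⟩ := seed_solution c
  have h := (triple_solution h1 h2 k n).2
  unfold solution
  convert h using 1
  rw [hm]; push_cast; ring

variable {lo hi : ℝ}

theorem solution_algAsymp_small (hm : m = n + k + 1) {c : ℂ}
    (h : ∀ δ > 0, RelClose (sectorFilter lo hi δ) (dawson c) fun x => 1 / 2 * x ^ (-1 : ℤ)) :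
    AlgAsymp lo hi (fun x => -(2 * (m : ℂ)) / (2 * x)) (solution n k c) := by
  obtain ⟨h1, h2⟩ := seed_small h
  refine AlgAsymp.of_relClose fun δ hδ => ?_
  refine ((secondDominant_triple h1 h2 k n).relClose₁ δ hδ).congr' EventuallyEq.rfl
    (Eventually.of_forall fun x => ?_)
  simp only [hm, zpow_neg_one]
  push_cast
  rw [neg_div, mul_div_mul_left _ _ two_ne_zero]
  ring

theorem solution_algAsymp_infty : AlgAsymp lo hi (fun x => -2 * x)
    (solution n k OnePoint.infty) := by
  obtain ⟨h1, h2⟩ := seed_infty_large (lo := lo) (hi := hi)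
  refine AlgAsymp.of_relClose fun δ hδ => ?_
  exact ((firstDominant_triple h1 h2 k n).relClose₁ hδ).congr' EventuallyEq.rfl
    (Eventually.of_forall fun x => by simp only [zpow_one])

/-- Two solutions of the first family, where both are `∼ -m / x`. -/
theorem solution_sub_small (hm : m = n + k + 1) {c b : ℂ}
    (hc : ∀ δ > 0, RelClose (sectorFilter lo hi δ) (dawson c) fun x => 1 / 2 * x ^ (-1 : ℤ))
    (hb : ∀ δ > 0, RelClose (sectorFilter lo hi δ) (dawson b) fun x => 1 / 2 * x ^ (-1 : ℤ))
    {δ : ℝ} (hδ : 0 < δ) :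
    RelClose (sectorFilter lo hi δ) (fun x => solution n k c x - solution n k b x)
      fun x => (b - c) * (2 ^ (n + m + 1) / ((n.factorial : ℂ) * ((m - 1).factorial : ℂ))) *
        (x ^ (2 * n + 2 * m : ℤ) * exp (-1 * x ^ 2)) := by
  obtain ⟨h1, h2⟩ := seed_small hc
  obtain ⟨h3, h4⟩ := seed_small hb
  refine (triple_sub_small h1 h2 h3 h4 hδ (seed_sub_small hc hb hδ) k n).1.congr'
    EventuallyEq.rfl ?_
  filter_upwards [eventually_ne_zero_of_le_cobounded (sectorFilter_le_cobounded lo hi δ)] with x hx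
  have e1 : (2 * n + 2 * m : ℤ) = 2 * k + 4 * n + 2 := by rw [hm]; push_cast; ring
  have e2 : n + m + 1 = k + 2 * n + 2 := by omega
  have e3 : m - 1 = n + k := by omega
  rw [e1, e2, e3, zpow_add₀ hx _ 2, pow_add _ _ 2]
  ring

/-- A solution of the first family against that for `c = ∞`, where both are `∼ -2 x`. -/
theorem solution_sub_large (hm : m = n + k + 1) {φ₀ : ℝ}
    (hφ : 1 * exp (φ₀ * I) ^ 2 = (-1 : ℂ)) {c c' : ℂ} (hc' : c' ≠ 0)
    (hc : ∀ δ > 0, RelClose (sectorFilter (φ₀ - Real.pi / 4) (φ₀ + Real.pi / 4) δ) (dawson c)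
      fun x => c' * exp (-1 * x ^ 2)) {δ : ℝ} (hδ : 0 < δ) :
    RelClose (sectorFilter (φ₀ - Real.pi / 4) (φ₀ + Real.pi / 4) δ)
      (fun x => solution n k c x - solution n k OnePoint.infty x)
      fun x => (1 / c' * (-1) ^ n * (2 : ℂ) ^ (2 * n - m + 1 : ℤ) *
          ((k.factorial : ℂ) / (n.factorial : ℂ))) *
        (x ^ (4 * n - 2 * m + 2 : ℤ) * exp (1 * x ^ 2)) := by
  have hinv : ∀ δ > 0, RelClose (sectorFilter (φ₀ - Real.pi / 4) (φ₀ + Real.pi / 4) δ)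
      (fun x => seed c x + 2 * x) fun x => c'⁻¹ * exp (1 * x ^ 2) := fun δ hδ =>
    ((hc δ hδ).inv (sectorFilter_le_cobounded _ _ _)).congr'
      (Eventually.of_forall fun x => by simp [seed])
      (Eventually.of_forall fun x => by simp only [mul_inv, ← exp_neg]; ring_nf)
  have h1 : RiccatiInSector (φ₀ - Real.pi / 4) (φ₀ + Real.pi / 4) (seed c) := fun δ hδ => by
    filter_upwards [(hc δ hδ).eventually_ne_zero (sectorFilter_le_cobounded _ _ _)
      (Eventually.of_forall fun x => mul_ne_zero hc' (exp_ne_zero _))] with x hx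
    exact hasDerivAt_seed_coe hx
  have h2 : ∀ δ > 0, (fun x => seed c x + 2 * x) =O[sectorFilter (φ₀ - Real.pi / 4)
      (φ₀ + Real.pi / 4) δ] fun x => x ^ (-1 : ℤ) := fun δ hδ =>
    ((hinv δ hδ).isBigO (sectorFilter_le_cobounded _ _ _)).trans
      ((exp_isBigO_zpow hφ (-1) hδ).const_mul_left c'⁻¹)
  obtain ⟨h3, h4⟩ := seed_infty_large (lo := φ₀ - Real.pi / 4) (hi := φ₀ + Real.pi / 4)
  have h5 : RelClose (sectorFilter (φ₀ - Real.pi / 4) (φ₀ + Real.pi / 4) δ)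
      (fun x => seed c x - seed OnePoint.infty x) fun x => c'⁻¹ * exp (1 * x ^ 2) :=
    (hinv δ hδ).congr' (Eventually.of_forall fun x => by simp [seed]) EventuallyEq.rfl
  refine (triple_sub_large h1 h2 h3 h4 hδ h5 k n).congr' EventuallyEq.rfl
    (Eventually.of_forall fun x => ?_)
  have e1 : (4 * n - 2 * m + 2 : ℤ) = 2 * n - 2 * k := by rw [hm]; push_cast; ring
  have e2 : (2 * n - m + 1 : ℤ) = n - k := by rw [hm]; push_cast; ring
  simp only [e1, e2]
  ring

end Family

section Directions

theorem exp_zero_sq : -1 * exp ((0 : ℝ) * I) ^ 2 = (-1 : ℂ) := by simp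

theorem exp_half_pi_sq : 1 * exp ((Real.pi / 2 : ℝ) * I) ^ 2 = (-1 : ℂ) := by
  push_cast
  rw [exp_pi_div_two_mul_I]
  simp

theorem exp_pi_sq : -1 * exp ((Real.pi : ℝ) * I) ^ 2 = (-1 : ℂ) := by
  rw [exp_pi_mul_I]; simp

theorem exp_three_half_pi : exp ((3 * Real.pi / 2 : ℝ) * I) = -I := by
  have : ((3 * Real.pi / 2 : ℝ) : ℂ) * I = Real.pi * I + Real.pi / 2 * I := by push_cast; ring
  rw [this, exp_add, exp_pi_mul_I, exp_pi_div_two_mul_I]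
  ring

theorem exp_three_half_pi_sq : 1 * exp ((3 * Real.pi / 2 : ℝ) * I) ^ 2 = (-1 : ℂ) := by
  rw [exp_three_half_pi]
  simp

theorem dawson_zero : dawson 0 = dawsonLower := by
  funext x; rw [dawson]; ring

theorem dawson_upperParam : dawson upperParam = dawsonUpper := by
  funext x; rw [dawson_eq_upper, upperParam]; ring

variable {δ lo hi : ℝ}

theorem relClose_dawsonLower_of_le (hlo : -(5 * Real.pi / 4) ≤ lo) (hhi : hi ≤ Real.pi / 4)
    (hδ : 0 < δ) : RelClose (sectorFilter lo hi δ) dawsonLower fun x => 1 / 2 * x ^ (-1 : ℤ) :=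
  (relClose_dawsonLower hδ).mono (sectorFilter_mono (by linarith) (by linarith))

theorem relClose_dawsonLower_of_le' (hlo : 3 * Real.pi / 4 ≤ lo) (hhi : hi ≤ 9 * Real.pi / 4)
    (hδ : 0 < δ) : RelClose (sectorFilter lo hi δ) dawsonLower fun x => 1 / 2 * x ^ (-1 : ℤ) :=
  (relClose_dawsonLower hδ).mono ((sectorFilter_sub_two_pi lo hi δ).trans
    (sectorFilter_mono (by linarith) (by linarith)))

theorem relClose_dawsonUpper_of_le (hlo : -(Real.pi / 4) ≤ lo) (hhi : hi ≤ 5 * Real.pi / 4)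
    (hδ : 0 < δ) : RelClose (sectorFilter lo hi δ) dawsonUpper fun x => 1 / 2 * x ^ (-1 : ℤ) :=
  (relClose_dawsonUpper hδ).mono (sectorFilter_mono (by linarith) (by linarith))

theorem relClose_dawson_right (c : ℂ) (hδ : 0 < δ) :
    RelClose (sectorFilter (0 - Real.pi / 4) (0 + Real.pi / 4) δ) (dawson c)
      fun x => 1 / 2 * x ^ (-1 : ℤ) :=
  relClose_add_exp exp_zero_sq hδ (relClose_dawsonLower_of_le (by linarith [Real.pi_pos])
    (by linarith [Real.pi_pos]) hδ) c

theorem relClose_dawson_left (c : ℂ) (hδ : 0 < δ) :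
    RelClose (sectorFilter (Real.pi - Real.pi / 4) (Real.pi + Real.pi / 4) δ) (dawson c)
      fun x => 1 / 2 * x ^ (-1 : ℤ) :=
  (relClose_add_exp exp_pi_sq hδ (relClose_dawsonUpper_of_le (by linarith [Real.pi_pos])
    (by linarith [Real.pi_pos]) hδ) (c + I * (√Real.pi : ℝ))).congr'
    (Eventually.of_forall fun x => (dawson_eq_upper c x).symm) EventuallyEq.rfl

theorem relClose_dawson_top {c : ℂ} (hc : c + I * (√Real.pi : ℝ) ≠ 0) (hδ : 0 < δ) :
    RelClose (sectorFilter (Real.pi / 2 - Real.pi / 4) (Real.pi / 2 + Real.pi / 4) δ) (dawson c)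
      fun x => (c + I * (√Real.pi : ℝ)) * exp (-1 * x ^ 2) :=
  (relClose_add_exp_large exp_half_pi_sq hδ (relClose_dawsonUpper_of_le (by linarith [Real.pi_pos])
    (by linarith [Real.pi_pos]) hδ) hc).congr'
    (Eventually.of_forall fun x => (dawson_eq_upper c x).symm) EventuallyEq.rfl

theorem relClose_dawson_bottom {c : ℂ} (hc : c ≠ 0) (hδ : 0 < δ) :
    RelClose (sectorFilter (3 * Real.pi / 2 - Real.pi / 4) (3 * Real.pi / 2 + Real.pi / 4) δ)
      (dawson c) fun x => c * exp (-1 * x ^ 2) :=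
  relClose_add_exp_large exp_three_half_pi_sq hδ (relClose_dawsonLower_of_le'
    (by linarith [Real.pi_pos]) (by linarith [Real.pi_pos]) hδ) hc

end Directions

section FirstFamily

variable {n k m : ℕ}

theorem background_right (hm : m = n + k + 1) :
    IsBackgroundPair ((n : ℂ) - k) ((2 * (m : ℂ)) ^ 2) 0 (fun x => -(2 * (m : ℂ)) / (2 * x))
      (solution n k (0 : ℂ)) (solution n k upperParam) := by
  refine ⟨solution_isP4Solution hm _, solution_algAsymp_small hm fun δ hδ => ?_,
    solution_isP4Solution hm _, solution_algAsymp_small hm fun δ hδ => ?_⟩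
  · rw [dawson_zero]
    exact relClose_dawsonLower_of_le (by linarith [Real.pi_pos]) (by linarith [Real.pi_pos]) hδ
  · rw [dawson_upperParam]
    exact relClose_dawsonUpper_of_le (by linarith [Real.pi_pos]) (by linarith [Real.pi_pos]) hδ

theorem background_left (hm : m = n + k + 1) :
    IsBackgroundPair ((n : ℂ) - k) ((2 * (m : ℂ)) ^ 2) Real.pi
      (fun x => -(2 * (m : ℂ)) / (2 * x)) (solution n k upperParam) (solution n k (0 : ℂ)) := by
  refine ⟨solution_isP4Solution hm _, solution_algAsymp_small hm fun δ hδ => ?_,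
    solution_isP4Solution hm _, solution_algAsymp_small hm fun δ hδ => ?_⟩
  · rw [dawson_upperParam]
    exact relClose_dawsonUpper_of_le (by linarith [Real.pi_pos]) (by linarith [Real.pi_pos]) hδ
  · rw [dawson_zero]
    exact relClose_dawsonLower_of_le' (by linarith [Real.pi_pos]) (by linarith [Real.pi_pos]) hδ

theorem background_vertical (hm : m = n + k + 1) (φ₀ : ℝ) :
    IsBackgroundPair ((n : ℂ) - k) ((2 * (m : ℂ)) ^ 2) φ₀ (fun x => -2 * x)
      (solution n k OnePoint.infty) (solution n k OnePoint.infty) :=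
  ⟨solution_isP4Solution hm _, solution_algAsymp_infty, solution_isP4Solution hm _,
    solution_algAsymp_infty⟩

theorem solution_right (hm : m = n + k + 1) (c : ℂ) :
    SectorExpAsymp 0 (solution n k (0 : ℂ)) (solution n k upperParam) (2 * n + 2 * m) (-1)
      (fun φ => -(c + I * (√Real.pi : ℝ) * stepTheta φ) *
        (2 ^ (n + m + 1) / ((n.factorial : ℂ) * ((m - 1).factorial : ℂ)))) (solution n k c) := by
  have h := SectorExpAsymp.of_relClose
    (fun δ hδ => solution_sub_small hm (fun δ hδ => relClose_dawson_right c hδ)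
      (fun δ hδ => relClose_dawson_right 0 hδ) hδ)
    (fun δ hδ => solution_sub_small hm (fun δ hδ => relClose_dawson_right c hδ)
      (fun δ hδ => relClose_dawson_right upperParam hδ) hδ)
  convert h using 2 with φ
  rw [sub_zero, upperParam]
  ring

theorem solution_left (hm : m = n + k + 1) (c : ℂ) :
    SectorExpAsymp Real.pi (solution n k upperParam) (solution n k (0 : ℂ)) (2 * n + 2 * m) (-1)
      (fun φ => -(c + I * (√Real.pi : ℝ) * stepTheta (Real.pi - φ)) *
        (2 ^ (n + m + 1) / ((n.factorial : ℂ) * ((m - 1).factorial : ℂ)))) (solution n k c) := by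
  have h := SectorExpAsymp.of_relClose
    (fun δ hδ => solution_sub_small hm (fun δ hδ => relClose_dawson_left c hδ)
      (fun δ hδ => relClose_dawson_left upperParam hδ) hδ)
    (fun δ hδ => solution_sub_small hm (fun δ hδ => relClose_dawson_left c hδ)
      (fun δ hδ => relClose_dawson_left 0 hδ) hδ)
  convert h using 2 with φ
  rw [← neg_sub φ, stepTheta_neg, upperParam]
  ring

theorem solution_top (hm : m = n + k + 1) {c : ℂ} (hc : c + I * (√Real.pi : ℝ) ≠ 0) :
    SectorExpAsymp (Real.pi / 2) (solution n k OnePoint.infty) (solution n k OnePoint.infty)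
      (4 * n - 2 * m + 2) 1
      (fun _ => 1 / (c + I * (√Real.pi : ℝ)) * (-1) ^ n * (2 : ℂ) ^ (2 * n - m + 1 : ℤ) *
        ((k.factorial : ℂ) / (n.factorial : ℂ))) (solution n k c) := by
  have h := SectorExpAsymp.of_relClose
    (fun δ hδ => solution_sub_large hm exp_half_pi_sq hc
      (fun δ hδ => relClose_dawson_top hc hδ) hδ)
    (fun δ hδ => solution_sub_large hm exp_half_pi_sq hc
      (fun δ hδ => relClose_dawson_top hc hδ) hδ)
  convert h using 2 with φ
  ring

theorem solution_bottom (hm : m = n + k + 1) {c : ℂ} (hc : c ≠ 0) :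
    SectorExpAsymp (3 * Real.pi / 2) (solution n k OnePoint.infty) (solution n k OnePoint.infty)
      (4 * n - 2 * m + 2) 1
      (fun _ => 1 / c * (-1) ^ n * (2 : ℂ) ^ (2 * n - m + 1 : ℤ) *
        ((k.factorial : ℂ) / (n.factorial : ℂ))) (solution n k c) := by
  have h := SectorExpAsymp.of_relClose
    (fun δ hδ => solution_sub_large hm exp_three_half_pi_sq hc
      (fun δ hδ => relClose_dawson_bottom hc hδ) hδ)
    (fun δ hδ => solution_sub_large hm exp_three_half_pi_sq hc
      (fun δ hδ => relClose_dawson_bottom hc hδ) hδ)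
  convert h using 2 with φ
  ring

theorem solution_infty_vertical (φ₀ : ℝ) (p : ℤ) (σ : ℂ) :
    SectorExpAsymp φ₀ (solution n k OnePoint.infty) (solution n k OnePoint.infty) p σ
      (fun _ => 0) (solution n k OnePoint.infty) := by
  have h0 : ∀ δ > 0, RelClose (sectorFilter (φ₀ - Real.pi / 4) (φ₀ + Real.pi / 4) δ)
      (fun x => solution n k OnePoint.infty x - solution n k OnePoint.infty x)
      fun x => 0 * (x ^ p * exp (σ * x ^ 2)) := fun δ _ =>
    (RelClose.refl _ fun _ => 0).congr' (Eventually.of_forall fun x => (sub_self _).symm)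
      (Eventually.of_forall fun x => (zero_mul _).symm)
  have h := SectorExpAsymp.of_relClose h0 h0
  convert h using 2 with φ
  ring

theorem solution_top_special (hm : m = n + k + 1) {c : ℂ} (hc : c + I * (√Real.pi : ℝ) = 0) :
    SectorAlgAsymp (Real.pi / 2) (fun x => -(2 * (m : ℂ)) / (2 * x)) (solution n k c) := by
  have e : c = upperParam := eq_neg_of_add_eq_zero_left hc
  refine solution_algAsymp_small hm fun δ hδ => ?_
  rw [e, dawson_upperParam]
  exact relClose_dawsonUpper_of_le (by linarith [Real.pi_pos]) (by linarith [Real.pi_pos]) hδ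

theorem solution_bottom_special (hm : m = n + k + 1) :
    SectorAlgAsymp (3 * Real.pi / 2) (fun x => -(2 * (m : ℂ)) / (2 * x))
      (solution n k (0 : ℂ)) := by
  refine solution_algAsymp_small hm fun δ hδ => ?_
  rw [dawson_zero]
  exact relClose_dawsonLower_of_le' (by linarith [Real.pi_pos]) (by linarith [Real.pi_pos]) hδ

end FirstFamily

end Sectors

/-! ### The quarter turn -/

/-- The symmetry `y(x) ↦ -i y(i x)` of the fourth Painlevé equation, which maps the parameters
`(a, b)` to `(-a, b)`. -/
noncomputable def quarterTurn (y : ℂ → ℂ) (x : ℂ) : ℂ := -I * y (I * x)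

theorem eventually_codiscrete_I_mul {P : ℂ → Prop} (h : ∀ᶠ x in codiscrete ℂ, P x) :
    ∀ᶠ x in codiscrete ℂ, P (I * x) := by
  rw [eventually_codiscrete_iff] at h ⊢
  intro x
  have h1 : Tendsto (fun z : ℂ => I * z) (𝓝[≠] x) (𝓝[≠] (I * x)) := by
    refine tendsto_nhdsWithin_of_tendsto_nhds_of_eventually_within _
      ((continuous_const_mul I).continuousAt.mono_left nhdsWithin_le_nhds) ?_
    filter_upwards [self_mem_nhdsWithin] with z hz h2
    exact hz (mul_left_cancel₀ I_ne_zero h2)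
  exact h1.eventually (h (I * x))

theorem deriv_quarterTurn (y : ℂ → ℂ) : deriv (quarterTurn y) = fun x => deriv y (I * x) := by
  funext x
  have h : quarterTurn y = fun x => -I * (fun z => y (I * z)) x := rfl
  rw [h, deriv_const_mul_field, deriv_comp_mul_left, smul_eq_mul, ← mul_assoc, neg_mul, I_mul_I,
    neg_neg, one_mul]

theorem deriv_deriv_quarterTurn (y : ℂ → ℂ) (x : ℂ) :
    deriv (deriv (quarterTurn y)) x = I * deriv (deriv y) (I * x) := by
  rw [deriv_quarterTurn, deriv_comp_mul_left, smul_eq_mul]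

theorem apply_I_mul (y : ℂ → ℂ) (x : ℂ) : y (I * x) = I * quarterTurn y x := by
  rw [quarterTurn]; linear_combination y (I * x) * I_sq

theorem meromorphicOn_quarterTurn {y : ℂ → ℂ} (h : MeromorphicOn y Set.univ) :
    MeromorphicOn (quarterTurn y) Set.univ := by
  intro x _
  have h1 : AnalyticAt ℂ (fun z : ℂ => I * z) x := by fun_prop
  exact (MeromorphicAt.const (-I) x).mul ((h (I * x) trivial).comp_analyticAt h1)

theorem quarterTurn_ne_zero {y : ℂ → ℂ} {x : ℂ} (h : y (I * x) ≠ 0) : quarterTurn y x ≠ 0 :=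
  mul_ne_zero (neg_ne_zero.2 I_ne_zero) h

theorem IsP4Solution.quarterTurn {a b : ℂ} {y : ℂ → ℂ} (h : IsP4Solution a b y) :
    IsP4Solution (-a) b (quarterTurn y) := by
  refine ⟨meromorphicOn_quarterTurn h.1, ?_⟩
  filter_upwards [eventually_codiscrete_I_mul h.2] with x hx
  refine ⟨quarterTurn_ne_zero hx.1, ?_⟩
  have h0 := quarterTurn_ne_zero hx.1
  rw [deriv_deriv_quarterTurn, hx.2, deriv_quarterTurn, apply_I_mul y]
  set w := _root_.quarterTurn y x
  field_simp
  ring_nf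
  simp only [I_sq, I_pow_four]
  ring

theorem IsRiccatiSolution.quarterTurn {σ q : ℂ} {y : ℂ → ℂ} (h : IsRiccatiSolution σ q y) :
    IsRiccatiSolution (-σ) q (quarterTurn y) := by
  refine ⟨meromorphicOn_quarterTurn h.1, ?_⟩
  filter_upwards [eventually_codiscrete_I_mul h.2] with x hx
  refine ⟨quarterTurn_ne_zero hx.1, ?_⟩
  simp only [deriv_quarterTurn]
  rw [hx.2, apply_I_mul y]
  linear_combination
    σ * (_root_.quarterTurn y x ^ 2 + 2 * x * _root_.quarterTurn y x) * I_sq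

theorem IsTransform.quarterTurn {w f g d f' g' d' : ℂ → ℂ} (h : IsTransform w f g d)
    (h' : ∀ x, d (I * x) ≠ 0 → d' x ≠ 0 ∧
      -I * (f (I * x) + g (I * x) / d (I * x)) = f' x + g' x / d' x) :
    IsTransform (quarterTurn w) f' g' d' := by
  refine ⟨meromorphicOn_quarterTurn h.1, ?_⟩
  filter_upwards [eventually_codiscrete_I_mul h.2] with x hx
  refine ⟨quarterTurn_ne_zero hx.1, (h' x hx.2.1).1, ?_⟩
  rw [← (h' x hx.2.1).2, ← hx.2.2, _root_.quarterTurn]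

/-- The class of classical solutions is invariant under the quarter turn, which interchanges
`R₀⁺` with `R₀⁻` and `R∞⁺` with `R∞⁻`. -/
theorem IsClassical.quarterTurn {a b : ℂ} {y : ℂ → ℂ} (h : IsClassical a b y) :
    IsClassical (-a) b (quarterTurn y) := by
  have key : ∀ {α β : ℂ} {y : ℂ → ℂ}, IsClassical (-(2 * α - β / 2)) (β ^ 2) y →
      IsClassical (2 * -α - -β / 2) ((-β) ^ 2) y := fun {α β y} h => by
    convert h using 1 <;> ring
  have key' : ∀ {α β : ℂ} {y : ℂ → ℂ}, IsClassical (2 * -α - -β / 2) ((-β) ^ 2) y →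
      IsClassical (-(2 * α - β / 2)) (β ^ 2) y := fun {α β y} h => by
    convert h using 1 <;> ring
  induction h with
  | riccati σ q y hσ hy =>
    have h1 := IsClassical.riccati (-σ) q _ (by rw [neg_sq, hσ]) hy.quarterTurn
    convert h1 using 1
    ring
  | zero_plus α β α' β' y w _ hα hβ hw ih =>
    refine key' (IsClassical.zero_minus (-α) (-β) (-α') (-β') _ _ (key ih)
      (by rw [hα]; ring) (by linear_combination -hβ) (hw.quarterTurn fun x hx => ?_))
    simp only [deriv_quarterTurn, _root_.quarterTurn]
    have e : deriv y (I * x) + (-I * y (I * x)) ^ 2 + 2 * x * (-I * y (I * x)) + -β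
        = deriv y (I * x) - y (I * x) ^ 2 - 2 * (I * x) * y (I * x) - β := by
      linear_combination y (I * x) ^ 2 * I_sq
    rw [e]
    exact ⟨hx, by ring⟩
  | zero_minus α β α' β' y w _ hα hβ hw ih =>
    refine key' (IsClassical.zero_plus (-α) (-β) (-α') (-β') _ _ (key ih)
      (by rw [hα]; ring) (by linear_combination -hβ) (hw.quarterTurn fun x hx => ?_))
    simp only [deriv_quarterTurn, _root_.quarterTurn]
    have e : deriv y (I * x) - (-I * y (I * x)) ^ 2 - 2 * x * (-I * y (I * x)) - -β
        = deriv y (I * x) + y (I * x) ^ 2 + 2 * (I * x) * y (I * x) + β := by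
      linear_combination -y (I * x) ^ 2 * I_sq
    rw [e]
    exact ⟨hx, by ring⟩
  | infty_plus α β α' β' y w _ hα hβ hw ih =>
    refine key' (IsClassical.infty_minus (-α) (-β) (-α') (-β') _ _ (key ih)
      (by rw [hα]) (by linear_combination -hβ) (hw.quarterTurn fun x hx => ?_))
    simp only [deriv_quarterTurn, _root_.quarterTurn]
    have hy : y (I * x) ≠ 0 := right_ne_zero_of_mul hx
    refine ⟨mul_ne_zero two_ne_zero (mul_ne_zero (neg_ne_zero.2 I_ne_zero) hy), ?_⟩
    have hI := I_ne_zero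
    field_simp
    ring_nf
    simp only [I_pow_three]
    ring_nf
    simp only [I_sq]
    ring
  | infty_minus α β α' β' y w _ hα hβ hw ih =>
    refine key' (IsClassical.infty_plus (-α) (-β) (-α') (-β') _ _ (key ih)
      (by rw [hα]) (by linear_combination -hβ) (hw.quarterTurn fun x hx => ?_))
    simp only [deriv_quarterTurn, _root_.quarterTurn]
    have hy : y (I * x) ≠ 0 := right_ne_zero_of_mul hx
    refine ⟨mul_ne_zero two_ne_zero (mul_ne_zero (neg_ne_zero.2 I_ne_zero) hy), ?_⟩
    have hI := I_ne_zero
    field_simp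
    ring_nf
    simp only [I_pow_three]
    ring_nf
    simp only [I_sq]
    ring

section Turn

variable {θ : ℝ}

theorem I_mul_polarPt (hθ : exp (θ * I) = I) (r φ : ℝ) :
    I * polarPt r φ = polarPt r (φ + θ) := by
  rw [polarPt_add, hθ]

theorem AlgAsymp.quarterTurn (hθ : exp (θ * I) = I) {lo hi lo' hi' : ℝ} {L L' y : ℂ → ℂ}
    (h : AlgAsymp lo hi L y) (hlo : lo = lo' + θ) (hhi : hi = hi' + θ)
    (hL : ∀ x, L (I * x) = I * L' x) :
    AlgAsymp lo' hi' L' (quarterTurn y) := by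
  intro δ hδ
  obtain ⟨C, R, hR0, hR⟩ := h δ hδ
  refine ⟨C, R, hR0, fun r φ hr h1 h2 => ?_⟩
  have h3 := hR r (φ + θ) hr (by linarith) (by linarith)
  rw [← I_mul_polarPt hθ, apply_I_mul y, hL, ← mul_sub, norm_mul, norm_mul, norm_I, one_mul,
    one_mul] at h3
  exact h3

theorem IsBackgroundPair.quarterTurn (hθ : exp (θ * I) = I) {a b : ℂ} {φ₀ φ₁ : ℝ}
    {L L' Bm Bp : ℂ → ℂ} (h : IsBackgroundPair a b φ₀ L Bm Bp) (hφ : φ₀ = φ₁ + θ)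
    (hL : ∀ x, L (I * x) = I * L' x) :
    IsBackgroundPair (-a) b φ₁ L' (quarterTurn Bm) (quarterTurn Bp) :=
  ⟨h.1.quarterTurn, h.2.1.quarterTurn hθ (by rw [hφ]; ring) (by rw [hφ]; ring) hL,
    h.2.2.1.quarterTurn, h.2.2.2.quarterTurn hθ (by rw [hφ]; ring) (by rw [hφ]; ring) hL⟩

theorem SectorAlgAsymp.quarterTurn (hθ : exp (θ * I) = I) {φ₀ φ₁ : ℝ} {L L' y : ℂ → ℂ}
    (h : SectorAlgAsymp φ₀ L y) (hφ : φ₀ = φ₁ + θ) (hL : ∀ x, L (I * x) = I * L' x) :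
    SectorAlgAsymp φ₁ L' (quarterTurn y) :=
  AlgAsymp.quarterTurn hθ h (by rw [hφ]; ring) (by rw [hφ]; ring) hL

theorem SectorExpAsymp.quarterTurn (hθ : exp (θ * I) = I) {φ₀ φ₁ : ℝ} {Bm Bp y : ℂ → ℂ} {p : ℤ}
    {σ : ℂ} {μ ν : ℝ → ℂ} (h : SectorExpAsymp φ₀ Bm Bp p σ μ y) (hφ : φ₀ = φ₁ + θ)
    (hν : ∀ φ, ν φ = -I * I ^ p * μ (φ + θ)) :
    SectorExpAsymp φ₁ (quarterTurn Bm) (quarterTurn Bp) p (-σ) ν (quarterTurn y) := by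
  intro δ hδ
  obtain ⟨C, R, hR0, hR⟩ := h δ hδ
  refine ⟨C, R, hR0, fun r φ hr h1 h2 x B e hx hB he => ?_⟩
  have h3 := hR r (φ + θ) hr (by rw [hφ]; linarith) (by rw [hφ]; linarith) (I * x) (I * B)
    (I ^ p * e) (by rw [hx, I_mul_polarPt hθ])
    (by rw [hB, apply_I_mul Bm, apply_I_mul Bp, hφ, add_sub_add_right_eq_sub]; ring)
    (by rw [he, mul_zpow, mul_pow, I_sq]; ring_nf)
  have hIp : ‖(I : ℂ) ^ p‖ = 1 := by rw [norm_zpow, norm_I, one_zpow]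
  have e1 : y (I * x) - (I * B + μ (φ + θ) * (I ^ p * e))
      = I * (_root_.quarterTurn y x - (B + ν φ * e)) := by
    rw [apply_I_mul y, hν]
    linear_combination (-(I ^ p * μ (φ + θ) * e)) * I_sq
  have e2 : ‖μ (φ + θ) * (I ^ p * e)‖ = ‖ν φ * e‖ := by
    rw [hν]
    simp only [norm_mul, norm_neg, norm_I, hIp]
    ring
  have e3 : ‖I ^ p * e‖ = ‖e‖ := by rw [norm_mul, hIp, one_mul]
  rw [e1, e2, e3, norm_mul, norm_I, one_mul] at h3
  refine ⟨h3.1, fun h4 => h3.2 ?_⟩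
  rcases h4 with h4 | h4
  · exact Or.inl fun h5 => h4 (by linarith)
  · refine Or.inr fun h5 => h4 ?_
    rw [hν, h5, mul_zero]

end Turn

/-! ### The second family -/

theorem I_zpow_two_mul (j : ℤ) : I ^ (2 * j) = (-1 : ℂ) ^ j := by
  rw [zpow_mul, zpow_ofNat, I_sq]

theorem neg_one_pow_mul_self (k : ℕ) : (-1 : ℂ) ^ k * (-1) ^ k = 1 := by
  rw [← mul_pow]; simp

theorem exp_neg_three_half_pi : exp ((-(3 * Real.pi / 2) : ℝ) * I) = I := by
  rw [Complex.ofReal_neg, neg_mul, exp_neg, exp_three_half_pi, inv_neg, inv_I, neg_neg]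

theorem exp_half_pi : exp ((Real.pi / 2 : ℝ) * I) = I := by
  push_cast; exact exp_pi_div_two_mul_I

/-- The correspondence between the parameters of the two families under the quarter turn. -/
noncomputable def turnParam (c : OnePoint ℂ) : OnePoint ℂ :=
  c.elim ((upperParam : ℂ) : OnePoint ℂ) fun c => open Classical in
    if c = 0 then OnePoint.infty else ((upperParam + 1 / (2 * I * c) : ℂ) : OnePoint ℂ)

theorem turnParam_infty : turnParam OnePoint.infty = (upperParam : OnePoint ℂ) := rfl

theorem turnParam_zero : turnParam ((0 : ℂ) : OnePoint ℂ) = OnePoint.infty := if_pos rfl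

theorem turnParam_coe {c : ℂ} (hc : c ≠ 0) :
    turnParam (c : OnePoint ℂ) = ((upperParam + 1 / (2 * I * c) : ℂ) : OnePoint ℂ) := if_neg hc

/-- The classical solutions of the second family, with `m = n + k + 1`. -/
noncomputable def turnedSolution (n k : ℕ) (c : OnePoint ℂ) : ℂ → ℂ :=
  quarterTurn (solution k n (turnParam c))

section SecondFamily

variable {n k m : ℕ}

theorem smallTail_turn (m : ℕ) (x : ℂ) :
    -(2 * (m : ℂ)) / (2 * (I * x)) = I * ((2 * (m : ℂ)) / (2 * x)) := by
  simp only [div_eq_mul_inv, mul_inv, inv_I]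
  ring

theorem dominant_turn (x : ℂ) : -2 * (I * x) = I * (-2 * x) := by ring

theorem vertical_coefficient (hm : m = n + k + 1) (d : ℂ) :
    -I / (2 * d) * (-1) ^ n * (2 : ℂ) ^ (m - 2 * n : ℤ) *
      ((n.factorial : ℂ) / (k.factorial : ℂ)) = -I * I ^ (2 * (m : ℤ) - 4 * n - 2) *
      (1 / d * (-1) ^ k * (2 : ℂ) ^ (2 * k - m + 1 : ℤ) *
        ((n.factorial : ℂ) / (k.factorial : ℂ))) := by
  have e1 : (2 * (m : ℤ) - 4 * n - 2) = 2 * ((k : ℤ) - n) := by rw [hm]; push_cast; ring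
  have e2 : ((m : ℤ) - 2 * n) = k - n + 1 := by rw [hm]; push_cast; ring
  have e3 : (2 * (k : ℤ) - m + 1) = k - n := by rw [hm]; push_cast; ring
  have e4 : (-1 : ℂ) ^ ((k : ℤ) - n) * (-1) ^ k = (-1) ^ n := by
    rw [zpow_sub₀ (by norm_num), zpow_natCast, zpow_natCast, div_mul_eq_mul_div,
      neg_one_pow_mul_self, div_eq_iff (pow_ne_zero _ (by norm_num)), neg_one_pow_mul_self]
  rw [e1, e2, e3, I_zpow_two_mul, zpow_add_one₀ two_ne_zero, ← e4]
  rw [div_eq_mul_inv (-I), mul_inv]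
  ring

theorem horizontal_coefficient (hm : m = n + k + 1) (d t : ℂ) :
    -(d + 2 * (√Real.pi : ℝ) * t) * (-1) ^ n *
      ((2 : ℂ) ^ (2 * m - n - 1 : ℤ) / (((m - 1).factorial : ℂ) * (k.factorial : ℂ))) =
    -I * I ^ (4 * (m : ℤ) - 2 * n - 2) * (-(upperParam + d / (2 * I) + I * (√Real.pi : ℝ) * (1 - t))
      * (2 ^ (k + m + 1) / ((k.factorial : ℂ) * ((m - 1).factorial : ℂ)))) := by
  have e1 : (4 * (m : ℤ) - 2 * n - 2) = 2 * ((2 * k + (n + 1) : ℕ) : ℤ) := by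
    rw [hm]; push_cast; ring
  have e2 : (2 * (m : ℤ) - n - 1) = ((k + m : ℕ) : ℤ) := by rw [hm]; push_cast; ring
  have e4 : (-1 : ℂ) ^ (2 * k + (n + 1)) = -(-1) ^ n := by
    rw [pow_add, pow_mul, neg_one_sq, one_pow, one_mul, pow_succ, mul_neg_one]
  have hd : d / (2 * I) = -(d * I / 2) := by
    rw [div_eq_mul_inv, mul_inv, inv_I]; ring
  rw [e1, e2, I_zpow_two_mul, zpow_natCast, zpow_natCast, e4, hd, upperParam, pow_succ 2 (k + m)]
  linear_combination (-(d + 2 * (√Real.pi : ℝ) * t) * (-1) ^ n * (2 ^ (k + m)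
    / (((m - 1).factorial : ℂ) * (k.factorial : ℂ)))) * I_sq

/-- The asymptotics of the first family in a vertical sector, where `-2 x` dominates, turned into
the asymptotics of the second family in a horizontal sector. -/
theorem turned_vertical (hm : m = n + k + 1) {φ₀ φ₁ θ : ℝ} (hθ : exp (θ * I) = I)
    (hφ : φ₀ = φ₁ + θ) {c : OnePoint ℂ} {d ν : ℂ} (hν : ν = -I / (2 * d))
    (h : SectorExpAsymp φ₀ (solution k n OnePoint.infty) (solution k n OnePoint.infty)
      (4 * k - 2 * m + 2) 1
      (fun _ => 1 / d * (-1) ^ k * (2 : ℂ) ^ (2 * k - m + 1 : ℤ) *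
        ((n.factorial : ℂ) / (k.factorial : ℂ))) (solution k n c)) :
    SectorExpAsymp φ₁ (quarterTurn (solution k n OnePoint.infty))
      (quarterTurn (solution k n OnePoint.infty)) (2 * m - 4 * n - 2) (-1)
      (fun _ => ν * (-1) ^ n * (2 : ℂ) ^ (m - 2 * n : ℤ) *
        ((n.factorial : ℂ) / (k.factorial : ℂ))) (quarterTurn (solution k n c)) := by
  have e : (4 * (k : ℤ) - 2 * m + 2) = 2 * m - 4 * n - 2 := by rw [hm]; push_cast; ring
  rw [e] at h
  exact h.quarterTurn hθ hφ fun φ => by rw [hν]; exact vertical_coefficient hm d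

/-- The asymptotics of the first family in a horizontal sector, where `y` is small, turned into the
asymptotics of the second family in a vertical sector. The parameter `d` is measured from
`c = -i √π` instead of `c = 0`, so that the step function is replaced by its complement. -/
theorem turned_horizontal (hm : m = n + k + 1) {φ₀ φ₁ θ : ℝ} (hθ : exp (θ * I) = I)
    (hφ : φ₀ = φ₁ + θ) {Bm Bp : ℂ → ℂ} {t s : ℝ → ℂ} (hts : ∀ φ, s (φ + θ) = 1 - t φ) {c d : ℂ}
    (hc : c = upperParam + d / (2 * I))
    (h : SectorExpAsymp φ₀ Bm Bp (2 * k + 2 * m) (-1)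
      (fun φ => -(c + I * (√Real.pi : ℝ) * s φ) *
        (2 ^ (k + m + 1) / ((k.factorial : ℂ) * ((m - 1).factorial : ℂ)))) (solution k n c)) :
    SectorExpAsymp φ₁ (quarterTurn Bm) (quarterTurn Bp) (4 * m - 2 * n - 2) 1
      (fun φ => -(d + 2 * (√Real.pi : ℝ) * t φ) * (-1) ^ n *
        ((2 : ℂ) ^ (2 * m - n - 1 : ℤ) / (((m - 1).factorial : ℂ) * (k.factorial : ℂ))))
      (quarterTurn (solution k n c)) := by
  have e : (2 * (k : ℤ) + 2 * m) = 4 * m - 2 * n - 2 := by rw [hm]; push_cast; ring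
  rw [e] at h
  have h1 := h.quarterTurn hθ hφ (ν := fun φ => -(d + 2 * (√Real.pi : ℝ) * t φ) * (-1) ^ n *
        ((2 : ℂ) ^ (2 * m - n - 1 : ℤ) / (((m - 1).factorial : ℂ) * (k.factorial : ℂ))))
    fun φ => by rw [hts, hc]; exact horizontal_coefficient hm d (t φ)
  rwa [neg_neg] at h1

end SecondFamily

theorem theorem6 (n m : ℕ) (hm : n + 1 ≤ m) (α β : ℂ) (hα : α = 1 / 2 + n) (hβ : β = 2 * m) :
    -- first family
    (∃ (y : OnePoint ℂ → ℂ → ℂ) (Bm Bp : Fin 4 → ℂ → ℂ),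
      (∀ c : OnePoint ℂ, IsP4Solution (2 * α - β / 2) (β ^ 2) (y c) ∧
        IsClassical (2 * α - β / 2) (β ^ 2) (y c)) ∧
      -- algebraic backgrounds
      IsBackgroundPair (2 * α - β / 2) (β ^ 2) 0 (fun x => -β / (2 * x)) (Bm 0) (Bp 0) ∧
      IsBackgroundPair (2 * α - β / 2) (β ^ 2) (Real.pi / 2) (fun x => -2 * x) (Bm 1) (Bp 1) ∧
      IsBackgroundPair (2 * α - β / 2) (β ^ 2) Real.pi (fun x => -β / (2 * x)) (Bm 2) (Bp 2) ∧
      IsBackgroundPair (2 * α - β / 2) (β ^ 2) (3 * Real.pi / 2) (fun x => -2 * x)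
        (Bm 3) (Bp 3) ∧
      -- sector i
      (∀ c : ℂ, SectorExpAsymp 0 (Bm 0) (Bp 0) (2 * n + 2 * m) (-1)
        (fun φ => -(c + I * (√Real.pi : ℝ) * stepTheta φ) *
          (2 ^ (n + m + 1) / ((n.factorial : ℂ) * ((m - 1).factorial : ℂ)))) (y (c : ℂ))) ∧
      SectorAlgAsymp 0 (fun x => -2 * x) (y OnePoint.infty) ∧
      -- sector ii
      (∀ c : ℂ, c + I * (√Real.pi : ℝ) ≠ 0 →
        SectorExpAsymp (Real.pi / 2) (Bm 1) (Bp 1) (4 * n - 2 * m + 2) 1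
        (fun _ => 1 / (c + I * (√Real.pi : ℝ)) * (-1) ^ n * (2 : ℂ) ^ (2 * n - m + 1 : ℤ) *
          (((m - n - 1).factorial : ℂ) / (n.factorial : ℂ))) (y (c : ℂ))) ∧
      (∀ c : ℂ, c + I * (√Real.pi : ℝ) = 0 →
        SectorAlgAsymp (Real.pi / 2) (fun x => -β / (2 * x)) (y (c : ℂ))) ∧
      SectorExpAsymp (Real.pi / 2) (Bm 1) (Bp 1) (4 * n - 2 * m + 2) 1 (fun _ => 0)
        (y OnePoint.infty) ∧
      -- sector iii
      (∀ c : ℂ, SectorExpAsymp Real.pi (Bm 2) (Bp 2) (2 * n + 2 * m) (-1)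
        (fun φ => -(c + I * (√Real.pi : ℝ) * stepTheta (Real.pi - φ)) *
          (2 ^ (n + m + 1) / ((n.factorial : ℂ) * ((m - 1).factorial : ℂ)))) (y (c : ℂ))) ∧
      SectorAlgAsymp Real.pi (fun x => -2 * x) (y OnePoint.infty) ∧
      -- sector iv
      (∀ c : ℂ, c ≠ 0 →
        SectorExpAsymp (3 * Real.pi / 2) (Bm 3) (Bp 3) (4 * n - 2 * m + 2) 1
        (fun _ => 1 / c * (-1) ^ n * (2 : ℂ) ^ (2 * n - m + 1 : ℤ) *
          (((m - n - 1).factorial : ℂ) / (n.factorial : ℂ))) (y (c : ℂ))) ∧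
      SectorAlgAsymp (3 * Real.pi / 2) (fun x => -β / (2 * x)) (y ((0 : ℂ) : OnePoint ℂ)) ∧
      SectorExpAsymp (3 * Real.pi / 2) (Bm 3) (Bp 3) (4 * n - 2 * m + 2) 1 (fun _ => 0)
        (y OnePoint.infty)) ∧
    -- second family
    (∃ (y : OnePoint ℂ → ℂ → ℂ) (Bm Bp : Fin 4 → ℂ → ℂ),
      (∀ c : OnePoint ℂ, IsP4Solution (2 * α - β / 2) (β ^ 2) (y c) ∧
        IsClassical (2 * α - β / 2) (β ^ 2) (y c)) ∧
      -- algebraic backgrounds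
      IsBackgroundPair (2 * α - β / 2) (β ^ 2) 0 (fun x => -2 * x) (Bm 0) (Bp 0) ∧
      IsBackgroundPair (2 * α - β / 2) (β ^ 2) (Real.pi / 2) (fun x => β / (2 * x))
        (Bm 1) (Bp 1) ∧
      IsBackgroundPair (2 * α - β / 2) (β ^ 2) Real.pi (fun x => -2 * x) (Bm 2) (Bp 2) ∧
      IsBackgroundPair (2 * α - β / 2) (β ^ 2) (3 * Real.pi / 2) (fun x => β / (2 * x))
        (Bm 3) (Bp 3) ∧
      -- sector i
      (∀ c : ℂ, SectorExpAsymp 0 (Bm 0) (Bp 0) (2 * m - 4 * n - 2) (-1)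
        (fun _ => c * (-1) ^ n * (2 : ℂ) ^ (m - 2 * n : ℤ) *
          ((n.factorial : ℂ) / ((m - n - 1).factorial : ℂ))) (y (c : ℂ))) ∧
      SectorAlgAsymp 0 (fun x => β / (2 * x)) (y OnePoint.infty) ∧
      -- sector ii
      (∀ c : ℂ, c ≠ 0 →
        SectorExpAsymp (Real.pi / 2) (Bm 1) (Bp 1) (4 * m - 2 * n - 2) 1
        (fun φ => -(1 / c + 2 * (√Real.pi : ℝ) * stepTheta (φ - Real.pi / 2)) * (-1) ^ n *
          ((2 : ℂ) ^ (2 * m - n - 1 : ℤ) /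
            (((m - 1).factorial : ℂ) * ((m - n - 1).factorial : ℂ)))) (y (c : ℂ))) ∧
      SectorAlgAsymp (Real.pi / 2) (fun x => -2 * x) (y ((0 : ℂ) : OnePoint ℂ)) ∧
      SectorExpAsymp (Real.pi / 2) (Bm 1) (Bp 1) (4 * m - 2 * n - 2) 1
        (fun φ => -(2 * (√Real.pi : ℝ) * stepTheta (φ - Real.pi / 2)) * (-1) ^ n *
          ((2 : ℂ) ^ (2 * m - n - 1 : ℤ) /
            (((m - 1).factorial : ℂ) * ((m - n - 1).factorial : ℂ)))) (y OnePoint.infty) ∧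
      -- sector iii
      (∀ c : ℂ, 1 + 2 * (√Real.pi : ℝ) * c ≠ 0 →
        SectorExpAsymp Real.pi (Bm 2) (Bp 2) (2 * m - 4 * n - 2) (-1)
        (fun _ => c / (1 + 2 * (√Real.pi : ℝ) * c) * (-1) ^ n * (2 : ℂ) ^ (m - 2 * n : ℤ) *
          ((n.factorial : ℂ) / ((m - n - 1).factorial : ℂ))) (y (c : ℂ))) ∧
      (∀ c : ℂ, 1 + 2 * (√Real.pi : ℝ) * c = 0 →
        SectorAlgAsymp Real.pi (fun x => β / (2 * x)) (y (c : ℂ))) ∧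
      SectorExpAsymp Real.pi (Bm 2) (Bp 2) (2 * m - 4 * n - 2) (-1)
        (fun _ => 1 / (2 * (√Real.pi : ℝ)) * (-1) ^ n * (2 : ℂ) ^ (m - 2 * n : ℤ) *
          ((n.factorial : ℂ) / ((m - n - 1).factorial : ℂ))) (y OnePoint.infty) ∧
      -- sector iv
      (∀ c : ℂ, c ≠ 0 →
        SectorExpAsymp (3 * Real.pi / 2) (Bm 3) (Bp 3) (4 * m - 2 * n - 2) 1
        (fun φ => -(1 / c + 2 * (√Real.pi : ℝ) * stepTheta (3 * Real.pi / 2 - φ)) * (-1) ^ n *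
          ((2 : ℂ) ^ (2 * m - n - 1 : ℤ) /
            (((m - n - 1).factorial : ℂ) * ((m - 1).factorial : ℂ)))) (y (c : ℂ))) ∧
      SectorAlgAsymp (3 * Real.pi / 2) (fun x => -2 * x) (y ((0 : ℂ) : OnePoint ℂ)) ∧
      SectorExpAsymp (3 * Real.pi / 2) (Bm 3) (Bp 3) (4 * m - 2 * n - 2) 1
        (fun φ => -(2 * (√Real.pi : ℝ) * stepTheta (3 * Real.pi / 2 - φ)) * (-1) ^ n *
          ((2 : ℂ) ^ (2 * m - n - 1 : ℤ) /
            (((m - n - 1).factorial : ℂ) * ((m - 1).factorial : ℂ)))) (y OnePoint.infty)) := by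
  obtain ⟨k, hk⟩ := Nat.exists_eq_add_of_le hm
  have hm1 : m = n + k + 1 := by omega
  have hm2 : m = k + n + 1 := by omega
  have hk' : m - n - 1 = k := by omega
  have ha : 2 * α - β / 2 = (n : ℂ) - k := by rw [hα, hβ, hm1]; push_cast; ring
  have ha' : (n : ℂ) - k = -((k : ℂ) - n) := by ring
  have hpi : ((√Real.pi : ℝ) : ℂ) ≠ 0 :=
    Complex.ofReal_ne_zero.2 (Real.sqrt_ne_zero'.2 Real.pi_pos)
  rw [ha, hβ, hk']
  refine ⟨⟨solution n k, ![solution n k ((0 : ℂ) : OnePoint ℂ), solution n k OnePoint.infty,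
      solution n k (upperParam : OnePoint ℂ), solution n k OnePoint.infty],
    ![solution n k (upperParam : OnePoint ℂ), solution n k OnePoint.infty,
      solution n k ((0 : ℂ) : OnePoint ℂ), solution n k OnePoint.infty],
    fun c => ⟨solution_isP4Solution hm1 c, solution_isClassical hm1 c⟩,
    background_right hm1, background_vertical hm1 _, background_left hm1,
    background_vertical hm1 _, solution_right hm1, solution_algAsymp_infty,
    fun c hc => solution_top hm1 hc, fun c hc => solution_top_special hm1 hc,
    solution_infty_vertical _ _ _, solution_left hm1, solution_algAsymp_infty,
    fun c hc => solution_bottom hm1 hc, solution_bottom_special hm1,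
    solution_infty_vertical _ _ _⟩, ?_⟩
  have ht1 : ∀ φ : ℝ, stepTheta (Real.pi - (φ + Real.pi / 2)) = 1 - stepTheta (φ - Real.pi / 2) :=
    fun φ => by rw [← stepTheta_neg]; congr 1; ring
  have ht2 : ∀ φ : ℝ, stepTheta (φ + -(3 * Real.pi / 2)) = 1 - stepTheta (3 * Real.pi / 2 - φ) :=
    fun φ => by rw [← stepTheta_neg]; congr 1; ring
  have hp1 : Real.pi / 2 = 0 + Real.pi / 2 := by ring
  have hp2 : Real.pi = Real.pi / 2 + Real.pi / 2 := by ring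
  have hp3 : 3 * Real.pi / 2 = Real.pi + Real.pi / 2 := by ring
  have hp4 : (0 : ℝ) = 3 * Real.pi / 2 + -(3 * Real.pi / 2) := by ring
  -- The fourth sector comes from the first one of the first family, by the angle `π/2 - 2π`.
  refine ⟨turnedSolution n k,
    ![quarterTurn (solution k n OnePoint.infty), quarterTurn (solution k n upperParam),
      quarterTurn (solution k n OnePoint.infty), quarterTurn (solution k n (0 : ℂ))],
    ![quarterTurn (solution k n OnePoint.infty), quarterTurn (solution k n (0 : ℂ)),
      quarterTurn (solution k n OnePoint.infty), quarterTurn (solution k n upperParam)],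
    fun c => ?_, ?_, ?_, ?_, ?_, fun c => ?_, ?_, fun c hc => ?_, ?_, ?_, fun c hc => ?_,
    fun c hc => ?_, ?_, fun c hc => ?_, ?_, ?_⟩
  · rw [ha']
    exact ⟨(solution_isP4Solution hm2 _).quarterTurn, (solution_isClassical hm2 _).quarterTurn⟩
  · rw [ha']
    exact (background_vertical hm2 (Real.pi / 2)).quarterTurn exp_half_pi hp1 dominant_turn
  · rw [ha']
    exact (background_left hm2).quarterTurn exp_half_pi hp2 (smallTail_turn m)
  · rw [ha']
    exact (background_vertical hm2 (3 * Real.pi / 2)).quarterTurn exp_half_pi hp3 dominant_turn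
  · rw [ha']
    exact (background_right hm2).quarterTurn exp_neg_three_half_pi hp4 (smallTail_turn m)
  · rcases eq_or_ne c 0 with rfl | hc
    · rw [turnedSolution, turnParam_zero]
      exact (solution_infty_vertical (Real.pi / 2) _ 1).quarterTurn exp_half_pi hp1
        fun φ => by simp
    · rw [turnedSolution, turnParam_coe hc]
      have hd : upperParam + 1 / (2 * I * c) + I * (√Real.pi : ℝ) = 1 / (2 * I * c) := by
        rw [upperParam]; ring
      have hd0 : (1 : ℂ) / (2 * I * c) ≠ 0 :=
        one_div_ne_zero (mul_ne_zero (mul_ne_zero two_ne_zero I_ne_zero) hc)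
      refine turned_vertical hm1 exp_half_pi hp1 ?_ (solution_top hm2 (by rwa [hd]))
      rw [hd]
      field_simp
      rw [I_sq, neg_neg]
  · exact (solution_top_special hm2 (neg_add_cancel _)).quarterTurn exp_half_pi hp1
      (smallTail_turn m)
  · rw [turnedSolution, turnParam_coe hc]
    exact turned_horizontal hm1 exp_half_pi hp2 ht1
      (by rw [div_div, mul_comm c]) (solution_left hm2 _)
  · rw [turnedSolution, turnParam_zero]
    exact SectorAlgAsymp.quarterTurn exp_half_pi solution_algAsymp_infty hp2 dominant_turn
  · have h := turned_horizontal hm1 exp_half_pi hp2 ht1 (d := 0) (by simp)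
      (solution_left hm2 upperParam)
    simp only [zero_add] at h
    exact h
  · rcases eq_or_ne c 0 with rfl | hc0
    · rw [turnedSolution, turnParam_zero]
      exact (solution_infty_vertical (3 * Real.pi / 2) _ 1).quarterTurn exp_half_pi hp3
        fun φ => by simp
    · rw [turnedSolution, turnParam_coe hc0]
      have hd : upperParam + 1 / (2 * I * c) = (1 + 2 * (√Real.pi : ℝ) * c) / (2 * I * c) := by
        rw [upperParam]
        field_simp
        rw [I_sq]
        ring
      refine turned_vertical hm1 exp_half_pi hp3 ?_ (solution_bottom hm2 ?_)
      · rw [hd]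
        field_simp
        rw [I_sq]
        ring
      · rw [hd]
        exact div_ne_zero hc (mul_ne_zero (mul_ne_zero two_ne_zero I_ne_zero) hc0)
  · have hc0 : c ≠ 0 := by
      rintro rfl
      simp at hc
    have hd : upperParam + 1 / (2 * I * c) = 0 := by
      have : upperParam + 1 / (2 * I * c) = (1 + 2 * (√Real.pi : ℝ) * c) / (2 * I * c) := by
        rw [upperParam]
        field_simp
        rw [I_sq]
        ring
      rw [this, hc, zero_div]
    rw [turnedSolution, turnParam_coe hc0, hd]
    exact (solution_bottom_special hm2).quarterTurn exp_half_pi hp3 (smallTail_turn m)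
  · rw [turnedSolution, turnParam_infty]
    refine turned_vertical hm1 exp_half_pi hp3 ?_ (solution_bottom hm2 ?_)
    · rw [upperParam]
      field_simp
    · exact neg_ne_zero.2 (mul_ne_zero I_ne_zero hpi)
  · rw [turnedSolution, turnParam_coe hc]
    have h := turned_horizontal hm1 exp_neg_three_half_pi hp4 ht2
      (by rw [div_div, mul_comm c]) (solution_right hm2 (upperParam + 1 / (2 * I * c)))
    rw [mul_comm ((m - 1).factorial : ℂ)] at h
    exact h
  · rw [turnedSolution, turnParam_zero]
    exact SectorAlgAsymp.quarterTurn exp_neg_three_half_pi solution_algAsymp_infty hp4 dominant_turn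
  · have h := turned_horizontal hm1 exp_neg_three_half_pi hp4 ht2 (d := 0) (by simp)
      (solution_right hm2 upperParam)
    simp only [zero_add] at h
    rw [mul_comm ((m - 1).factorial : ℂ)] at h
    exact h
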